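/- **Setting.** For $k\in[0,1)$ let $F(\varphi,k)=\int_0^\varphi \frac{d\theta}{\sqrt{1-k^2\sin^2\theta}}$ and $K(k)=F(\pi/2,k)$. Let $\mathrm{am}(\cdot;k)$ be the inverse of $F(\cdot,k)$, $\mathrm{sn}=\sin\mathrm{am}$, and $\mathrm{dn}(u;k)=\sqrt{1-k^2\,\mathrm{sn}^2(u;k)}$. Let $\mathrm{dn}^{-1}(\cdot\,;k):[\sqrt{1-k^2},1]\to[0,K(k)]$ be the inverse of $\mathrm{dn}(\cdot\,;k)$ restricted to $[0,K(k)]$. For $\omega>Z^2/4$ put $$\theta(\omega,Z)=-\tfrac{\sqrt2}{4}|Z|+\sqrt{\omega-\tfrac{Z^2}{8}},\qquad \lambda(\omega,Z)=\tfrac{\sqrt2}{4}|Z|+\sqrt{\omega-\tfrac{Z^2}{8}},$$ and for $\eta\in(0,\theta(\omega,Z))$ put $$\eta_1=\sqrt{2\omega-\eta^2},\quad k^2=\frac{2\omega-2\eta^2}{2\omega-\eta^2},\quad \Phi^2=\tfrac12\Big[(2\omega-\tfrac{Z^2}{2})+\sqrt{(2\omega-\tfrac{Z^2}{2})^2-4\eta^2(2\omega-\eta^2)}\Big],$$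 $$a(\eta,\omega,Z)=\mathrm{dn}^{-1}\big(\Phi/\eta_1;k\big)\in[0,K(k)],\qquad T_+(\eta,\omega,Z)=\frac{2\sqrt2}{\eta_1}\big[K(k)+a(\eta,\omega,Z)\big],$$ with $k,\Phi\ge 0$. For $Z\ne0$ put also $$T_1(\omega,Z)=\frac{2\sqrt2}{\lambda}\,[K(k_0)+a_0],\qquad k_0^2=\frac{\sqrt2\,|Z|\sqrt{\omega-Z^2/8}}{\lambda^2},\qquad a_0=\mathrm{dn}^{-1}\Big(\frac{\sqrt{\omega-Z^2/4}}{\lambda};k_0\Big).$$ For such $\eta,\omega,Z$ and $L>0$, let $\zeta$ be the function on $\mathbb R$, periodic with period $2L$, which on $[-L,L]$ is $$\zeta(\xi)=\eta_1\,\mathrm{dn}\Big(\frac{\eta_1}{\sqrt2}|\xi|-a;k\Big).$$ $H^1_{per}([-L,L])$ is the real Hilbert space of $2L$-periodic complex-valued functions with $\|f\|^2=\|f\|^2_{L^2(-L,L)}+\|f'\|^2_{L^2(-L,L)}<\infty$, where $f'$ is the weak derivative. **Theorem.** Let $L>0$. There are a function $\nu:(-\infty,0]\to\mathbb R$, with $\nu(0)=\frac{\pi^2}{2L^2}$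 and $\nu(Z)>\max\{\frac{Z^2}{4},\frac{\pi^2}{2L^2}\}$ for $Z<0$, and a real function $(\omega,Z)\mapsto\Lambda_3(\omega,Z)$, such that the following holds, where $\zeta_{\omega,Z}$ denotes the function $\zeta$ for $\eta=\Lambda_3(\omega,Z)$. (A) Let $Z_0<0$ and let $\omega_1$ be such that $\omega_1>\frac{Z_0^2}{4}$, $2L>T_1(\omega_1,Z_0)$ and $\omega_1>\frac{\pi^2}{2L^2}$. Then $\omega_1>\nu(Z_0)$, and there is a unique $\eta_{2,1}\in(0,\theta(\omega_1,Z_0))$ with $T_+(\eta_{2,1},\omega_1,Z_0)=2L$. Moreover there are open intervals $V\subset(-\infty,0)$ with $Z_0\in V$ and $N\ni\eta_{2,1}$ such that, with $W=(\nu(Z_0),+\infty)\times V$: 1. $\Lambda_3|_W$ is the unique $C^\infty$ function $g:W\to N$ with $g(\omega_1,Z_0)=\eta_{2,1}$, $g(\omega,Z)\in(0,\theta(\omega,Z))$ and $T_+(g(\omega,Z),\omega,Z)=2L$ for all $(\omega,Z)\in W$. 2. For all $(\omega,Z)\in W$ the function $\zeta=\zeta_{\omega,Z}$ is positive, even, $2L$-periodic,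 continuous on $\mathbb R$ and $C^2$ on $\mathbb R\setminus 2L\mathbb Z$, and satisfies $-\zeta''+\omega\zeta=\zeta^3$ on $\mathbb R\setminus 2L\mathbb Z$. The one-sided limits $\zeta'(0\pm)$ exist, and $\zeta'(0+)-\zeta'(0-)=-Z\zeta(0)$. 3. $\zeta_{\omega,Z}\in H^1_{per}([-L,L])$ for $(\omega,Z)\in W$. For each $\omega>\nu(Z_0)$ the map $Z\in V\mapsto\zeta_{\omega,Z}\in H^1_{per}([-L,L])$ is real-analytic. For each $Z\in V$ the map $\omega\in(\nu(Z_0),+\infty)\mapsto\zeta_{\omega,Z}\in H^1_{per}([-L,L])$ is $C^\infty$. (B) Let $\omega>\frac{\pi^2}{2L^2}$. Then $\eta=\Lambda_3(\omega,0)$ is the unique $\eta\in(0,\sqrt\omega)$ with $\frac{2\sqrt2}{\sqrt{2\omega-\eta^2}}K(k)=2L$, and $a(\Lambda_3(\omega,0),\omega,0)=0$. For all $Z<0$ close enough to $0$ (depending on $\omega$) one has $\omega>\nu(Z)$. As $Z\to0^-$, $\Lambda_3(\omega,Z)\to\Lambda_3(\omega,0)$ and, for every $\xi\in[-L,L]$,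 $$\zeta_{\omega,Z}(\xi)\to\phi_{\omega,0}(\xi)=\eta_1\,\mathrm{dn}\Big(\frac{\eta_1}{\sqrt2}\xi;k\Big),$$ where $\eta_1$ and $k$ are those of $\eta=\Lambda_3(\omega,0)$. -/

import Mathlib

open Set Filter Topology MeasureTheory
open scoped ENNReal

noncomputable section

namespace DnoidalPeak

/-! ### Elliptic integrals and the Jacobi function dn (argument `u`, modulus `k`) -/

/-- Normal elliptic integral of the first kind `F(φ, k) = ∫₀^φ dθ / √(1 - k² sin² θ)`. -/
def ellF (φ k : ℝ) : ℝ := ∫ t in (0 : ℝ)..φ, 1 / √(1 - k ^ 2 * Real.sin t ^ 2)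

/-- Complete elliptic integral `K(k) = F(π/2, k)`. -/
def ellK (k : ℝ) : ℝ := ellF (Real.pi / 2) k

/-- Jacobi amplitude: the inverse of `φ ↦ F(φ, k)`, an increasing bijection of `ℝ`
for `0 ≤ k < 1`. -/
def jacobiAm (u k : ℝ) : ℝ := Function.invFun (fun φ => ellF φ k) u

def jacobiSn (u k : ℝ) : ℝ := Real.sin (jacobiAm u k)

def jacobiDn (u k : ℝ) : ℝ := √(1 - k ^ 2 * jacobiSn u k ^ 2)

/-- The inverse `dn⁻¹(y; k) ∈ [0, K(k)]`, for `√(1 - k²) ≤ y ≤ 1`. -/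
def dnInv (y k : ℝ) : ℝ :=
  Function.invFunOn (fun u => jacobiDn u k) (Icc 0 (ellK k)) y

/-! ### The parameters; `η` stands for the smaller amplitude `η₂` -/

def theta (ω Z : ℝ) : ℝ := -(√2 / 4) * |Z| + √(ω - Z ^ 2 / 8)

def lam (ω Z : ℝ) : ℝ := √2 / 4 * |Z| + √(ω - Z ^ 2 / 8)

/-- The larger amplitude, `η₁² = 2ω - η₂²`. -/
def etaOne (η ω : ℝ) : ℝ := √(2 * ω - η ^ 2)

/-- The modulus, `k² = (2ω - 2η²) / (2ω - η²)`. -/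
def modulus (η ω : ℝ) : ℝ := √((2 * ω - 2 * η ^ 2) / (2 * ω - η ^ 2))

/-- The peak height `Φ(η, ω, Z)`. -/
def Phi (η ω Z : ℝ) : ℝ :=
  √(((2 * ω - Z ^ 2 / 2)
    + √((2 * ω - Z ^ 2 / 2) ^ 2 - 4 * η ^ 2 * (2 * ω - η ^ 2))) / 2)

/-- The shift `a(η, ω, Z) = dn⁻¹(Φ / η₁; k)`. -/
def shift (η ω Z : ℝ) : ℝ := dnInv (Phi η ω Z / etaOne η ω) (modulus η ω)

/-- `T₊(η, ω, Z) = (2√2 / η₁) (K(k) + a)`, the period of the peak profile. -/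
def Tplus (η ω Z : ℝ) : ℝ :=
  2 * √2 / etaOne η ω * (ellK (modulus η ω) + shift η ω Z)

/-- The period `(2√2 / η₁) K(k)` of the dnoidal wave (no defect). -/
def dnoidalPeriod (η ω : ℝ) : ℝ := 2 * √2 / etaOne η ω * ellK (modulus η ω)

/-- The modulus `k₀`, `k₀² = √2 |Z| √(ω - Z²/8) / λ²`. -/
def kZero (ω Z : ℝ) : ℝ := √(√2 * |Z| * √(ω - Z ^ 2 / 8) / lam ω Z ^ 2)

/-- The shift `a₀`, `dn(a₀; k₀) = √(ω - Z²/4) / λ`. -/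
def aZero (ω Z : ℝ) : ℝ := dnInv (√(ω - Z ^ 2 / 4) / lam ω Z) (kZero ω Z)

/-- `T₁(ω, Z) = (2√2 / λ) (K(k₀) + a₀)`. -/
def Tone (ω Z : ℝ) : ℝ := 2 * √2 / lam ω Z * (ellK (kZero ω Z) + aZero ω Z)

def Admissible (L ω Z : ℝ) : Prop :=
  Z ^ 2 / 4 < ω ∧ Tone ω Z < 2 * L ∧ Real.pi ^ 2 / (2 * L ^ 2) < ω

/-! ### Profiles -/

/-- The `2L`-periodic function which agrees on `[-L, L]` with a function `f` such that
`f (-L) = f L`. -/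
def periodize (L : ℝ) (f : ℝ → ℝ) (x : ℝ) : ℝ := f (x - 2 * L * (round (x / (2 * L)) : ℝ))

/-- The dnoidal peak for `Z < 0` with smaller amplitude `η`: the `2L`-periodic extension of
`η₁ dn(η₁ |ξ| / √2 - a; k)`, `ξ ∈ [-L, L]`. -/
def zetaPeak (L η ω Z : ℝ) : ℝ → ℝ :=
  periodize L fun ξ =>
    etaOne η ω * jacobiDn (etaOne η ω / √2 * |ξ| - shift η ω Z) (modulus η ω)

/-- The dnoidal wave `η₁ dn(η₁ ξ / √2; k)`. -/
def dnoidalWave (η ω ξ : ℝ) : ℝ :=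
  etaOne η ω * jacobiDn (etaOne η ω / √2 * ξ) (modulus η ω)

/-- The points `2nL`, `n ∈ ℤ`. -/
def lattice (L : ℝ) : Set ℝ := {x | ∃ n : ℤ, x = 2 * n * L}

/-- `u` is a `2L`-periodic solution of `-u'' + ω u - Z δ u = u³` with peaks at `2nL`. -/
structure IsPeriodicPeak (L ω Z : ℝ) (u : ℝ → ℝ) : Prop where
  periodic : ∀ x, u (x + 2 * L) = u x
  continuous : Continuous u
  contDiffOn : ContDiffOn ℝ 2 u (lattice L)ᶜ
  equation : ∀ x ∈ (lattice L)ᶜ, -deriv (deriv u) x + ω * u x = u x ^ 3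
  jump : ∃ dplus dminus : ℝ, Tendsto (deriv u) (𝓝[>] 0) (𝓝 dplus) ∧
    Tendsto (deriv u) (𝓝[<] 0) (𝓝 dminus) ∧ dplus - dminus = -Z * u 0

/-! ### The smooth solution branch of `T₊ = 2L` -/

/-- `g : W → N` is a smooth function through `(ω₁, Z₀, η₀)` with `T₊(g(ω, Z), ω, Z) = 2L`;
the values lie in the domain `(0, θ(ω, Z))` of `T₊(·, ω, Z)`. -/
structure IsBranch (L : ℝ) (W : Set (ℝ × ℝ)) (N : Set ℝ) (ω₁ Z₀ η₀ : ℝ)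
    (g : ℝ × ℝ → ℝ) : Prop where
  smooth : ContDiffOn ℝ (⊤ : ℕ∞) g W
  mapsTo : MapsTo g W N
  mem_domain : ∀ p ∈ W, g p ∈ Ioo 0 (theta p.1 p.2)
  base : g (ω₁, Z₀) = η₀
  period : ∀ p ∈ W, Tplus (g p) p.1 p.2 = 2 * L

/-! ### The space `H¹_per([-L, L])` of complex-valued functions, as a real Hilbert space -/

/-- Lebesgue measure on one period. -/
abbrev periodMeasure (L : ℝ) : Measure ℝ := volume.restrict (Ioc (-L) L)

abbrev L2per (L : ℝ) : Type := Lp ℂ 2 (periodMeasure L)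

/-- `g` is the weak derivative of `f` as a `2L`-periodic distribution. -/
def IsWeakDeriv (L : ℝ) (f g : L2per L) : Prop :=
  ∀ ψ : ℝ → ℂ, ContDiff ℝ (⊤ : ℕ∞) ψ → Function.Periodic ψ (2 * L) →
    ∫ x, f x * deriv ψ x ∂(periodMeasure L) = -∫ x, g x * ψ x ∂(periodMeasure L)

theorem integrable_mul_of_continuous {L : ℝ} (f : L2per L) {ψ : ℝ → ℂ}
    (hψ : Continuous ψ) : Integrable (fun x => f x * ψ x) (periodMeasure L) := by
  obtain ⟨C, hC⟩ := (isCompact_Icc (a := -L) (b := L)).exists_bound_of_continuousOn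
    hψ.continuousOn
  have hf : Integrable (fun x => f x) (periodMeasure L) :=
    (Lp.memLp f).integrable (by norm_num)
  refine hf.mul_bdd (c := C) hψ.aestronglyMeasurable ?_
  exact (ae_restrict_iff' measurableSet_Ioc).2
    (Eventually.of_forall fun x hx => hC x (Ioc_subset_Icc_self hx))

theorem IsWeakDeriv.add {L : ℝ} {f g f' g' : L2per L} (h : IsWeakDeriv L f g)
    (h' : IsWeakDeriv L f' g') : IsWeakDeriv L (f + f') (g + g') := by
  intro ψ hs hp
  have hd : Continuous (deriv ψ) := hs.continuous_deriv (by simp)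
  have e1 : ∫ x, (f + f') x * deriv ψ x ∂(periodMeasure L)
      = ∫ x, (f x * deriv ψ x + f' x * deriv ψ x) ∂(periodMeasure L) := by
    refine integral_congr_ae ?_
    filter_upwards [Lp.coeFn_add f f'] with x hx
    rw [hx, Pi.add_apply, add_mul]
  have e2 : ∫ x, (g + g') x * ψ x ∂(periodMeasure L)
      = ∫ x, (g x * ψ x + g' x * ψ x) ∂(periodMeasure L) := by
    refine integral_congr_ae ?_
    filter_upwards [Lp.coeFn_add g g'] with x hx
    rw [hx, Pi.add_apply, add_mul]
  rw [e1, e2, integral_add (integrable_mul_of_continuous f hd)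
    (integrable_mul_of_continuous f' hd),
    integral_add (integrable_mul_of_continuous g hs.continuous)
    (integrable_mul_of_continuous g' hs.continuous), h ψ hs hp, h' ψ hs hp, neg_add]

theorem IsWeakDeriv.smul {L : ℝ} {f g : L2per L} (c : ℝ) (h : IsWeakDeriv L f g) :
    IsWeakDeriv L (c • f) (c • g) := by
  intro ψ hs hp
  have e1 : ∫ x, (c • f) x * deriv ψ x ∂(periodMeasure L)
      = ∫ x, c • (f x * deriv ψ x) ∂(periodMeasure L) := by
    refine integral_congr_ae ?_
    filter_upwards [Lp.coeFn_smul c f] with x hx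
    rw [hx, Pi.smul_apply, smul_mul_assoc]
  have e2 : ∫ x, (c • g) x * ψ x ∂(periodMeasure L)
      = ∫ x, c • (g x * ψ x) ∂(periodMeasure L) := by
    refine integral_congr_ae ?_
    filter_upwards [Lp.coeFn_smul c g] with x hx
    rw [hx, Pi.smul_apply, smul_mul_assoc]
  rw [e1, e2, integral_smul, integral_smul, h ψ hs hp, smul_neg]

theorem IsWeakDeriv.zero (L : ℝ) : IsWeakDeriv L 0 0 := by
  intro ψ _ _
  have e : ∀ φ : ℝ → ℂ, ∫ x, (0 : L2per L) x * φ x ∂(periodMeasure L) = 0 := by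
    intro φ
    refine integral_eq_zero_of_ae ?_
    filter_upwards [Lp.coeFn_zero ℂ 2 (periodMeasure L)] with x hx
    rw [hx]
    simp
  rw [e, e, neg_zero]

/-- `H¹_per([-L, L])`: pairs of a function and its weak derivative, with the norm
`‖f‖² = ‖f‖²_{L²} + ‖f'‖²_{L²}`. -/
def H1per (L : ℝ) : Submodule ℝ (WithLp 2 (L2per L × L2per L)) where
  carrier := {p | IsWeakDeriv L p.fst p.snd}
  add_mem' h h' := IsWeakDeriv.add h h'
  zero_mem' := IsWeakDeriv.zero L
  smul_mem' c _ h := IsWeakDeriv.smul c h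

/-- The element `p` of `H¹_per` is the (class of the) real function `u`. -/
def Represents (L : ℝ) (p : H1per L) (u : ℝ → ℝ) : Prop :=
  ∀ᵐ x ∂(periodMeasure L), (p : WithLp 2 (L2per L × L2per L)).fst x = (u x : ℂ)

end DnoidalPeak

end

open DnoidalPeak

/-!
Write `η < η₁` for the extreme values of a solution of `φ'' = ω φ - φ³`, so `η² + η₁² = 2ω`, and put
`D = (η₁ - η)²`, `m = |Z| / √2`. The amplitude `η` ranges over `(0, θ)` exactly when `D` ranges
over `(m², 2ω)`. The ascending Landen transformation `ψ = φ + arctan ((η / η₁) tan φ)` turns the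
period into

  `T₊ = 2√2 (2 I(D, ω) + J(D, ω, m))`, `I = ∫₀^{π/2} dt / √(4ω - D (1 + sin² t))`,
  `J = ∫₀^m dx / √((D - x²)(4ω - D - x²))`

(`IsAmplitude.Tplus_eq_angleInt`, `Tplus_eq_gapPeriod`), and `T₁ = 6√2 I(m², ω)`, because the shift
is half of the quarter period at `η = θ`. Both integrands are convex in `D` and decreasing in
`ω`, hence so is the period (`convexOn_gapPeriod`, `gapPeriod_anti`); it tends to infinity as
`D → 2ω` (`exists_lt_quarterInt`). A level which lies above the infimum therefore has exactly one
root where the convex function increases, the upper root, and the derivative is positive there.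
If `T₁ < 2L`, every root is the upper one; this is the uniqueness in part (A).

At `D = m²` the period has slope `-∞`, so its infimum is strictly smaller than `T₁`
(`isSolvable_of_quarterInt_le`). The set of `(ω, Z)` with an upper root is open and upward closed in
`ω`, and at each `Z < 0` it contains frequencies below all admissible ones. The threshold `ν(Z)` is
chosen among those, within `|Z|` of the infimum (`exists_threshold`). One root below the level at
`(ν(Z₀), Z₀)` persists for `Z` near `Z₀` and for all `ω > ν(Z₀)`, which gives an interval `V`
independent of `ω`. As `Z → 0⁻` the infimum tends to `π² / (2L²)`, although the frequencies with
`T₁ = 2L` do not, so `ν` cannot be taken to be the infimum of the admissible frequencies.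

For analyticity, the reciprocal square root is analytic on the positive functions in the Banach
algebra `C([0, b])`, so `I` and `J` are analytic, and the implicit function theorem applies to the
upper root (`IsUpperRoot.exists_analytic`), near `m = 0` as well. The profile on `[0, L]` solves
`φ'' = ω φ - φ³` with initial data analytic in `(ω, Z)`. The integrated equation for `φ'` in
`C([0, L])` is polynomial, its linearization is the identity minus a quasinilpotent Volterra
operator, and the implicit function theorem makes `φ'` analytic in the parameters
(`contDiffAt_slopeFlow`). Even periodic extension is a bounded operator into `H¹_per`
(`evenExtendL`).
-/

namespace DnoidalPeak

/-! ### The Jacobi functions -/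

section Jacobi

variable {k : ℝ}

theorem delta_pos (hk : k ^ 2 < 1) (t : ℝ) : 0 < 1 - k ^ 2 * Real.sin t ^ 2 := by
  nlinarith [Real.sin_sq_le_one t, sq_nonneg (Real.sin t), sq_nonneg k]

theorem continuous_ellF_integrand (hk : k ^ 2 < 1) :
    Continuous fun t : ℝ => 1 / √(1 - k ^ 2 * Real.sin t ^ 2) :=
  continuous_const.div (by fun_prop) fun t => (Real.sqrt_pos.2 (delta_pos hk t)).ne'

theorem hasDerivAt_ellF (hk : k ^ 2 < 1) (φ : ℝ) :
    HasDerivAt (fun φ => ellF φ k) (1 / √(1 - k ^ 2 * Real.sin φ ^ 2)) φ :=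
  intervalIntegral.integral_hasDerivAt_right
    ((continuous_ellF_integrand hk).intervalIntegrable _ _)
    (continuous_ellF_integrand hk).stronglyMeasurable.stronglyMeasurableAtFilter
    (continuous_ellF_integrand hk).continuousAt

theorem ellF_zero (k : ℝ) : ellF 0 k = 0 := by simp [ellF]

theorem ellF_strictMono (hk : k ^ 2 < 1) : StrictMono fun φ => ellF φ k :=
  strictMono_of_hasDerivAt_pos (hasDerivAt_ellF hk) fun φ =>
    one_div_pos.2 (Real.sqrt_pos.2 (delta_pos hk φ))

theorem ellF_pi_sub (hk : k ^ 2 < 1) (φ : ℝ) :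
    ellF (Real.pi - φ) k = 2 * ellK k - ellF φ k := by
  have h : ∀ x, HasDerivAt (fun φ => ellF (Real.pi - φ) k + ellF φ k) 0 x := by
    intro x
    have h1 := (hasDerivAt_ellF hk (Real.pi - x)).comp_const_sub Real.pi x
    have h2 := h1.add (hasDerivAt_ellF hk x)
    rw [Real.sin_pi_sub] at h2
    exact h2.congr_deriv (neg_add_cancel _)
  have h0 := is_const_of_deriv_eq_zero (fun x => (h x).differentiableAt)
    (fun x => (h x).deriv) φ (Real.pi / 2)
  simp only [sub_half] at h0
  unfold ellK
  linarith

theorem ellF_neg (hk : k ^ 2 < 1) (φ : ℝ) : ellF (-φ) k = -ellF φ k := by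
  have h : ∀ x, HasDerivAt (fun φ => ellF (0 - φ) k + ellF φ k) 0 x := by
    intro x
    have h1 := (hasDerivAt_ellF hk (0 - x)).comp_const_sub 0 x
    have h2 := h1.add (hasDerivAt_ellF hk x)
    rw [zero_sub, Real.sin_neg, neg_sq] at h2
    exact h2.congr_deriv (neg_add_cancel _)
  have h0 := is_const_of_deriv_eq_zero (fun x => (h x).differentiableAt)
    (fun x => (h x).deriv) φ 0
  simp only [zero_sub, neg_zero, ellF_zero] at h0
  linarith

theorem le_ellF (hk : k ^ 2 < 1) {φ : ℝ} (hφ : 0 ≤ φ) : φ ≤ ellF φ k := by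
  have hm : Monotone fun φ => ellF φ k - φ := by
    refine monotone_of_hasDerivAt_nonneg
      (fun x => (hasDerivAt_ellF hk x).sub (hasDerivAt_id x)) fun x => sub_nonneg.2 ?_
    rw [le_div_iff₀ (Real.sqrt_pos.2 (delta_pos hk x)), one_mul]
    exact Real.sqrt_le_one.2 (by nlinarith [mul_nonneg (sq_nonneg k) (sq_nonneg (Real.sin x))])
  have := hm hφ
  simp only [ellF_zero] at this
  linarith

theorem ellF_surjective (hk : k ^ 2 < 1) : Function.Surjective fun φ => ellF φ k := by
  have hc : Continuous fun φ => ellF φ k :=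
    continuous_iff_continuousAt.2 fun x => (hasDerivAt_ellF hk x).continuousAt
  have htop : Tendsto (fun φ => ellF φ k) atTop atTop :=
    tendsto_atTop_mono' _ ((eventually_ge_atTop 0).mono fun φ h => le_ellF hk h) tendsto_id
  refine hc.surjective htop ?_
  have : (fun φ => ellF φ k) = fun φ => -ellF (-φ) k := by
    funext φ
    rw [ellF_neg hk, neg_neg]
  rw [this]
  exact tendsto_neg_atTop_atBot.comp (htop.comp tendsto_neg_atBot_atTop)

theorem ellF_jacobiAm (hk : k ^ 2 < 1) (u : ℝ) : ellF (jacobiAm u k) k = u :=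
  Function.invFun_eq (ellF_surjective hk u)

theorem jacobiAm_eq (hk : k ^ 2 < 1) {u φ : ℝ} (h : ellF φ k = u) : jacobiAm u k = φ :=
  (ellF_strictMono hk).injective (by simp only [ellF_jacobiAm hk, h])

theorem jacobiAm_zero (hk : k ^ 2 < 1) : jacobiAm 0 k = 0 := jacobiAm_eq hk (ellF_zero k)

theorem jacobiAm_ellK (hk : k ^ 2 < 1) : jacobiAm (ellK k) k = Real.pi / 2 := jacobiAm_eq hk rfl

theorem jacobiAm_neg (hk : k ^ 2 < 1) (u : ℝ) : jacobiAm (-u) k = -jacobiAm u k :=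
  jacobiAm_eq hk (by rw [ellF_neg hk, ellF_jacobiAm hk])

theorem jacobiAm_two_ellK_sub (hk : k ^ 2 < 1) (u : ℝ) :
    jacobiAm (2 * ellK k - u) k = Real.pi - jacobiAm u k :=
  jacobiAm_eq hk (by rw [ellF_pi_sub hk, ellF_jacobiAm hk])

theorem jacobiAm_strictMono (hk : k ^ 2 < 1) : StrictMono fun u => jacobiAm u k := by
  intro u v h
  by_contra! h'
  have := (ellF_strictMono hk).monotone h'
  simp only [ellF_jacobiAm hk] at this
  exact absurd h (not_lt.2 this)

theorem continuous_jacobiAm (hk : k ^ 2 < 1) : Continuous fun u => jacobiAm u k :=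
  (jacobiAm_strictMono hk).monotone.continuous_of_surjective
    fun φ => ⟨ellF φ k, jacobiAm_eq hk rfl⟩

/-- The Jacobi function `cn = cos am`. -/
noncomputable def jacobiCn (u k : ℝ) : ℝ := Real.cos (jacobiAm u k)

theorem jacobiDn_pos (hk : k ^ 2 < 1) (u : ℝ) : 0 < jacobiDn u k :=
  Real.sqrt_pos.2 (delta_pos hk _)

theorem jacobiDn_sq (hk : k ^ 2 < 1) (u : ℝ) :
    jacobiDn u k ^ 2 = 1 - k ^ 2 * jacobiSn u k ^ 2 :=
  Real.sq_sqrt (delta_pos hk _).le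

theorem jacobiSn_sq_add_jacobiCn_sq (u k : ℝ) : jacobiSn u k ^ 2 + jacobiCn u k ^ 2 = 1 :=
  Real.sin_sq_add_cos_sq _

theorem hasDerivAt_jacobiAm (hk : k ^ 2 < 1) (u : ℝ) :
    HasDerivAt (fun u => jacobiAm u k) (jacobiDn u k) u := by
  have h := HasDerivAt.of_local_left_inverse (f := fun φ => ellF φ k) (g := fun u => jacobiAm u k)
    (a := u) (continuous_jacobiAm hk).continuousAt (hasDerivAt_ellF hk (jacobiAm u k))
    (one_div_pos.2 (Real.sqrt_pos.2 (delta_pos hk _))).ne'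
    (Eventually.of_forall (ellF_jacobiAm hk))
  rwa [one_div, inv_inv] at h

theorem hasDerivAt_jacobiSn (hk : k ^ 2 < 1) (u : ℝ) :
    HasDerivAt (fun u => jacobiSn u k) (jacobiCn u k * jacobiDn u k) u :=
  (hasDerivAt_jacobiAm hk u).sin

theorem hasDerivAt_jacobiCn (hk : k ^ 2 < 1) (u : ℝ) :
    HasDerivAt (fun u => jacobiCn u k) (-jacobiSn u k * jacobiDn u k) u :=
  (hasDerivAt_jacobiAm hk u).cos

theorem hasDerivAt_jacobiDn (hk : k ^ 2 < 1) (u : ℝ) :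
    HasDerivAt (fun u => jacobiDn u k) (-k ^ 2 * (jacobiSn u k * jacobiCn u k)) u := by
  have h := ((((hasDerivAt_jacobiSn hk u).pow 2).const_mul (k ^ 2)).const_sub 1).sqrt
    (delta_pos hk _).ne'
  refine h.congr_deriv ?_
  change -(k ^ 2 * (_ * _ * _)) / (2 * jacobiDn u k) = _
  have := (jacobiDn_pos hk u).ne'
  field_simp
  norm_num
  ring

theorem jacobiDn_neg (hk : k ^ 2 < 1) (u : ℝ) : jacobiDn (-u) k = jacobiDn u k := by
  simp [jacobiDn, jacobiSn, jacobiAm_neg hk]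

theorem jacobiDn_two_ellK_sub (hk : k ^ 2 < 1) (u : ℝ) :
    jacobiDn (2 * ellK k - u) k = jacobiDn u k := by
  simp [jacobiDn, jacobiSn, jacobiAm_two_ellK_sub hk]

theorem ellK_pos (hk : k ^ 2 < 1) : 0 < ellK k := by
  have := le_ellF hk (φ := Real.pi / 2) (by positivity)
  exact lt_of_lt_of_le (by positivity) this

theorem ellK_le (hk : k ^ 2 < 1) : ellK k ≤ Real.pi / 2 / √(1 - k ^ 2) := by
  have h : ellK k ≤ ∫ _ in (0 : ℝ)..(Real.pi / 2), 1 / √(1 - k ^ 2) := by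
    refine intervalIntegral.integral_mono_on (by positivity)
      ((continuous_ellF_integrand hk).intervalIntegrable _ _) (by simp) fun t _ => ?_
    refine one_div_le_one_div_of_le (Real.sqrt_pos.2 (by linarith)) (Real.sqrt_le_sqrt ?_)
    nlinarith [Real.sin_sq_le_one t, sq_nonneg k]
  refine h.trans (le_of_eq ?_)
  simp
  ring

theorem jacobiAm_mem (hk : k ^ 2 < 1) {u : ℝ} (hu : u ∈ Icc 0 (ellK k)) :
    jacobiAm u k ∈ Icc 0 (Real.pi / 2) := by
  have hm := (jacobiAm_strictMono hk).monotone
  have h0 := hm hu.1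
  have h1 := hm hu.2
  simp only [jacobiAm_zero hk, jacobiAm_ellK hk] at h0 h1
  exact ⟨h0, h1⟩

theorem continuous_jacobiDn (hk : k ^ 2 < 1) : Continuous fun u => jacobiDn u k :=
  continuous_iff_continuousAt.2 fun u => (hasDerivAt_jacobiDn hk u).continuousAt

theorem dnInv_spec (hk : k ^ 2 < 1) {y : ℝ} (hy : y ∈ Icc √(1 - k ^ 2) 1) :
    dnInv y k ∈ Icc 0 (ellK k) ∧ jacobiDn (dnInv y k) k = y := by
  have hiv := intermediate_value_Icc' (ellK_pos hk).le (continuous_jacobiDn hk).continuousOn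
  have h0 : jacobiDn 0 k = 1 := by simp [jacobiDn, jacobiSn, jacobiAm_zero hk]
  have h1 : jacobiDn (ellK k) k = √(1 - k ^ 2) := by
    simp [jacobiDn, jacobiSn, jacobiAm_ellK hk]
  rw [h0, h1] at hiv
  have hex : ∃ a ∈ Icc 0 (ellK k), (fun u => jacobiDn u k) a = y := hiv hy
  exact ⟨Function.invFunOn_mem hex, Function.invFunOn_eq hex⟩

end Jacobi

/-! ### Periodic extension of a reflection-symmetric arc -/

section Periodize

variable {L : ℝ} {h h' : ℝ → ℝ}

/-- The periodic extension is a function of the distance to the lattice `2Lℤ`. -/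
theorem periodize_eq_norm (x : ℝ) :
    periodize L (fun ξ => h |ξ|) x = h ‖(x : AddCircle (2 * L))‖ := by
  rw [AddCircle.norm_eq, periodize]
  congr 3
  rw [div_eq_inv_mul, mul_comm]

theorem periodize_eq_of_abs_le (hL : 0 < L) {x : ℝ} (hx : |x| ≤ L) :
    periodize L (fun ξ => h |ξ|) x = h |x| := by
  rw [periodize_eq_norm, (AddCircle.norm_coe_eq_abs_iff (2 * L) (by positivity)).2]
  rwa [abs_of_pos (by positivity : 0 < 2 * L), mul_div_cancel_left₀ _ two_ne_zero]

theorem periodize_add_period (n : ℤ) (x : ℝ) :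
    periodize L (fun ξ => h |ξ|) (x - n * (2 * L)) = periodize L (fun ξ => h |ξ|) x := by
  rw [periodize_eq_norm, periodize_eq_norm, AddCircle.coe_sub, ← zsmul_eq_mul,
    AddCircle.coe_zsmul, AddCircle.coe_period, smul_zero, sub_zero]

theorem periodize_eq_of_mem_Ioo (hL : 0 < L) (hsymm : ∀ r, h (2 * L - r) = h r) {x : ℝ}
    (hx : x ∈ Ioo 0 (2 * L)) : periodize L (fun ξ => h |ξ|) x = h x := by
  rcases le_total x L with hxL | hxL
  · rw [periodize_eq_of_abs_le hL (by rwa [abs_of_pos hx.1]), abs_of_pos hx.1]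
  · have e := periodize_add_period (L := L) (h := h) 1 x
    rw [← e, periodize_eq_of_abs_le hL, abs_of_nonpos, ← hsymm x]
    · congr 1
      push_cast
      ring
    · have := hx.2
      push_cast
      linarith
    · have := hx.2
      rw [abs_le]
      push_cast
      constructor <;> linarith

/-- A reflection-symmetric solution of `h'' = ω h - h³` whose slope at `0` is half of the
prescribed jump extends to a peak solution. -/
theorem isPeriodicPeak_periodize (hL : 0 < L) {ω Z : ℝ}
    (hsymm : ∀ r, h (2 * L - r) = h r) (hd : ∀ r, HasDerivAt h (h' r) r)
    (hdd : ∀ r, HasDerivAt h' (ω * h r - h r ^ 3) r) (hjump : 2 * h' 0 = -Z * h 0) :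
    IsPeriodicPeak L ω Z (periodize L fun ξ => h |ξ|) := by
  set u := periodize L fun ξ => h |ξ| with hu
  have hcont : Continuous h := continuous_iff_continuousAt.2 fun r => (hd r).continuousAt
  have hcont' : Continuous h' := continuous_iff_continuousAt.2 fun r => (hdd r).continuousAt
  have hderiv : deriv h = h' := funext fun r => (hd r).deriv
  have hderiv' : deriv h' = fun r => ω * h r - h r ^ 3 := funext fun r => (hdd r).deriv
  have hC2 : ContDiff ℝ 2 h := by
    have h1 : ContDiff ℝ 1 h' := by
      refine contDiff_one_iff_deriv.2 ⟨fun r => (hdd r).differentiableAt, ?_⟩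
      rw [hderiv']
      fun_prop
    refine (contDiff_succ_iff_deriv (n := 1)).2 ⟨fun r => (hd r).differentiableAt, by simp, ?_⟩
    rwa [hderiv]
  -- Away from the lattice the extension is locally a translate of the arc.
  have hloc : ∀ x ∈ (lattice L)ᶜ, ∃ c : ℝ, u =ᶠ[𝓝 x] fun y => h (y - c) := by
    intro x hx
    refine ⟨⌊x / (2 * L)⌋ * (2 * L), ?_⟩
    set n := ⌊x / (2 * L)⌋ with hn
    have h1 : (n : ℝ) ≤ x / (2 * L) := Int.floor_le _
    have h2 : x / (2 * L) < n + 1 := Int.lt_floor_add_one _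
    rw [le_div_iff₀ (by positivity)] at h1
    rw [div_lt_iff₀ (by positivity)] at h2
    have h3 : (n : ℝ) * (2 * L) ≠ x := fun e => hx ⟨n, by rw [← e]; ring⟩
    have hmem : x ∈ Ioo ((n : ℝ) * (2 * L)) ((n + 1) * (2 * L)) := ⟨lt_of_le_of_ne h1 h3, h2⟩
    filter_upwards [isOpen_Ioo.mem_nhds hmem] with y hy
    rw [hu, ← periodize_add_period n y]
    exact periodize_eq_of_mem_Ioo hL hsymm ⟨by linarith [hy.1], by linarith [hy.2]⟩
  have hu0 : u 0 = h 0 := by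
    rw [hu, periodize_eq_of_abs_le hL (by simpa using hL.le), abs_zero]
  refine ⟨fun x => ?_, ?_, ?_, ?_, h' 0, -h' 0, ?_, ?_, by rw [hu0]; linarith⟩
  · have := periodize_add_period (L := L) (h := h) (-1) x
    rw [hu, ← this]
    congr 1
    push_cast
    ring
  · have : u = fun x : ℝ => h ‖(x : AddCircle (2 * L))‖ := funext periodize_eq_norm
    rw [this]
    exact hcont.comp (continuous_norm.comp (AddCircle.continuous_mk' (2 * L)))
  · intro x hx
    obtain ⟨c, hc⟩ := hloc x hx
    have : ContDiff ℝ 2 fun y => h (y - c) := hC2.comp (contDiff_id.sub contDiff_const)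
    exact (this.contDiffAt.congr_of_eventuallyEq hc).contDiffWithinAt
  · intro x hx
    obtain ⟨c, hc⟩ := hloc x hx
    have e1 : deriv (fun y => h (y - c)) = fun y => h' (y - c) :=
      funext fun y => ((hd (y - c)).comp_sub_const y c).deriv
    have e2 : deriv (deriv u) x = ω * h (x - c) - h (x - c) ^ 3 := by
      rw [hc.deriv.deriv_eq, e1]
      exact ((hdd (x - c)).comp_sub_const x c).deriv
    rw [e2, hc.eq_of_nhds]
    ring
  · have : Tendsto h' (𝓝[>] 0) (𝓝 (h' 0)) := hcont'.continuousAt.mono_left inf_le_left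
    refine this.congr' ?_
    filter_upwards [Ioo_mem_nhdsGT hL] with x hx
    have : u =ᶠ[𝓝 x] h := by
      filter_upwards [isOpen_Ioo.mem_nhds hx] with y hy
      exact periodize_eq_of_mem_Ioo hL hsymm ⟨hy.1, by linarith [hy.2]⟩
    rw [this.deriv_eq, hderiv]
  · have : Tendsto (fun x => -h' (-x)) (𝓝[<] 0) (𝓝 (-h' 0)) := by
      have h0 : Continuous fun x => -h' (-x) := by fun_prop
      have := h0.tendsto 0
      rw [neg_zero] at this
      exact this.mono_left inf_le_left
    refine this.congr' ?_
    filter_upwards [Ioo_mem_nhdsLT (neg_lt_zero.2 hL)] with x hx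
    have : u =ᶠ[𝓝 x] fun y => h (-y) := by
      filter_upwards [isOpen_Ioo.mem_nhds hx] with y hy
      rw [hu, periodize_eq_of_abs_le hL (by rw [abs_of_neg hy.2]; linarith [hy.1]),
        abs_of_neg hy.2]
    rw [this.deriv_eq]
    have := (hd (-x)).scomp x (hasDerivAt_neg x)
    rw [show (fun y => h (-y)) = h ∘ Neg.neg from rfl]
    simpa using this.deriv.symm

theorem periodize_neg (x : ℝ) :
    periodize L (fun ξ => h |ξ|) (-x) = periodize L (fun ξ => h |ξ|) x := by
  rw [periodize_eq_norm, periodize_eq_norm, AddCircle.coe_neg, norm_neg]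

end Periodize

/-! ### The arc of the peak profile -/

/-- Admissible smaller amplitudes `η`: the modulus lies in `(0, 1)` and the slope equation
`φ' = |Z| φ / 2` has a solution on the orbit with amplitudes `η < η₁`. The endpoint
`η = θ(ω, Z)` is included when `Z ≠ 0`. -/
structure IsAmplitude (η ω Z : ℝ) : Prop where
  pos : 0 < η
  lt_etaOne : η < etaOne η ω
  le_sub : |Z| / √2 ≤ etaOne η ω - η

namespace IsAmplitude

variable {η ω Z : ℝ}

theorem etaOne_pos (h : IsAmplitude η ω Z) : 0 < etaOne η ω := h.pos.trans h.lt_etaOne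

theorem etaOne_sq (h : IsAmplitude η ω Z) : etaOne η ω ^ 2 = 2 * ω - η ^ 2 :=
  Real.sq_sqrt (Real.sqrt_pos.1 h.etaOne_pos).le

theorem modulus_sq_mul (h : IsAmplitude η ω Z) :
    etaOne η ω ^ 2 * modulus η ω ^ 2 = etaOne η ω ^ 2 - η ^ 2 := by
  have h1 := h.etaOne_sq
  have h2 := h.etaOne_pos
  have h3 : η ^ 2 < etaOne η ω ^ 2 := by nlinarith [h.pos, h.lt_etaOne]
  have h4 : 0 < etaOne η ω ^ 2 := by positivity
  rw [modulus, Real.sq_sqrt (div_nonneg (by linarith) (by linarith)), ← h1,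
    mul_div_cancel₀ _ h4.ne']
  linarith

theorem modulus_sq_lt_one (h : IsAmplitude η ω Z) : modulus η ω ^ 2 < 1 := by
  have h1 := h.modulus_sq_mul
  have h2 := h.etaOne_pos
  have h3 := h.pos
  by_contra! h4
  nlinarith [mul_le_mul_of_nonneg_left h4 (sq_nonneg (etaOne η ω)), pow_pos h3 2]

theorem sq_Z_div_two_le (h : IsAmplitude η ω Z) : Z ^ 2 / 2 ≤ (etaOne η ω - η) ^ 2 := by
  have h1 := pow_le_pow_left₀ (by positivity) h.le_sub 2
  rwa [div_pow, sq_abs, Real.sq_sqrt zero_le_two] at h1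

/-- `Φ²` is the larger root of the quadratic which equates `φ'²` with `Z² φ² / 4` on the orbit. -/
theorem Phi_spec (h : IsAmplitude η ω Z) :
    (etaOne η ω ^ 2 - Phi η ω Z ^ 2) * (Phi η ω Z ^ 2 - η ^ 2) = Z ^ 2 / 2 * Phi η ω Z ^ 2 ∧
      η * etaOne η ω ≤ Phi η ω Z ^ 2 := by
  have h1 := h.etaOne_sq
  have hc : 0 < η * etaOne η ω := mul_pos h.pos h.etaOne_pos
  have hA : 2 * (η * etaOne η ω) ≤ 2 * ω - Z ^ 2 / 2 := by nlinarith [h.sq_Z_div_two_le]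
  have hdisc : 0 ≤ (2 * ω - Z ^ 2 / 2) ^ 2 - 4 * η ^ 2 * (2 * ω - η ^ 2) := by
    rw [← h1]
    nlinarith [mul_self_le_mul_self (by positivity) hA]
  have hs := Real.sq_sqrt hdisc
  have hs0 := Real.sqrt_nonneg ((2 * ω - Z ^ 2 / 2) ^ 2 - 4 * η ^ 2 * (2 * ω - η ^ 2))
  have hX : Phi η ω Z ^ 2 = ((2 * ω - Z ^ 2 / 2)
    + √((2 * ω - Z ^ 2 / 2) ^ 2 - 4 * η ^ 2 * (2 * ω - η ^ 2))) / 2 :=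
    Real.sq_sqrt (by linarith)
  set s := √((2 * ω - Z ^ 2 / 2) ^ 2 - 4 * η ^ 2 * (2 * ω - η ^ 2))
  rw [hX]
  constructor
  · rw [h1]
    linear_combination (-1 / 4) * hs
  · linarith

theorem Phi_pos (h : IsAmplitude η ω Z) : 0 < Phi η ω Z := by
  have h1 := h.Phi_spec.2
  have h2 := mul_pos h.pos h.etaOne_pos
  have h3 : 0 ≤ Phi η ω Z := Real.sqrt_nonneg _
  exact lt_of_le_of_ne h3 fun e => by rw [← e] at h1; norm_num at h1; linarith

theorem eta_sq_lt_Phi_sq (h : IsAmplitude η ω Z) : η ^ 2 < Phi η ω Z ^ 2 := by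
  nlinarith [h.Phi_spec.2, h.pos, h.lt_etaOne]

theorem Phi_sq_le (h : IsAmplitude η ω Z) : Phi η ω Z ^ 2 ≤ etaOne η ω ^ 2 := by
  by_contra! hlt
  have := mul_neg_of_neg_of_pos (sub_neg.2 hlt) (sub_pos.2 h.eta_sq_lt_Phi_sq)
  rw [h.Phi_spec.1] at this
  nlinarith [mul_nonneg (sq_nonneg Z) (sq_nonneg (Phi η ω Z))]

theorem shift_spec (h : IsAmplitude η ω Z) :
    shift η ω Z ∈ Icc 0 (ellK (modulus η ω)) ∧
      etaOne η ω * jacobiDn (shift η ω Z) (modulus η ω) = Phi η ω Z := by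
  have hη₁ := h.etaOne_pos
  have hy : Phi η ω Z / etaOne η ω ∈ Icc √(1 - modulus η ω ^ 2) 1 := by
    constructor
    · rw [Real.sqrt_le_left (div_nonneg h.Phi_pos.le hη₁.le), div_pow, le_div_iff₀ (by positivity)]
      nlinarith [h.modulus_sq_mul, h.eta_sq_lt_Phi_sq]
    · rw [div_le_one hη₁]
      exact le_of_sq_le_sq h.Phi_sq_le hη₁.le
  obtain ⟨h1, h2⟩ := dnInv_spec h.modulus_sq_lt_one hy
  refine ⟨h1, ?_⟩
  change etaOne η ω * jacobiDn (dnInv _ _) _ = _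
  rw [h2, mul_div_cancel₀ _ hη₁.ne']

theorem sn_shift_sq (h : IsAmplitude η ω Z) :
    etaOne η ω ^ 2 * modulus η ω ^ 2 * jacobiSn (shift η ω Z) (modulus η ω) ^ 2
      = etaOne η ω ^ 2 - Phi η ω Z ^ 2 := by
  rw [← h.shift_spec.2, mul_pow, jacobiDn_sq h.modulus_sq_lt_one]
  ring

theorem cn_shift_sq (h : IsAmplitude η ω Z) :
    etaOne η ω ^ 2 * modulus η ω ^ 2 * jacobiCn (shift η ω Z) (modulus η ω) ^ 2
      = Phi η ω Z ^ 2 - η ^ 2 := by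
  have h1 := h.sn_shift_sq
  have h2 := jacobiSn_sq_add_jacobiCn_sq (shift η ω Z) (modulus η ω)
  have h3 := h.modulus_sq_mul
  linear_combination -h1 + (etaOne η ω ^ 2 * modulus η ω ^ 2) * h2 + h3

theorem am_shift_mem (h : IsAmplitude η ω Z) :
    jacobiAm (shift η ω Z) (modulus η ω) ∈ Icc 0 (Real.pi / 2) :=
  jacobiAm_mem h.modulus_sq_lt_one h.shift_spec.1

theorem sn_shift_nonneg (h : IsAmplitude η ω Z) :
    0 ≤ jacobiSn (shift η ω Z) (modulus η ω) :=
  Real.sin_nonneg_of_nonneg_of_le_pi h.am_shift_mem.1 (by linarith [h.am_shift_mem.2, Real.pi_pos])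

theorem cn_shift_nonneg (h : IsAmplitude η ω Z) :
    0 ≤ jacobiCn (shift η ω Z) (modulus η ω) :=
  Real.cos_nonneg_of_neg_pi_div_two_le_of_le (by linarith [h.am_shift_mem.1, Real.pi_pos])
    h.am_shift_mem.2

/-- The slope equation at the shift, which encodes the jump condition. -/
theorem slope_shift (h : IsAmplitude η ω Z) :
    etaOne η ω ^ 2 * modulus η ω ^ 2 * (jacobiSn (shift η ω Z) (modulus η ω)
      * jacobiCn (shift η ω Z) (modulus η ω)) = |Z| / √2 * Phi η ω Z := by
  have hs := h.sn_shift_nonneg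
  have hc := h.cn_shift_nonneg
  have hΦ := h.Phi_pos
  refine (sq_eq_sq₀ (by positivity) (by positivity)).1 ?_
  calc _ = (etaOne η ω ^ 2 * modulus η ω ^ 2 * jacobiSn (shift η ω Z) (modulus η ω) ^ 2)
        * (etaOne η ω ^ 2 * modulus η ω ^ 2 * jacobiCn (shift η ω Z) (modulus η ω) ^ 2) := by ring
    _ = Z ^ 2 / 2 * Phi η ω Z ^ 2 := by rw [h.sn_shift_sq, h.cn_shift_sq, h.Phi_spec.1]
    _ = _ := by rw [mul_pow, div_pow, sq_abs, Real.sq_sqrt zero_le_two]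

end IsAmplitude

/-- One arc `η₁ dn(η₁ r / √2 - a; k)` of the peak profile, for all real `r`. -/
noncomputable def arc (η ω Z r : ℝ) : ℝ :=
  etaOne η ω * jacobiDn (etaOne η ω / √2 * r - shift η ω Z) (modulus η ω)

/-- The derivative of `arc` in `r`. -/
noncomputable def arcDeriv (η ω Z r : ℝ) : ℝ :=
  -(etaOne η ω ^ 2 * modulus η ω ^ 2 / √2)
    * (jacobiSn (etaOne η ω / √2 * r - shift η ω Z) (modulus η ω)
      * jacobiCn (etaOne η ω / √2 * r - shift η ω Z) (modulus η ω))

theorem zetaPeak_eq (L η ω Z : ℝ) :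
    zetaPeak L η ω Z = periodize L fun ξ => arc η ω Z |ξ| := rfl

namespace IsAmplitude

variable {η ω Z : ℝ}

theorem hasDerivAt_arc (h : IsAmplitude η ω Z) (r : ℝ) :
    HasDerivAt (arc η ω Z) (arcDeriv η ω Z r) r := by
  have hl : HasDerivAt (fun r => etaOne η ω / √2 * r - shift η ω Z) (etaOne η ω / √2) r := by
    simpa using ((hasDerivAt_id r).const_mul (etaOne η ω / √2)).sub_const (shift η ω Z)
  have := ((hasDerivAt_jacobiDn h.modulus_sq_lt_one
    (etaOne η ω / √2 * r - shift η ω Z)).comp r hl).const_mul (etaOne η ω)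
  refine this.congr_deriv ?_
  rw [arcDeriv]
  ring

theorem hasDerivAt_arcDeriv (h : IsAmplitude η ω Z) (r : ℝ) :
    HasDerivAt (arcDeriv η ω Z) (ω * arc η ω Z r - arc η ω Z r ^ 3) r := by
  have hl : HasDerivAt (fun r => etaOne η ω / √2 * r - shift η ω Z) (etaOne η ω / √2) r := by
    simpa using ((hasDerivAt_id r).const_mul (etaOne η ω / √2)).sub_const (shift η ω Z)
  set x := etaOne η ω / √2 * r - shift η ω Z with hx
  have hk := h.modulus_sq_lt_one
  have := ((((hasDerivAt_jacobiSn hk x).mul (hasDerivAt_jacobiCn hk x))).comp r hl).const_mul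
    (-(etaOne η ω ^ 2 * modulus η ω ^ 2 / √2))
  refine this.congr_deriv ?_
  rw [arc, ← hx]
  have e1 := h.modulus_sq_mul
  have e2 := h.etaOne_sq
  have e3 := jacobiDn_sq hk x
  have e4 := jacobiSn_sq_add_jacobiCn_sq x (modulus η ω)
  have e5 : √2 * √2 = 2 := Real.mul_self_sqrt zero_le_two
  have e6 : √2 ≠ 0 := by positivity
  have e7 : etaOne η ω ^ 2 * modulus η ω ^ 2 / √2 * (etaOne η ω / √2)
      = etaOne η ω * (etaOne η ω ^ 2 * modulus η ω ^ 2) / 2 := by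
    rw [div_mul_div_comm, e5]
    ring
  generalize jacobiDn x (modulus η ω) = d at *
  generalize jacobiSn x (modulus η ω) = s at *
  generalize jacobiCn x (modulus η ω) = c at *
  generalize etaOne η ω = b at *
  generalize modulus η ω = k at *
  have e8 : -(b ^ 2 * k ^ 2 / √2) * ((c * d * c + s * (-s * d)) * (b / √2))
      = -(b * (b ^ 2 * k ^ 2) / 2) * (d * (c ^ 2 - s ^ 2)) := by
    rw [← e7]
    ring
  rw [e8]
  have e9 : b ^ 2 * d ^ 2 = b ^ 2 - b ^ 2 * k ^ 2 * s ^ 2 := by rw [e3]; ring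
  have e10 : ω = (b ^ 2 + η ^ 2) / 2 := by linarith
  rw [e10]
  linear_combination (-(b * (b ^ 2 * k ^ 2) / 2) * d) * e4 + b * d * e9 - b * d / 2 * e1

theorem arc_pos (h : IsAmplitude η ω Z) (r : ℝ) : 0 < arc η ω Z r :=
  mul_pos h.etaOne_pos (jacobiDn_pos h.modulus_sq_lt_one _)

theorem arc_zero (h : IsAmplitude η ω Z) : arc η ω Z 0 = Phi η ω Z := by
  rw [arc, mul_zero, zero_sub, jacobiDn_neg h.modulus_sq_lt_one, h.shift_spec.2]

theorem arcDeriv_zero (h : IsAmplitude η ω Z) : arcDeriv η ω Z 0 = |Z| / 2 * Phi η ω Z := by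
  have e := h.slope_shift
  have e5 : √2 * √2 = 2 := Real.mul_self_sqrt zero_le_two
  rw [arcDeriv, mul_zero, zero_sub, jacobiSn, jacobiCn, jacobiAm_neg h.modulus_sq_lt_one,
    Real.sin_neg, Real.cos_neg]
  rw [jacobiSn, jacobiCn] at e
  calc _ = etaOne η ω ^ 2 * modulus η ω ^ 2 * (Real.sin (jacobiAm (shift η ω Z) (modulus η ω))
      * Real.cos (jacobiAm (shift η ω Z) (modulus η ω))) / √2 := by ring
    _ = |Z| / (√2 * √2) * Phi η ω Z := by rw [e]; field_simp
    _ = _ := by rw [e5]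

theorem arc_two_mul_sub {L : ℝ} (h : IsAmplitude η ω Z) (hT : Tplus η ω Z = 2 * L) (r : ℝ) :
    arc η ω Z (2 * L - r) = arc η ω Z r := by
  have hη₁ := h.etaOne_pos
  have e5 : √2 * √2 = 2 := Real.mul_self_sqrt zero_le_two
  rw [arc, arc, ← jacobiDn_two_ellK_sub h.modulus_sq_lt_one (etaOne η ω / √2 * r - _)]
  congr 2
  rw [← hT, Tplus]
  field_simp
  ring

theorem isPeriodicPeak {L : ℝ} (hL : 0 < L) (h : IsAmplitude η ω Z) (hZ : Z ≤ 0)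
    (hT : Tplus η ω Z = 2 * L) : IsPeriodicPeak L ω Z (zetaPeak L η ω Z) := by
  rw [zetaPeak_eq]
  refine isPeriodicPeak_periodize hL (h.arc_two_mul_sub hT) h.hasDerivAt_arc
    h.hasDerivAt_arcDeriv ?_
  rw [h.arcDeriv_zero, h.arc_zero, abs_of_nonpos hZ]
  ring

theorem zetaPeak_pos (L : ℝ) (h : IsAmplitude η ω Z) (ξ : ℝ) :
    0 < zetaPeak L η ω Z ξ := by
  rw [zetaPeak_eq, periodize_eq_norm]
  exact h.arc_pos _

end IsAmplitude

/-! ### The ascending Landen transformation -/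

/-- The integral `∫₀^x dt / √(4ω - D (1 + sin² t))`, where `D = (η₁ - η)²` and `4ω - D = (η₁ + η)²`;
up to the factor `η₁ + η` it is the normal elliptic integral of modulus `(η₁ - η) / (η₁ + η)`. -/
noncomputable def angleInt (D ω x : ℝ) : ℝ :=
  ∫ t in (0 : ℝ)..x, 1 / √(4 * ω - D * (1 + Real.sin t ^ 2))

theorem radicand_pos {D ω : ℝ} (hD : 0 ≤ D) (h : D < 2 * ω) (t : ℝ) :
    0 < 4 * ω - D * (1 + Real.sin t ^ 2) := by
  nlinarith [Real.sin_sq_le_one t, sq_nonneg (Real.sin t)]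

theorem continuous_angleInt_integrand {D ω : ℝ} (hD : 0 ≤ D) (h : D < 2 * ω) :
    Continuous fun t : ℝ => 1 / √(4 * ω - D * (1 + Real.sin t ^ 2)) :=
  continuous_const.div (by fun_prop) fun t => (Real.sqrt_pos.2 (radicand_pos hD h t)).ne'

theorem hasDerivAt_angleInt {D ω : ℝ} (hD : 0 ≤ D) (h : D < 2 * ω) (x : ℝ) :
    HasDerivAt (fun x => angleInt D ω x) (1 / √(4 * ω - D * (1 + Real.sin x ^ 2))) x :=
  intervalIntegral.integral_hasDerivAt_right
    ((continuous_angleInt_integrand hD h).intervalIntegrable _ _)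
    (continuous_angleInt_integrand hD h).stronglyMeasurable.stronglyMeasurableAtFilter
    (continuous_angleInt_integrand hD h).continuousAt

theorem angleInt_pi {D ω : ℝ} (hD : 0 ≤ D) (h : D < 2 * ω) :
    angleInt D ω Real.pi = 2 * angleInt D ω (Real.pi / 2) := by
  have hd : ∀ x, HasDerivAt (fun x => angleInt D ω (Real.pi - x) + angleInt D ω x) 0 x := by
    intro x
    have h1 := (hasDerivAt_angleInt hD h (Real.pi - x)).comp_const_sub Real.pi x
    have h2 := h1.add (hasDerivAt_angleInt hD h x)
    rw [Real.sin_pi_sub] at h2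
    exact h2.congr_deriv (neg_add_cancel _)
  have h0 := is_const_of_deriv_eq_zero (fun x => (hd x).differentiableAt)
    (fun x => (hd x).deriv) 0 (Real.pi / 2)
  have h00 : angleInt D ω 0 = 0 := by simp [angleInt]
  simp only [sub_half, sub_zero, h00] at h0
  linarith

/-- The angle `φ + arctan (κ tan φ)` of the ascending Landen transformation, `κ = η / η₁`. -/
noncomputable def landenAngle (κ φ : ℝ) : ℝ := φ + Real.arctan (κ * Real.tan φ)

section Landen

variable {b c φ : ℝ}

theorem landen_radicand_pos (hb : 0 < b) (hc : 0 < c) (φ : ℝ) :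
    0 < b ^ 2 * Real.cos φ ^ 2 + c ^ 2 * Real.sin φ ^ 2 := by
  have h := Real.sin_sq_add_cos_sq φ
  by_contra! hle
  have h1 : 0 ≤ b ^ 2 * Real.cos φ ^ 2 := by positivity
  have h2 : 0 ≤ c ^ 2 * Real.sin φ ^ 2 := by positivity
  have h3 : Real.cos φ ^ 2 = 0 := by
    have : b ^ 2 * Real.cos φ ^ 2 = 0 := by linarith
    exact (mul_eq_zero.1 this).resolve_left (by positivity)
  have h4 : Real.sin φ ^ 2 = 0 := by
    have : c ^ 2 * Real.sin φ ^ 2 = 0 := by linarith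
    exact (mul_eq_zero.1 this).resolve_left (by positivity)
  linarith

theorem sqrt_one_add_landen_sq (hb : 0 < b) (hφ : 0 < Real.cos φ) :
    √(1 + (c / b * Real.tan φ) ^ 2)
      = √(b ^ 2 * Real.cos φ ^ 2 + c ^ 2 * Real.sin φ ^ 2) / (b * Real.cos φ) := by
  rw [Real.tan_eq_sin_div_cos, ← Real.sqrt_sq (mul_pos hb hφ).le,
    ← Real.sqrt_div' _ (by positivity)]
  congr 1
  field_simp

theorem sin_landenAngle (hb : 0 < b) (hc : 0 < c) (hφ : 0 < Real.cos φ) :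
    Real.sin (landenAngle (c / b) φ) = (b + c) * (Real.sin φ * Real.cos φ)
      / √(b ^ 2 * Real.cos φ ^ 2 + c ^ 2 * Real.sin φ ^ 2) := by
  have := Real.sqrt_pos.2 (landen_radicand_pos hb hc φ)
  rw [landenAngle, Real.sin_add, Real.sin_arctan, Real.cos_arctan, sqrt_one_add_landen_sq hb hφ,
    Real.tan_eq_sin_div_cos]
  field_simp

theorem cos_landenAngle (hb : 0 < b) (hc : 0 < c) (hφ : 0 < Real.cos φ) :
    Real.cos (landenAngle (c / b) φ) = (b * Real.cos φ ^ 2 - c * Real.sin φ ^ 2)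
      / √(b ^ 2 * Real.cos φ ^ 2 + c ^ 2 * Real.sin φ ^ 2) := by
  have := Real.sqrt_pos.2 (landen_radicand_pos hb hc φ)
  rw [landenAngle, Real.cos_add, Real.sin_arctan, Real.cos_arctan, sqrt_one_add_landen_sq hb hφ,
    Real.tan_eq_sin_div_cos]
  field_simp

theorem hasDerivAt_landenAngle (hb : 0 < b) (hc : 0 < c) (hφ : 0 < Real.cos φ) :
    HasDerivAt (landenAngle (c / b)) ((b + c) * (b * Real.cos φ ^ 2 + c * Real.sin φ ^ 2)
      / (b ^ 2 * Real.cos φ ^ 2 + c ^ 2 * Real.sin φ ^ 2)) φ := by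
  have h1 := (hasDerivAt_id φ).add (((Real.hasDerivAt_tan hφ.ne').const_mul (c / b)).arctan)
  refine h1.congr_deriv ?_
  have h2 := (landen_radicand_pos hb hc φ).ne'
  rw [Real.tan_eq_sin_div_cos]
  have h3 : 1 + (c / b * (Real.sin φ / Real.cos φ)) ^ 2
      = (b ^ 2 * Real.cos φ ^ 2 + c ^ 2 * Real.sin φ ^ 2) / (b ^ 2 * Real.cos φ ^ 2) := by
    field_simp
  rw [h3]
  field_simp
  linear_combination (-(b * c)) * Real.sin_sq_add_cos_sq φ

variable {ω k : ℝ}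

/-- Landen's transformation of the incomplete integral, before the quarter period. -/
theorem ellF_div_eq_angleInt (hc : 0 < c) (hcb : c < b) (hω : 2 * ω = b ^ 2 + c ^ 2)
    (hk : b ^ 2 * k ^ 2 = b ^ 2 - c ^ 2) (hφ : φ ∈ Ioo (-(Real.pi / 2)) (Real.pi / 2)) :
    ellF φ k / b = angleInt ((b - c) ^ 2) ω (landenAngle (c / b) φ) := by
  have hb : 0 < b := hc.trans hcb
  have hk1 : k ^ 2 < 1 := by
    by_contra! h4
    nlinarith [mul_le_mul_of_nonneg_left h4 (sq_nonneg b), pow_pos hc 2]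
  have hD : (b - c) ^ 2 < 2 * ω := by nlinarith
  have key : ∀ x ∈ Ioo (-(Real.pi / 2)) (Real.pi / 2), HasDerivAt
      (fun φ => ellF φ k / b - angleInt ((b - c) ^ 2) ω (landenAngle (c / b) φ)) 0 x := by
    intro x hx
    have hcos := Real.cos_pos_of_mem_Ioo hx
    have hE := landen_radicand_pos hb hc x
    have h1 := (hasDerivAt_ellF hk1 x).div_const b
    have h2 := (hasDerivAt_angleInt (sq_nonneg (b - c)) hD (landenAngle (c / b) x)).comp x
      (hasDerivAt_landenAngle hb hc hcos)
    refine (h1.sub h2).congr_deriv ?_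
    have hsc := Real.sin_sq_add_cos_sq x
    have e1 : √(1 - k ^ 2 * Real.sin x ^ 2)
        = √(b ^ 2 * Real.cos x ^ 2 + c ^ 2 * Real.sin x ^ 2) / b := by
      rw [← Real.sqrt_sq hb.le, ← Real.sqrt_div' _ (by positivity), Real.sqrt_sq hb.le]
      congr 1
      field_simp
      linear_combination (-Real.sin x ^ 2) * hk - b ^ 2 * hsc
    have hw : 0 < b * Real.cos x ^ 2 + c * Real.sin x ^ 2 := by
      have : c * (Real.sin x ^ 2 + Real.cos x ^ 2) ≤ b * Real.cos x ^ 2 + c * Real.sin x ^ 2 := by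
        nlinarith [sq_nonneg (Real.cos x)]
      rw [hsc] at this
      linarith
    have e2 : √(4 * ω - (b - c) ^ 2 * (1 + Real.sin (landenAngle (c / b) x) ^ 2))
        = (b + c) * (b * Real.cos x ^ 2 + c * Real.sin x ^ 2)
          / √(b ^ 2 * Real.cos x ^ 2 + c ^ 2 * Real.sin x ^ 2) := by
      rw [sin_landenAngle hb hc hcos,
        ← Real.sqrt_sq (mul_pos (add_pos hb hc) hw).le, ← Real.sqrt_div' _ hE.le]
      congr 1
      rw [div_pow, Real.sq_sqrt hE.le]
      field_simp
      have e3 : Real.cos x ^ 2 = 1 - Real.sin x ^ 2 := by linarith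
      rw [e3]
      linear_combination 2 * (b ^ 2 * (1 - Real.sin x ^ 2) + c ^ 2 * Real.sin x ^ 2) * hω
    rw [e1, e2]
    have hE' := Real.sqrt_pos.2 hE
    have hE2 := Real.sq_sqrt hE.le
    rw [← hE2, Real.sqrt_sq hE'.le]
    field_simp
    ring
  have h0 := isOpen_Ioo.is_const_of_deriv_eq_zero isPreconnected_Ioo
    (fun x hx => (key x hx).differentiableAt.differentiableWithinAt)
    (fun x hx => (key x hx).deriv) hφ
    (show (0 : ℝ) ∈ Ioo (-(Real.pi / 2)) (Real.pi / 2) by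
      constructor <;> linarith [Real.pi_pos])
  simp [ellF_zero, landenAngle, angleInt] at h0
  simp only [angleInt, landenAngle, one_div]
  linarith

/-- Landen's transformation of the complete integral. -/
theorem ellK_div_eq_angleInt (hc : 0 < c) (hcb : c < b) (hω : 2 * ω = b ^ 2 + c ^ 2)
    (hk : b ^ 2 * k ^ 2 = b ^ 2 - c ^ 2) :
    ellK k / b = 2 * angleInt ((b - c) ^ 2) ω (Real.pi / 2) := by
  have hb : 0 < b := hc.trans hcb
  have hk1 : k ^ 2 < 1 := by
    by_contra! h4
    nlinarith [mul_le_mul_of_nonneg_left h4 (sq_nonneg b), pow_pos hc 2]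
  have hD : (b - c) ^ 2 < 2 * ω := by nlinarith
  have h1 : Tendsto (fun φ => ellF φ k / b) (𝓝[<] (Real.pi / 2)) (𝓝 (ellK k / b)) :=
    ((hasDerivAt_ellF hk1 (Real.pi / 2)).div_const b).continuousAt.mono_left inf_le_left
  have h2 : Tendsto (landenAngle (c / b)) (𝓝[<] (Real.pi / 2)) (𝓝 Real.pi) := by
    have ht : Tendsto (fun φ => c / b * Real.tan φ) (𝓝[<] (Real.pi / 2)) atTop :=
      Real.tendsto_tan_pi_div_two.const_mul_atTop (by positivity)
    have ha := (Real.tendsto_arctan_atTop.mono_right inf_le_left).comp ht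
    have := (tendsto_id.mono_left (inf_le_left : 𝓝[<] (Real.pi / 2) ≤ 𝓝 (Real.pi / 2))).add ha
    rwa [add_halves] at this
  have h3 := ((hasDerivAt_angleInt (sq_nonneg (b - c)) hD Real.pi).continuousAt.tendsto).comp h2
  rw [← angleInt_pi (sq_nonneg _) hD]
  refine tendsto_nhds_unique h1 (h3.congr' ?_)
  filter_upwards [Ioo_mem_nhdsLT (show -(Real.pi / 2) < Real.pi / 2 by linarith [Real.pi_pos])]
    with x hx
  exact (ellF_div_eq_angleInt hc hcb hω hk hx).symm

end Landen

/-! ### The period in the gap variable -/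

/-- The quarter-period integral `∫₀^{π/2} dt / √(4ω - D (1 + sin² t))`. -/
noncomputable def quarterInt (D ω : ℝ) : ℝ := angleInt D ω (Real.pi / 2)

/-- The contribution of the shift: `∫₀^m dx / √((D - x²)(4ω - D - x²))`, rescaled to `[0, 1]`. -/
noncomputable def shiftInt (D ω m : ℝ) : ℝ :=
  m * ∫ t in (0 : ℝ)..1, 1 / √((D - m ^ 2 * t ^ 2) * (4 * ω - D - m ^ 2 * t ^ 2))

/-- The substitution `x = √D sin t`. -/
theorem shiftInt_eq_angleInt {D ω m : ℝ} (hm : 0 ≤ m) (hmD : m ^ 2 < D) (h : D < 2 * ω) :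
    shiftInt D ω m = angleInt D ω (Real.arcsin (m / √D)) := by
  have hD : 0 < D := lt_of_le_of_lt (sq_nonneg m) hmD
  have hs : 0 < √D := Real.sqrt_pos.2 hD
  have hmlt : m < √D := Real.lt_sqrt_of_sq_lt hmD
  set x₀ := Real.arcsin (m / √D) with hx₀
  have hx0 : 0 ≤ x₀ := Real.arcsin_nonneg.2 (by positivity)
  have hx1 : x₀ < Real.pi / 2 := Real.arcsin_lt_pi_div_two.2 ((div_lt_one hs).2 hmlt)
  have hsin : √D * Real.sin x₀ = m := by
    rw [Real.sin_arcsin (by linarith [show 0 ≤ m / √D by positivity])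
      ((div_lt_one hs).2 hmlt).le, mul_div_cancel₀ _ hs.ne']
  set g : ℝ → ℝ := fun x => 1 / √((D - x ^ 2) * (4 * ω - D - x ^ 2)) with hg
  have hgpos : ∀ x ∈ Icc 0 m, 0 < (D - x ^ 2) * (4 * ω - D - x ^ 2) := by
    intro x hx
    have : x ^ 2 ≤ m ^ 2 := pow_le_pow_left₀ hx.1 hx.2 2
    exact mul_pos (by linarith) (by linarith)
  have h1 := intervalIntegral.integral_comp_mul_deriv'' (a := 0) (b := x₀)
    (f := fun t => √D * Real.sin t) (f' := fun t => √D * Real.cos t) (g := g)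
    (by fun_prop) (fun t _ => ((Real.hasDerivAt_sin t).const_mul (√D)).hasDerivWithinAt)
    (by fun_prop) ?_
  · simp only [Real.sin_zero, mul_zero, hsin] at h1
    have h2 := intervalIntegral.mul_integral_comp_mul_left (a := 0) (b := 1) (f := g) m
    simp only [mul_zero, mul_one] at h2
    rw [← h1] at h2
    rw [shiftInt, angleInt]
    simp only [hg, mul_pow] at h2
    rw [h2]
    refine intervalIntegral.integral_congr fun t ht => ?_
    rw [uIcc_of_le hx0] at ht
    have hcos : 0 < Real.cos t :=
      Real.cos_pos_of_mem_Ioo ⟨by linarith [ht.1, Real.pi_pos], by linarith [ht.2]⟩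
    have hsc := Real.sin_sq_add_cos_sq t
    have e1 : D - √D ^ 2 * Real.sin t ^ 2 = (√D * Real.cos t) ^ 2 := by
      rw [mul_pow, Real.sq_sqrt hD.le]
      linear_combination (-D) * hsc
    have e2 : 4 * ω - D - √D ^ 2 * Real.sin t ^ 2 = 4 * ω - D * (1 + Real.sin t ^ 2) := by
      rw [Real.sq_sqrt hD.le]
      ring
    simp only [Function.comp, mul_pow]
    rw [e1, e2, Real.sqrt_mul (sq_nonneg _), Real.sqrt_sq (by positivity)]
    have := Real.sqrt_pos.2 (radicand_pos hD.le h t)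
    field_simp
  · refine ContinuousOn.div continuousOn_const (by fun_prop) ?_
    rintro x ⟨t, ht, rfl⟩
    rw [uIcc_of_le hx0] at ht
    refine (Real.sqrt_pos.2 (hgpos _ ⟨?_, ?_⟩)).ne'
    · exact mul_nonneg hs.le (Real.sin_nonneg_of_nonneg_of_le_pi ht.1 (by linarith [ht.2]))
    · rw [← hsin]
      exact mul_le_mul_of_nonneg_left
        (Real.sin_le_sin_of_le_of_le_pi_div_two (by linarith [ht.1]) hx1.le ht.2) hs.le

namespace IsAmplitude

variable {η ω Z : ℝ}

theorem ellK_div (h : IsAmplitude η ω Z) :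
    ellK (modulus η ω) / etaOne η ω = 2 * quarterInt ((etaOne η ω - η) ^ 2) ω :=
  ellK_div_eq_angleInt h.pos h.lt_etaOne (by linarith [h.etaOne_sq]) h.modulus_sq_mul

/-- The slope equation places the Landen angle of the shift at `arcsin (m / (η₁ - η))`; the larger root
`Φ²` puts it in the first quadrant. -/
theorem shift_div (h : IsAmplitude η ω Z) :
    shift η ω Z / etaOne η ω = angleInt ((etaOne η ω - η) ^ 2) ω
      (Real.arcsin (|Z| / √2 / (etaOne η ω - η))) := by
  have hk := h.modulus_sq_lt_one
  have hb := h.etaOne_pos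
  have hd : 0 < etaOne η ω - η := sub_pos.2 h.lt_etaOne
  set φ := jacobiAm (shift η ω Z) (modulus η ω) with hφ
  have hF : ellF φ (modulus η ω) = shift η ω Z := ellF_jacobiAm hk _
  have hmem := h.am_shift_mem
  have hcn : 0 < Real.cos φ := by
    refine lt_of_le_of_ne h.cn_shift_nonneg fun e => ?_
    have h1 : etaOne η ω ^ 2 * modulus η ω ^ 2 * Real.cos φ ^ 2
      = Phi η ω Z ^ 2 - η ^ 2 := h.cn_shift_sq
    rw [← e] at h1
    linarith [h.eta_sq_lt_Phi_sq]
  have hlt : φ < Real.pi / 2 := lt_of_le_of_ne hmem.2 fun e => by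
    rw [e, Real.cos_pi_div_two] at hcn
    exact lt_irrefl _ hcn
  have hE : √(etaOne η ω ^ 2 * Real.cos φ ^ 2 + η ^ 2 * Real.sin φ ^ 2) = Phi η ω Z := by
    rw [← Real.sqrt_sq h.Phi_pos.le]
    congr 1
    have h1 : etaOne η ω ^ 2 * modulus η ω ^ 2 * Real.sin φ ^ 2
      = etaOne η ω ^ 2 - Phi η ω Z ^ 2 := h.sn_shift_sq
    linear_combination Real.sin φ ^ 2 * h.modulus_sq_mul - h1
      + etaOne η ω ^ 2 * Real.sin_sq_add_cos_sq φ
  have hsin : Real.sin (landenAngle (η / etaOne η ω) φ) = |Z| / √2 / (etaOne η ω - η) := by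
    rw [sin_landenAngle hb h.pos hcn, hE, div_eq_div_iff h.Phi_pos.ne' hd.ne']
    have h1 : etaOne η ω ^ 2 * modulus η ω ^ 2 * (Real.sin φ * Real.cos φ)
      = |Z| / √2 * Phi η ω Z := h.slope_shift
    rw [← h1, h.modulus_sq_mul]
    ring
  have hcos : 0 ≤ Real.cos (landenAngle (η / etaOne η ω) φ) := by
    rw [cos_landenAngle hb h.pos hcn, hE]
    refine div_nonneg ?_ h.Phi_pos.le
    have h1 : etaOne η ω ^ 2 * modulus η ω ^ 2 * Real.sin φ ^ 2
      = etaOne η ω ^ 2 - Phi η ω Z ^ 2 := h.sn_shift_sq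
    have h2 : etaOne η ω ^ 2 * modulus η ω ^ 2 * Real.cos φ ^ 2
      = Phi η ω Z ^ 2 - η ^ 2 := h.cn_shift_sq
    rw [h.modulus_sq_mul] at h1 h2
    have h3 := h.Phi_spec.2
    have h4 : (etaOne η ω ^ 2 - η ^ 2) * (etaOne η ω * Real.cos φ ^ 2 - η * Real.sin φ ^ 2)
        = (etaOne η ω + η) * (Phi η ω Z ^ 2 - η * etaOne η ω) := by
      linear_combination etaOne η ω * h2 - η * h1
    have h5 : 0 < etaOne η ω ^ 2 - η ^ 2 := by nlinarith [h.pos]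
    refine nonneg_of_mul_nonneg_right (a := etaOne η ω ^ 2 - η ^ 2) ?_ h5
    rw [h4]
    exact mul_nonneg (by linarith [h.pos]) (by linarith)
  have htan : 0 ≤ η / etaOne η ω * Real.tan φ :=
    mul_nonneg (div_nonneg h.pos.le hb.le) (Real.tan_nonneg_of_nonneg_of_le_pi_div_two hmem.1 hmem.2)
  have hψ0 : 0 ≤ landenAngle (η / etaOne η ω) φ :=
    add_nonneg hmem.1 (Real.arctan_nonneg.2 htan)
  have hψ1 : landenAngle (η / etaOne η ω) φ ≤ Real.pi / 2 := by
    by_contra! hgt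
    refine absurd (Real.cos_neg_of_pi_div_two_lt_of_lt hgt ?_) (not_lt.2 hcos)
    have := Real.arctan_lt_pi_div_two (η / etaOne η ω * Real.tan φ)
    rw [landenAngle]
    linarith [Real.pi_pos]
  rw [← hF, ← hsin, Real.arcsin_sin (by linarith [Real.pi_pos]) hψ1]
  exact ellF_div_eq_angleInt h.pos h.lt_etaOne (by linarith [h.etaOne_sq]) h.modulus_sq_mul
    ⟨by linarith [hmem.1, Real.pi_pos], hlt⟩

theorem Tplus_eq_angleInt (h : IsAmplitude η ω Z) :
    Tplus η ω Z = 2 * √2 * (2 * quarterInt ((etaOne η ω - η) ^ 2) ω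
      + angleInt ((etaOne η ω - η) ^ 2) ω (Real.arcsin (|Z| / √2 / (etaOne η ω - η)))) := by
  rw [← h.ellK_div, ← h.shift_div, Tplus]
  ring

theorem shift_eq_zero (h : IsAmplitude η ω 0) : shift η ω 0 = 0 := by
  have h1 := h.shift_div
  rw [abs_zero, zero_div, zero_div, Real.arcsin_zero, angleInt,
    intervalIntegral.integral_same] at h1
  exact (div_eq_zero_iff.1 h1).resolve_right h.etaOne_pos.ne'

end IsAmplitude

/-- The period divided by `2√2`, as a function of the squared gap `D = (η₁ - η)²`, of `ω`
and of `m = |Z| / √2`. -/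
noncomputable def gapPeriod (D ω m : ℝ) : ℝ := 2 * quarterInt D ω + shiftInt D ω m

/-- The smaller amplitude as a function of the squared gap `D = (η₁ - η)²`. -/
noncomputable def etaOfGap (D ω : ℝ) : ℝ := (√(4 * ω - D) - √D) / 2

section Gap

variable {η ω Z D : ℝ}

theorem theta_add_lam_spec (hω : Z ^ 2 / 4 < ω) :
    0 < theta ω Z ∧ etaOne (theta ω Z) ω = lam ω Z ∧ lam ω Z - theta ω Z = |Z| / √2 ∧
      theta ω Z ^ 2 + lam ω Z ^ 2 = 2 * ω := by
  have h2 : √2 * √2 = 2 := Real.mul_self_sqrt zero_le_two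
  have hr := Real.sq_sqrt (show 0 ≤ ω - Z ^ 2 / 8 by nlinarith [sq_nonneg Z])
  have hq : (√2 / 4 * |Z|) ^ 2 = Z ^ 2 / 8 := by
    rw [mul_pow, sq_abs, div_pow, Real.sq_sqrt zero_le_two]
    ring
  have h3 : theta ω Z ^ 2 + lam ω Z ^ 2 = 2 * ω := by
    rw [theta, lam]
    linear_combination 2 * hr + 2 * hq
  have hq0 : 0 ≤ √2 / 4 * |Z| := by positivity
  have hlt : √2 / 4 * |Z| < √(ω - Z ^ 2 / 8) := by
    refine Real.lt_sqrt_of_sq_lt ?_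
    rw [hq]
    linarith
  refine ⟨by rw [theta]; linarith, ?_, ?_, h3⟩
  · rw [etaOne, show 2 * ω - theta ω Z ^ 2 = lam ω Z ^ 2 by linarith, Real.sqrt_sq]
    rw [lam]
    positivity
  · rw [lam, theta, eq_div_iff (by positivity)]
    linear_combination (1 / 2 * |Z|) * h2

theorem isAmplitude_theta (hω : Z ^ 2 / 4 < ω) (hZ : Z ≠ 0) : IsAmplitude (theta ω Z) ω Z := by
  obtain ⟨h1, h2, h3, -⟩ := theta_add_lam_spec hω
  refine ⟨h1, ?_, by rw [h2, h3]⟩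
  have : 0 < |Z| / √2 := by positivity
  rw [h2]
  linarith

theorem etaOne_lt_etaOne {η' : ℝ} (h0 : 0 ≤ η) (h : η < η') (h' : 0 < etaOne η' ω) :
    etaOne η' ω < etaOne η ω :=
  Real.sqrt_lt_sqrt (Real.sqrt_pos.1 h').le (by nlinarith)

theorem gap_of_mem_Ioo (hω : Z ^ 2 / 4 < ω) (hη : η ∈ Ioo 0 (theta ω Z)) :
    IsAmplitude η ω Z ∧ Z ^ 2 / 2 < (etaOne η ω - η) ^ 2 ∧ (etaOne η ω - η) ^ 2 < 2 * ω ∧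
      etaOfGap ((etaOne η ω - η) ^ 2) ω = η := by
  obtain ⟨h1, h2, h3, h4⟩ := theta_add_lam_spec hω
  have h5 : 0 ≤ |Z| / √2 := by positivity
  have h6 := etaOne_lt_etaOne hη.1.le hη.2 (ω := ω) (by rw [h2]; linarith)
  rw [h2] at h6
  have h7 : |Z| / √2 < etaOne η ω - η := by linarith [hη.2]
  have hA : IsAmplitude η ω Z := ⟨hη.1, by linarith, h7.le⟩
  refine ⟨hA, ?_, ?_, ?_⟩
  · have := pow_lt_pow_left₀ h7 h5 two_ne_zero
    rwa [div_pow, sq_abs, Real.sq_sqrt zero_le_two] at this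
  · nlinarith [hA.etaOne_sq, hA.pos, hA.etaOne_pos]
  · have e : 4 * ω - (etaOne η ω - η) ^ 2 = (etaOne η ω + η) ^ 2 := by
      linear_combination (-2) * hA.etaOne_sq
    rw [etaOfGap, e, Real.sqrt_sq (by linarith [hA.pos, hA.etaOne_pos]), Real.sqrt_sq (by linarith)]
    ring

theorem etaOfGap_spec (hZD : Z ^ 2 / 2 < D) (hD : D < 2 * ω) :
    etaOfGap D ω ∈ Ioo 0 (theta ω Z) ∧ (etaOne (etaOfGap D ω) ω - etaOfGap D ω) ^ 2 = D := by
  have hD0 : 0 ≤ D := by linarith [sq_nonneg Z]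
  have hω : Z ^ 2 / 4 < ω := by linarith
  have s1 := Real.sq_sqrt hD0
  have s2 := Real.sq_sqrt (show 0 ≤ 4 * ω - D by linarith)
  have hlt : √D < √(4 * ω - D) := Real.sqrt_lt_sqrt hD0 (by linarith)
  have h0 := Real.sqrt_nonneg D
  have hpos : 0 < etaOfGap D ω := by rw [etaOfGap]; linarith
  have e1 : etaOne (etaOfGap D ω) ω = (√(4 * ω - D) + √D) / 2 := by
    rw [etaOne, etaOfGap, ← Real.sqrt_sq (show 0 ≤ (√(4 * ω - D) + √D) / 2 by linarith)]
    congr 1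
    linear_combination (-1 / 2) * s1 - (1 / 2) * s2
  have e2 : etaOne (etaOfGap D ω) ω - etaOfGap D ω = √D := by
    rw [e1, etaOfGap]
    ring
  refine ⟨⟨hpos, ?_⟩, by rw [e2, s1]⟩
  obtain ⟨h1, h2, h3, h4⟩ := theta_add_lam_spec hω
  by_contra! hle
  have h5 : etaOne (etaOfGap D ω) ω ≤ lam ω Z := by
    rw [← h2]
    exact Real.sqrt_le_sqrt (by nlinarith)
  have h6 : √D ≤ |Z| / √2 := by linarith
  have h7 := pow_le_pow_left₀ h0 h6 2
  rw [div_pow, sq_abs, Real.sq_sqrt zero_le_two, s1] at h7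
  linarith

theorem Tplus_eq_gapPeriod (hω : Z ^ 2 / 4 < ω) (hη : η ∈ Ioo 0 (theta ω Z)) :
    Tplus η ω Z = 2 * √2 * gapPeriod ((etaOne η ω - η) ^ 2) ω (|Z| / √2) := by
  obtain ⟨hA, h1, h2, -⟩ := gap_of_mem_Ioo hω hη
  rw [hA.Tplus_eq_angleInt, gapPeriod, shiftInt_eq_angleInt (by positivity) _ h2,
    Real.sqrt_sq (by linarith [hA.lt_etaOne])]
  rwa [div_pow, sq_abs, Real.sq_sqrt zero_le_two]

/-- At `η = θ` the Landen angle of the shift is `π / 2`, so the shift is half of the quarter period. -/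
theorem Tone_eq_quarterInt (hω : Z ^ 2 / 4 < ω) (hZ : Z ≠ 0) :
    Tone ω Z = 2 * √2 * (3 * quarterInt (Z ^ 2 / 2) ω) := by
  obtain ⟨h1, h2, h3, h4⟩ := theta_add_lam_spec hω
  have hA := isAmplitude_theta hω hZ
  have hm : 0 < |Z| / √2 := by positivity
  have hl : 0 < lam ω Z := by linarith
  have hr := Real.sq_sqrt (show 0 ≤ ω - Z ^ 2 / 8 by nlinarith [sq_nonneg Z])
  have hq : (√2 / 4 * |Z|) ^ 2 = Z ^ 2 / 8 := by
    rw [mul_pow, sq_abs, div_pow, Real.sq_sqrt zero_le_two]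
    ring
  have e1 : modulus (theta ω Z) ω = kZero ω Z := by
    rw [modulus, kZero]
    congr 1
    rw [show 2 * ω - theta ω Z ^ 2 = lam ω Z ^ 2 by linarith]
    congr 1
    rw [theta]
    linear_combination (-2) * hr - 2 * hq
  have hprod : theta ω Z * lam ω Z = ω - Z ^ 2 / 4 := by
    rw [theta, lam]
    linear_combination hr - hq
  have e2 : Phi (theta ω Z) ω Z = √(ω - Z ^ 2 / 4) := by
    rw [Phi, show (2 * ω - Z ^ 2 / 2) ^ 2 - 4 * theta ω Z ^ 2 * (2 * ω - theta ω Z ^ 2) = 0 by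
      rw [show 2 * ω - theta ω Z ^ 2 = lam ω Z ^ 2 by linarith]
      linear_combination (-4) * (theta ω Z * lam ω Z + (ω - Z ^ 2 / 4)) * hprod,
      Real.sqrt_zero]
    congr 1
    ring
  have e3 : Tone ω Z = Tplus (theta ω Z) ω Z := by
    rw [Tone, Tplus, aZero, shift, e1, e2, h2]
  rw [e3, hA.Tplus_eq_angleInt, h2, h3, div_self hm.ne', Real.arcsin_one, div_pow, sq_abs,
    Real.sq_sqrt zero_le_two, ← quarterInt]
  ring

end Gap

/-! ### Analyticity of integrals depending on parameters -/

section InvSqrt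

variable {X : Type*} [TopologicalSpace X]

theorem isUnit_of_forall_pos {f : C(X, ℝ)} (hf : ∀ x, 0 < f x) : IsUnit f :=
  (ContinuousMap.isUnit_iff_forall_ne_zero f).2 fun x => (hf x).ne'

/-- Pointwise square root on `C(X, ℝ)`. -/
noncomputable def sqrtMap (f : C(X, ℝ)) : C(X, ℝ) :=
  (⟨Real.sqrt, Real.continuous_sqrt⟩ : C(ℝ, ℝ)).comp f

/-- Pointwise reciprocal square root on `C(X, ℝ)`, of interest for positive functions only. -/
noncomputable def invSqrtMap (f : C(X, ℝ)) : C(X, ℝ) := Ring.inverse (sqrtMap f)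

theorem invSqrtMap_apply {f : C(X, ℝ)} (hf : ∀ x, 0 < f x) (x : X) :
    invSqrtMap f x = 1 / √(f x) := by
  have h := Ring.mul_inverse_cancel _ (isUnit_of_forall_pos (f := sqrtMap f)
    fun x => Real.sqrt_pos.2 (hf x))
  have h1 := DFunLike.congr_fun h x
  rw [eq_div_iff (Real.sqrt_pos.2 (hf x)).ne', mul_comm]
  exact h1

variable [CompactSpace X]

theorem isOpen_setOf_forall_pos : IsOpen {f : C(X, ℝ) | ∀ x, 0 < f x} := by
  have := ContinuousMap.isOpen_setOfPred_mapsTo (X := X) (Y := ℝ) isCompact_univ (isOpen_Ioi (a := 0))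
  simpa [MapsTo] using this

/-- Squaring, as a homeomorphism of the open cone of positive functions. -/
noncomputable def squareHomeo : OpenPartialHomeomorph C(X, ℝ) C(X, ℝ) where
  toFun f := f * f
  invFun := sqrtMap
  source := {f | ∀ x, 0 < f x}
  target := {f | ∀ x, 0 < f x}
  map_source' f hf x := mul_pos (hf x) (hf x)
  map_target' f hf x := Real.sqrt_pos.2 (hf x)
  left_inv' f hf := by
    ext x
    exact Real.sqrt_mul_self (hf x).le
  right_inv' f hf := by
    ext x
    exact Real.mul_self_sqrt (hf x).le
  open_source := isOpen_setOf_forall_pos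
  open_target := isOpen_setOf_forall_pos
  continuousOn_toFun := by fun_prop
  continuousOn_invFun :=
    (ContinuousMap.continuous_postcomp (⟨Real.sqrt, Real.continuous_sqrt⟩ : C(ℝ, ℝ))).continuousOn

theorem contDiffAt_sqrtMap {f : C(X, ℝ)} (hf : ∀ x, 0 < f x) :
    ContDiffAt ℝ (⊤ : WithTop ℕ∞) sqrtMap f := by
  set g : C(X, ℝ) := sqrtMap f with hg
  have hgpos : ∀ x, 0 < g x := fun x => Real.sqrt_pos.2 (hf x)
  obtain ⟨u, hu⟩ := isUnit_of_forall_pos (f := g + g) fun x => add_pos (hgpos x) (hgpos x)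
  have h := squareHomeo.contDiffAt_symm (𝕜 := ℝ) (n := (⊤ : WithTop ℕ∞)) (a := f)
    (f₀' := ContinuousLinearEquiv.equivOfInverse
      (ContinuousLinearMap.mul ℝ C(X, ℝ) (u : C(X, ℝ)))
      (ContinuousLinearMap.mul ℝ C(X, ℝ) ((u⁻¹ : C(X, ℝ)ˣ) : C(X, ℝ)))
      (fun x => by simp) (fun x => by simp)) hf ?_ ?_
  · exact h
  · change HasFDerivAt (fun f : C(X, ℝ) => f * f) _ g
    refine ((hasFDerivAt_id g).mul (hasFDerivAt_id g)).congr_fderiv ?_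
    ext1 v
    simp [hu, mul_comm]
  · change ContDiffAt ℝ _ (fun f : C(X, ℝ) => f * f) g
    fun_prop

theorem contDiffAt_invSqrtMap {f : C(X, ℝ)} (hf : ∀ x, 0 < f x) :
    ContDiffAt ℝ (⊤ : WithTop ℕ∞) invSqrtMap f := by
  obtain ⟨u, hu⟩ := isUnit_of_forall_pos (f := sqrtMap f) fun x => Real.sqrt_pos.2 (hf x)
  have h := contDiffAt_ringInverse ℝ (n := (⊤ : WithTop ℕ∞)) u
  rw [hu] at h
  exact h.comp f (contDiffAt_sqrtMap hf)

end InvSqrt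

section Volterra

variable {L : ℝ}

/-- The primitive `ξ ↦ ∫₀^ξ f` as a bounded operator on `C([0, L])`. -/
noncomputable def primitive (hL : 0 ≤ L) : C(Icc (0 : ℝ) L, ℝ) →L[ℝ] C(Icc (0 : ℝ) L, ℝ) :=
  LinearMap.mkContinuous
    { toFun := fun f =>
        ⟨fun ξ => ∫ s in (0 : ℝ)..ξ, IccExtend hL f s, by
          have := (intervalIntegral.differentiable_integral_of_continuous
            (a := 0) (f.continuous.Icc_extend' (h := hL))).continuous
          exact this.comp continuous_subtype_val⟩
      map_add' := fun f g => by
        ext ξ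
        simp only [ContinuousMap.coe_mk, ContinuousMap.add_apply]
        rw [← intervalIntegral.integral_add
          (f.continuous.Icc_extend'.intervalIntegrable _ _)
          (g.continuous.Icc_extend'.intervalIntegrable _ _)]
        rfl
      map_smul' := fun c f => by
        ext ξ
        simp only [ContinuousMap.coe_mk, ContinuousMap.smul_apply, RingHom.id_apply]
        rw [← intervalIntegral.integral_smul]
        rfl }
    L fun f => by
      refine (ContinuousMap.norm_le _ (by positivity)).2 fun ξ => ?_
      have h := intervalIntegral.norm_integral_le_of_norm_le_const (a := 0) (b := (ξ : ℝ))
        (f := IccExtend hL f) (C := ‖f‖) fun s _ => f.norm_coe_le_norm _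
      refine h.trans ?_
      rw [sub_zero, abs_of_nonneg ξ.2.1, mul_comm]
      exact mul_le_mul_of_nonneg_right ξ.2.2 (norm_nonneg f)

theorem primitive_apply (hL : 0 ≤ L) (f : C(Icc (0 : ℝ) L, ℝ)) (ξ : Icc (0 : ℝ) L) :
    primitive hL f ξ = ∫ s in (0 : ℝ)..ξ, IccExtend hL f s := rfl

theorem contDiffAt_integral_invSqrt {E : Type*} [NormedAddCommGroup E] [NormedSpace ℝ E]
    (hL : 0 ≤ L) {A : E → C(Icc (0 : ℝ) L, ℝ)} {F : E → ℝ → ℝ} (hAF : ∀ q x, A q x = F q x) {p : E}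
    (hA : ContDiffAt ℝ (⊤ : WithTop ℕ∞) A p) (hpos : ∀ t ∈ Icc 0 L, 0 < F p t) :
    ContDiffAt ℝ (⊤ : WithTop ℕ∞) (fun q => ∫ t in (0 : ℝ)..L, 1 / √(F q t)) p := by
  have hp : ∀ x, 0 < A p x := fun x => by
    rw [hAF]
    exact hpos x x.2
  let ev : C(Icc (0 : ℝ) L, ℝ) →L[ℝ] ℝ := ContinuousMap.evalCLM ℝ ⟨L, hL, le_rfl⟩
  have h1 : ContDiffAt ℝ (⊤ : WithTop ℕ∞)
      (fun q => ev (primitive hL (invSqrtMap (A q)))) p :=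
    (ev.contDiff.comp (primitive hL).contDiff).contDiffAt.comp p
      ((contDiffAt_invSqrtMap hp).comp p hA)
  refine h1.congr_of_eventuallyEq ?_
  filter_upwards [hA.continuousAt.preimage_mem_nhds (isOpen_setOf_forall_pos.mem_nhds hp)] with q hq
  change _ = ∫ s in (0 : ℝ)..L, IccExtend hL (invSqrtMap (A q)) s
  refine intervalIntegral.integral_congr fun t ht => ?_
  rw [uIcc_of_le hL] at ht
  rw [IccExtend_of_mem hL _ ht, invSqrtMap_apply hq, hAF]

end Volterra

theorem contDiffAt_quarterInt {p : ℝ × ℝ} (h0 : 0 ≤ p.1) (h1 : p.1 < 2 * p.2) :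
    ContDiffAt ℝ (⊤ : WithTop ℕ∞) (fun q : ℝ × ℝ => quarterInt q.1 q.2) p := by
  let s : C(Icc (0 : ℝ) (Real.pi / 2), ℝ) := ⟨fun t => 1 + Real.sin t ^ 2, by fun_prop⟩
  refine contDiffAt_integral_invSqrt (by positivity)
    (A := fun q : ℝ × ℝ => (4 * q.2) • (1 : C(Icc (0 : ℝ) (Real.pi / 2), ℝ)) - q.1 • s)
    (F := fun q t => 4 * q.2 - q.1 * (1 + Real.sin t ^ 2)) (fun q x => by simp [s]) ?_
    fun t _ => radicand_pos h0 h1 t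
  fun_prop

theorem shiftInt_radicand_pos {D ω m t : ℝ} (hmD : m ^ 2 < D) (hD : D < 2 * ω)
    (ht : t ∈ Icc (0 : ℝ) 1) : 0 < D - m ^ 2 * t ^ 2 ∧ 0 < 4 * ω - D - m ^ 2 * t ^ 2 := by
  have : m ^ 2 * t ^ 2 ≤ m ^ 2 :=
    mul_le_of_le_one_right (sq_nonneg m) (pow_le_one₀ ht.1 ht.2)
  constructor <;> linarith

theorem contDiffAt_shiftInt {p : ℝ × ℝ × ℝ} (h0 : p.2.2 ^ 2 < p.1) (h1 : p.1 < 2 * p.2.1) :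
    ContDiffAt ℝ (⊤ : WithTop ℕ∞) (fun q : ℝ × ℝ × ℝ => shiftInt q.1 q.2.1 q.2.2) p := by
  let s : C(Icc (0 : ℝ) 1, ℝ) := ⟨fun t => (t : ℝ) ^ 2, by fun_prop⟩
  refine ContDiffAt.mul (by fun_prop) (contDiffAt_integral_invSqrt zero_le_one
    (A := fun q : ℝ × ℝ × ℝ => (q.1 • (1 : C(Icc (0 : ℝ) 1, ℝ)) - q.2.2 ^ 2 • s)
      * ((4 * q.2.1 - q.1) • (1 : C(Icc (0 : ℝ) 1, ℝ)) - q.2.2 ^ 2 • s))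
    (F := fun q t => (q.1 - q.2.2 ^ 2 * t ^ 2) * (4 * q.2.1 - q.1 - q.2.2 ^ 2 * t ^ 2))
    (fun q x => by simp [s]) ?_ fun t ht => ?_)
  · fun_prop
  · exact mul_pos (shiftInt_radicand_pos h0 h1 ht).1 (shiftInt_radicand_pos h0 h1 ht).2

theorem contDiffAt_gapPeriod {p : ℝ × ℝ × ℝ} (h0 : p.2.2 ^ 2 < p.1) (h1 : p.1 < 2 * p.2.1) :
    ContDiffAt ℝ (⊤ : WithTop ℕ∞) (fun q : ℝ × ℝ × ℝ => gapPeriod q.1 q.2.1 q.2.2) p := by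
  have h2 : ContDiffAt ℝ (⊤ : WithTop ℕ∞) (fun q : ℝ × ℝ × ℝ => quarterInt q.1 q.2.1) p :=
    (contDiffAt_quarterInt (p := (p.1, p.2.1)) ((sq_nonneg _).trans h0.le) h1).comp p
      (f := fun q : ℝ × ℝ × ℝ => (q.1, q.2.1)) (by fun_prop)
  exact (contDiffAt_const.mul h2).add (contDiffAt_shiftInt h0 h1)

/-! ### Convexity and monotonicity of the period -/

/-- Joint convexity of `(x, y) ↦ 1 / √(x y)` on the positive quadrant. -/
theorem one_div_sqrt_mul_le {a b x₁ y₁ x₂ y₂ : ℝ} (ha : 0 ≤ a) (hb : 0 ≤ b) (hab : a + b = 1)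
    (hx₁ : 0 < x₁) (hy₁ : 0 < y₁) (hx₂ : 0 < x₂) (hy₂ : 0 < y₂) :
    1 / √((a * x₁ + b * x₂) * (a * y₁ + b * y₂))
      ≤ a * (1 / √(x₁ * y₁)) + b * (1 / √(x₂ * y₂)) := by
  set s := √(x₁ * y₁) with hs
  set t := √(x₂ * y₂) with ht
  have hs0 : 0 < s := Real.sqrt_pos.2 (mul_pos hx₁ hy₁)
  have ht0 : 0 < t := Real.sqrt_pos.2 (mul_pos hx₂ hy₂)
  have hs2 : s ^ 2 = x₁ * y₁ := Real.sq_sqrt (mul_pos hx₁ hy₁).le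
  have ht2 : t ^ 2 = x₂ * y₂ := Real.sq_sqrt (mul_pos hx₂ hy₂).le
  have hpos : 0 < a * s + b * t := by
    rcases eq_or_lt_of_le ha with h | h
    · rw [← h, show b = 1 by linarith]
      linarith
    · have := mul_nonneg hb ht0.le
      nlinarith
  -- Cauchy's inequality for the geometric means
  have hcross : 2 * (s * t) ≤ x₁ * y₂ + x₂ * y₁ := by
    refine le_of_sq_le_sq ?_ (by positivity)
    have : (2 * (s * t)) ^ 2 = 4 * (x₁ * y₂) * (x₂ * y₁) := by
      rw [mul_pow, mul_pow, hs2, ht2]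
      ring
    rw [this]
    nlinarith [sq_nonneg (x₁ * y₂ - x₂ * y₁)]
  have h1 : a * s + b * t ≤ √((a * x₁ + b * x₂) * (a * y₁ + b * y₂)) := by
    refine Real.le_sqrt_of_sq_le ?_
    have e : (a * x₁ + b * x₂) * (a * y₁ + b * y₂) - (a * s + b * t) ^ 2
        = a * b * (x₁ * y₂ + x₂ * y₁ - 2 * (s * t)) := by
      linear_combination (-a ^ 2) * hs2 - b ^ 2 * ht2
    nlinarith [mul_nonneg (mul_nonneg ha hb) (sub_nonneg.2 hcross)]
  refine (one_div_le_one_div_of_le hpos h1).trans ?_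
  have e : a * (1 / s) + b * (1 / t) - 1 / (a * s + b * t)
      = a * b * (s - t) ^ 2 / (s * t * (a * s + b * t)) := by
    have hb' : b = 1 - a := by linarith
    have := hpos.ne'
    field_simp
    rw [hb']
    ring
  have : 0 ≤ a * b * (s - t) ^ 2 / (s * t * (a * s + b * t)) := by positivity
  linarith

theorem continuousOn_shiftInt_integrand {D ω m : ℝ} (hmD : m ^ 2 < D) (hD : D < 2 * ω) :
    ContinuousOn (fun t => 1 / √((D - m ^ 2 * t ^ 2) * (4 * ω - D - m ^ 2 * t ^ 2)))
      (Icc (0 : ℝ) 1) := by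
  refine continuousOn_const.div (by fun_prop) fun t ht => (Real.sqrt_pos.2 ?_).ne'
  exact mul_pos (shiftInt_radicand_pos hmD hD ht).1 (shiftInt_radicand_pos hmD hD ht).2

theorem intervalIntegrable_shiftInt {D ω m : ℝ} (hmD : m ^ 2 < D) (hD : D < 2 * ω) :
    IntervalIntegrable (fun t => 1 / √((D - m ^ 2 * t ^ 2) * (4 * ω - D - m ^ 2 * t ^ 2)))
      volume (0 : ℝ) 1 :=
  ContinuousOn.intervalIntegrable (by
    rw [uIcc_of_le zero_le_one]
    exact continuousOn_shiftInt_integrand hmD hD)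

theorem intervalIntegrable_quarterInt {D ω : ℝ} (h0 : 0 ≤ D) (hD : D < 2 * ω) (a b : ℝ) :
    IntervalIntegrable (fun t => 1 / √(4 * ω - D * (1 + Real.sin t ^ 2))) volume a b :=
  (continuous_angleInt_integrand h0 hD).intervalIntegrable _ _

/-- The period is a convex function of the squared gap. -/
theorem convexOn_gapPeriod {ω m : ℝ} (hm : 0 ≤ m) :
    ConvexOn ℝ (Ioo (m ^ 2) (2 * ω)) fun D => gapPeriod D ω m := by
  refine ⟨convex_Ioo _ _, fun D₁ h₁ D₂ h₂ a b ha hb hab => ?_⟩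
  have h₃ : a * D₁ + b * D₂ ∈ Ioo (m ^ 2) (2 * ω) := convex_Ioo _ _ h₁ h₂ ha hb hab
  simp only [smul_eq_mul, gapPeriod]
  have hb' : b = 1 - a := by linarith
  have hq : quarterInt (a * D₁ + b * D₂) ω ≤ a * quarterInt D₁ ω + b * quarterInt D₂ ω := by
    have i₁ := intervalIntegrable_quarterInt ((sq_nonneg m).trans h₁.1.le) h₁.2 0 (Real.pi / 2)
    have i₂ := intervalIntegrable_quarterInt ((sq_nonneg m).trans h₂.1.le) h₂.2 0 (Real.pi / 2)
    have i₃ := intervalIntegrable_quarterInt ((sq_nonneg m).trans h₃.1.le) h₃.2 0 (Real.pi / 2)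
    simp only [quarterInt, angleInt]
    rw [← intervalIntegral.integral_const_mul, ← intervalIntegral.integral_const_mul,
      ← intervalIntegral.integral_add (i₁.const_mul a) (i₂.const_mul b)]
    refine intervalIntegral.integral_mono_on (by positivity) i₃
      ((i₁.const_mul a).add (i₂.const_mul b)) fun t _ => ?_
    have := one_div_sqrt_mul_le ha hb hab
      (radicand_pos ((sq_nonneg m).trans h₁.1.le) h₁.2 t) one_pos
      (radicand_pos ((sq_nonneg m).trans h₂.1.le) h₂.2 t) one_pos
    simp only [mul_one, hab] at this
    refine le_trans (le_of_eq ?_) this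
    congr 2
    rw [hb']
    ring
  have hs : shiftInt (a * D₁ + b * D₂) ω m ≤ a * shiftInt D₁ ω m + b * shiftInt D₂ ω m := by
    have i₁ := intervalIntegrable_shiftInt h₁.1 h₁.2
    have i₂ := intervalIntegrable_shiftInt h₂.1 h₂.2
    have i₃ := intervalIntegrable_shiftInt h₃.1 h₃.2
    simp only [shiftInt]
    rw [mul_left_comm a, mul_left_comm b, ← mul_add]
    refine mul_le_mul_of_nonneg_left ?_ hm
    rw [← intervalIntegral.integral_const_mul, ← intervalIntegral.integral_const_mul,
      ← intervalIntegral.integral_add (i₁.const_mul a) (i₂.const_mul b)]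
    refine intervalIntegral.integral_mono_on zero_le_one i₃
      ((i₁.const_mul a).add (i₂.const_mul b)) fun t ht => ?_
    have p₁ := shiftInt_radicand_pos h₁.1 h₁.2 ht
    have p₂ := shiftInt_radicand_pos h₂.1 h₂.2 ht
    refine le_trans (le_of_eq ?_) (one_div_sqrt_mul_le ha hb hab p₁.1 p₁.2 p₂.1 p₂.2)
    congr 2
    rw [hb']
    ring
  linarith

theorem quarterInt_anti {D ω ω' : ℝ} (h0 : 0 ≤ D) (hD : D < 2 * ω) (h : ω ≤ ω') :
    quarterInt D ω' ≤ quarterInt D ω := by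
  refine intervalIntegral.integral_mono_on (by positivity)
    (intervalIntegrable_quarterInt h0 (by linarith) _ _)
    (intervalIntegrable_quarterInt h0 hD _ _) fun t _ => ?_
  exact one_div_le_one_div_of_le (Real.sqrt_pos.2 (radicand_pos h0 hD t))
    (Real.sqrt_le_sqrt (by linarith))

theorem shiftInt_anti {D ω ω' m : ℝ} (hm : 0 ≤ m) (hmD : m ^ 2 < D) (hD : D < 2 * ω)
    (h : ω ≤ ω') : shiftInt D ω' m ≤ shiftInt D ω m := by
  refine mul_le_mul_of_nonneg_left ?_ hm
  refine intervalIntegral.integral_mono_on zero_le_one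
    (intervalIntegrable_shiftInt hmD (by linarith)) (intervalIntegrable_shiftInt hmD hD)
    fun t ht => ?_
  have p := shiftInt_radicand_pos hmD hD ht
  exact one_div_le_one_div_of_le (Real.sqrt_pos.2 (mul_pos p.1 p.2))
    (Real.sqrt_le_sqrt (mul_le_mul_of_nonneg_left (by linarith) p.1.le))

theorem gapPeriod_anti {D ω ω' m : ℝ} (hm : 0 ≤ m) (hmD : m ^ 2 < D) (hD : D < 2 * ω)
    (h : ω ≤ ω') : gapPeriod D ω' m ≤ gapPeriod D ω m := by
  have h1 := quarterInt_anti ((sq_nonneg m).trans hmD.le) hD h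
  have h2 := shiftInt_anti hm hmD hD h
  simp only [gapPeriod]
  linarith

theorem shiftInt_nonneg {D ω m : ℝ} (hm : 0 ≤ m) : 0 ≤ shiftInt D ω m :=
  mul_nonneg hm (intervalIntegral.integral_nonneg zero_le_one fun t _ => by positivity)

theorem le_quarterInt {D ω : ℝ} (h0 : 0 ≤ D) (hD : D < 2 * ω) :
    Real.pi / (4 * √ω) ≤ quarterInt D ω := by
  have hω : 0 < ω := by linarith
  have h : ∫ _ in (0 : ℝ)..(Real.pi / 2), 1 / (2 * √ω) ≤ quarterInt D ω := by
    refine intervalIntegral.integral_mono_on (by positivity) (by simp)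
      (intervalIntegrable_quarterInt h0 hD _ _) fun t _ => ?_
    refine one_div_le_one_div_of_le (Real.sqrt_pos.2 (radicand_pos h0 hD t)) ?_
    rw [show 2 * √ω = √(4 * ω) by
      rw [Real.sqrt_mul (by norm_num), show (4 : ℝ) = 2 ^ 2 by norm_num, Real.sqrt_sq zero_le_two]]
    refine Real.sqrt_le_sqrt ?_
    nlinarith [mul_nonneg h0 (sq_nonneg (Real.sin t))]
  refine le_trans (le_of_eq ?_) h
  rw [intervalIntegral.integral_const, smul_eq_mul, sub_zero]
  field_simp
  norm_num

theorem le_gapPeriod {D ω m : ℝ} (hm : 0 ≤ m) (hmD : m ^ 2 < D) (hD : D < 2 * ω) :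
    Real.pi / (2 * √ω) ≤ gapPeriod D ω m := by
  have h1 := le_quarterInt ((sq_nonneg m).trans hmD.le) hD
  have h2 := shiftInt_nonneg (D := D) (ω := ω) hm
  have e : Real.pi / (2 * √ω) = 2 * (Real.pi / (4 * √ω)) := by ring
  rw [gapPeriod, e]
  linarith

/-- The shift is at most half of the quarter period; the deficit behaves like the square root
of `D - m²`. -/
theorem shiftInt_add_le {D ω m : ℝ} (hm : 0 ≤ m) (hmD : m ^ 2 < D) (hD : D < 2 * ω) :
    shiftInt D ω m + √((D - m ^ 2) / D) / (2 * √ω) ≤ quarterInt D ω := by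
  have h0 : 0 < D := (sq_nonneg m).trans_lt hmD
  have hω : 0 < ω := by linarith
  rw [shiftInt_eq_angleInt hm hmD hD]
  have hle : m / √D ≤ 1 := (div_le_one (Real.sqrt_pos.2 h0)).2 (Real.le_sqrt_of_sq_le hmD.le)
  set x := Real.arcsin (m / √D) with hx
  have hxle : x ≤ Real.pi / 2 := Real.arcsin_le_pi_div_two _
  have h1 : ∫ _ in x..(Real.pi / 2), 1 / (2 * √ω)
      ≤ ∫ t in x..(Real.pi / 2), 1 / √(4 * ω - D * (1 + Real.sin t ^ 2)) := by
    refine intervalIntegral.integral_mono_on hxle (by simp)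
      (intervalIntegrable_quarterInt h0.le hD _ _) fun t _ => ?_
    refine one_div_le_one_div_of_le (Real.sqrt_pos.2 (radicand_pos h0.le hD t)) ?_
    rw [show 2 * √ω = √(4 * ω) by
      rw [Real.sqrt_mul (by norm_num), show (4 : ℝ) = 2 ^ 2 by norm_num, Real.sqrt_sq zero_le_two]]
    refine Real.sqrt_le_sqrt ?_
    nlinarith [mul_nonneg h0.le (sq_nonneg (Real.sin t))]
  have h2 := intervalIntegral.integral_add_adjacent_intervals
    (intervalIntegrable_quarterInt h0.le hD 0 x)
    (intervalIntegrable_quarterInt h0.le hD x (Real.pi / 2))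
  have h3 : √((D - m ^ 2) / D) ≤ Real.pi / 2 - x := by
    have e : √((D - m ^ 2) / D) = Real.sin (Real.pi / 2 - x) := by
      rw [Real.sin_pi_div_two_sub, hx, Real.cos_arcsin, div_pow, Real.sq_sqrt h0.le]
      congr 1
      field_simp
    rw [e]
    exact Real.sin_le (by linarith)
  have h4 : √((D - m ^ 2) / D) / (2 * √ω) ≤ (Real.pi / 2 - x) / (2 * √ω) := by gcongr
  rw [intervalIntegral.integral_const, smul_eq_mul, mul_one_div] at h1
  change angleInt D ω x + _ ≤ ∫ t in (0 : ℝ)..(Real.pi / 2), _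
  rw [← h2]
  change _ ≤ angleInt D ω x + _
  linarith

theorem gapPeriod_le {D ω m : ℝ} (hm : 0 ≤ m) (hmD : m ^ 2 < D) (hD : D < 2 * ω) :
    gapPeriod D ω m ≤ 3 * quarterInt D ω := by
  have h1 := shiftInt_add_le hm hmD hD
  have h2 : 0 ≤ √((D - m ^ 2) / D) / (2 * √ω) := by positivity
  rw [gapPeriod]
  linarith

/-- The quarter-period integral diverges logarithmically as `4ω - 2D → 0⁺`, uniformly for
bounded `D`. -/
theorem exists_lt_quarterInt (B M : ℝ) (hB : 0 < B) :
    ∃ δ > 0, ∀ D ω : ℝ, 0 ≤ D → D ≤ B → D < 2 * ω → 4 * ω - 2 * D < δ → M < quarterInt D ω := by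
  -- The radicand is `(4ω - 2D) + D cos² t`, and `cos t ≤ π / 2 - t`.
  set β := √B with hβ
  have hβ0 : 0 < β := Real.sqrt_pos.2 hB
  have hβ2 : β ^ 2 = B := Real.sq_sqrt hB.le
  have key : ∀ D ω : ℝ, 0 ≤ D → D ≤ B → D < 2 * ω →
      (Real.log (√(4 * ω - 2 * D) + β * (Real.pi / 2)) - Real.log √(4 * ω - 2 * D)) / β
        ≤ quarterInt D ω := by
    intro D ω h0 hDB hD
    set e := √(4 * ω - 2 * D) with he
    have he0 : 0 < e := Real.sqrt_pos.2 (by linarith)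
    have he2 : e ^ 2 = 4 * ω - 2 * D := Real.sq_sqrt (by linarith)
    have hpos : ∀ s ∈ Icc (0 : ℝ) (Real.pi / 2), 0 < e + β * (Real.pi / 2 - s) := fun s hs =>
      add_pos_of_pos_of_nonneg he0 (mul_nonneg hβ0.le (sub_nonneg.2 hs.2))
    have hder : ∀ s ∈ uIcc 0 (Real.pi / 2), HasDerivAt
        (fun s => -(Real.log (e + β * (Real.pi / 2 - s)) / β))
        (1 / (e + β * (Real.pi / 2 - s))) s := by
      intro s hs
      rw [uIcc_of_le (by positivity)] at hs
      have h1 : HasDerivAt (fun s => e + β * (Real.pi / 2 - s)) (β * -1) s :=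
        (((hasDerivAt_id s).const_sub (Real.pi / 2)).const_mul β).const_add e
      refine ((h1.log (hpos s hs).ne').div_const β).neg.congr_deriv ?_
      have := (hpos s hs).ne'
      field_simp
    have hint : IntervalIntegrable (fun s => 1 / (e + β * (Real.pi / 2 - s))) volume 0
        (Real.pi / 2) := by
      refine ContinuousOn.intervalIntegrable ?_
      rw [uIcc_of_le (by positivity)]
      exact continuousOn_const.div (by fun_prop) fun s hs => (hpos s hs).ne'
    have h1 := intervalIntegral.integral_eq_sub_of_hasDerivAt hder hint
    have h2 : ∫ s in (0 : ℝ)..(Real.pi / 2), 1 / (e + β * (Real.pi / 2 - s)) ≤ quarterInt D ω := by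
      refine intervalIntegral.integral_mono_on (by positivity) hint
        (intervalIntegrable_quarterInt h0 hD _ _) fun s hs => ?_
      refine one_div_le_one_div_of_le (Real.sqrt_pos.2 (radicand_pos h0 hD s)) ?_
      rw [Real.sqrt_le_left (hpos s hs).le]
      have hs1 : 0 ≤ Real.pi / 2 - s := sub_nonneg.2 hs.2
      have hcos : Real.cos s ≤ Real.pi / 2 - s := by
        rw [← Real.sin_pi_div_two_sub]
        exact Real.sin_le hs1
      have hcos0 : 0 ≤ Real.cos s :=
        Real.cos_nonneg_of_neg_pi_div_two_le_of_le (by linarith [hs.1, Real.pi_pos]) hs.2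
      have hc2 : Real.cos s ^ 2 ≤ (Real.pi / 2 - s) ^ 2 := pow_le_pow_left₀ hcos0 hcos 2
      have hsc := Real.sin_sq_add_cos_sq s
      have h3 : D * Real.cos s ^ 2 ≤ β ^ 2 * (Real.pi / 2 - s) ^ 2 := by
        rw [hβ2]
        exact mul_le_mul hDB hc2 (sq_nonneg _) hB.le
      have h4 : 0 ≤ e * (β * (Real.pi / 2 - s)) := by positivity
      have h5 : 4 * ω - D * (1 + Real.sin s ^ 2) = e ^ 2 + D * Real.cos s ^ 2 := by
        rw [he2]
        linear_combination (-D) * hsc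
      rw [h5]
      nlinarith
    refine le_trans (le_of_eq ?_) h2
    rw [h1, sub_self, mul_zero, add_zero, sub_zero]
    ring
  have hlim : Tendsto (fun x => (Real.log (β * (Real.pi / 2)) - Real.log x) / β) (𝓝[>] 0) atTop :=
    (tendsto_atTop_add_const_left _ _
      (tendsto_neg_atBot_atTop.comp Real.tendsto_log_nhdsGT_zero)).atTop_div_const hβ0
  obtain ⟨ε, hε, hε'⟩ := mem_nhdsGT_iff_exists_Ioo_subset.1 (hlim.eventually_gt_atTop M)
  have hε0 : (0 : ℝ) < ε := hε
  refine ⟨ε ^ 2, by positivity, fun D ω h0 hDB hD hlt => ?_⟩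
  have he0 : 0 < √(4 * ω - 2 * D) := Real.sqrt_pos.2 (by linarith)
  have he1 : √(4 * ω - 2 * D) < ε := by
    rw [Real.sqrt_lt' hε0]
    exact hlt
  have h1 : M < (Real.log (β * (Real.pi / 2)) - Real.log √(4 * ω - 2 * D)) / β := hε' ⟨he0, he1⟩
  refine h1.trans_le (le_trans ?_ (key D ω h0 hDB hD))
  have : Real.log (β * (Real.pi / 2)) ≤ Real.log (√(4 * ω - 2 * D) + β * (Real.pi / 2)) :=
    Real.log_le_log (by positivity) (by linarith)
  gcongr

/-! ### The increasing branch of roots of the period equation -/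

/-- Some squared gap has a period below the level `ℓ`. -/
def IsSolvable (ℓ ω m : ℝ) : Prop := ∃ D ∈ Ioo (m ^ 2) (2 * ω), gapPeriod D ω m < ℓ

/-- `D` is the root of `gapPeriod D ω m = ℓ` at which the convex function `gapPeriod` increases. -/
structure IsUpperRoot (ℓ ω m D : ℝ) : Prop where
  mem : D ∈ Ioo (m ^ 2) (2 * ω)
  eq : gapPeriod D ω m = ℓ
  exists_lt : ∃ D' ∈ Ioo (m ^ 2) D, gapPeriod D' ω m < ℓ

section Roots

variable {ℓ ω m D : ℝ}

theorem continuousAt_gapPeriod (hD : D ∈ Ioo (m ^ 2) (2 * ω)) :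
    ContinuousAt (fun q : ℝ × ℝ × ℝ => gapPeriod q.1 q.2.1 q.2.2) (D, ω, m) :=
  (contDiffAt_gapPeriod (p := (D, ω, m)) hD.1 hD.2).continuousAt

theorem continuousOn_gapPeriod : ContinuousOn (fun D => gapPeriod D ω m) (Ioo (m ^ 2) (2 * ω)) :=
  fun D hD => ((continuousAt_gapPeriod hD).comp (f := fun D : ℝ => (D, ω, m))
    (by fun_prop)).continuousWithinAt

theorem eventually_gapPeriod_lt (hD : D ∈ Ioo (m ^ 2) (2 * ω)) (h : gapPeriod D ω m < ℓ) :
    ∀ᶠ p : ℝ × ℝ in 𝓝 (ω, m), D ∈ Ioo (p.2 ^ 2) (2 * p.1) ∧ gapPeriod D p.1 p.2 < ℓ := by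
  have h1 : ContinuousAt (fun p : ℝ × ℝ => gapPeriod D p.1 p.2) (ω, m) :=
    (continuousAt_gapPeriod hD).comp (x := (ω, m)) (f := fun p : ℝ × ℝ => (D, p.1, p.2))
      (by fun_prop)
  have h2 : ContinuousAt (fun p : ℝ × ℝ => p.2 ^ 2) (ω, m) := by fun_prop
  have h3 : ContinuousAt (fun p : ℝ × ℝ => 2 * p.1) (ω, m) := by fun_prop
  filter_upwards [h1.eventually_lt_const h, h2.eventually_lt_const hD.1,
    h3.eventually_const_lt hD.2] with p a b c using ⟨⟨b, c⟩, a⟩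

theorem IsSolvable.mono {ω' : ℝ} (hm : 0 ≤ m) (h : IsSolvable ℓ ω m) (hω : ω ≤ ω') :
    IsSolvable ℓ ω' m := by
  obtain ⟨D, hD, hlt⟩ := h
  exact ⟨D, ⟨hD.1, by linarith [hD.2]⟩, (gapPeriod_anti hm hD.1 hD.2 hω).trans_lt hlt⟩

theorem IsSolvable.sq_lt (h : IsSolvable ℓ ω m) : m ^ 2 < 2 * ω := by
  obtain ⟨D, hD, -⟩ := h
  exact hD.1.trans hD.2

theorem IsSolvable.lt_omega (hm : 0 ≤ m) (h : IsSolvable ℓ ω m) :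
    Real.pi ^ 2 / (4 * ℓ ^ 2) < ω := by
  obtain ⟨D, hD, hlt⟩ := h
  have hω : 0 < ω := by nlinarith [hD.1, hD.2, sq_nonneg m]
  have h1 := (le_gapPeriod hm hD.1 hD.2).trans_lt hlt
  have h0 : 0 < Real.pi / (2 * √ω) := by positivity
  have h2 := pow_lt_pow_left₀ h1 h0.le two_ne_zero
  have hℓ : 0 < ℓ := h0.trans h1
  rw [div_pow, mul_pow, Real.sq_sqrt hω.le, div_lt_iff₀ (by positivity)] at h2
  rw [div_lt_iff₀ (by positivity)]
  linarith

theorem exists_isUpperRoot (hm : 0 ≤ m) (h : IsSolvable ℓ ω m) : ∃ D, IsUpperRoot ℓ ω m D := by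
  obtain ⟨D', hD', hlt⟩ := h
  have hω : 0 < ω := by nlinarith [hD'.1, hD'.2, sq_nonneg m]
  obtain ⟨δ, hδ, hbig⟩ := exists_lt_quarterInt (2 * ω) ℓ (by linarith)
  obtain ⟨E, hE₁, hE₂⟩ := exists_between (show max D' (2 * ω - δ / 2) < 2 * ω from
    max_lt hD'.2 (by linarith))
  rw [max_lt_iff] at hE₁
  have hD0 : 0 ≤ D' := (sq_nonneg m).trans hD'.1.le
  have hE : E ∈ Ioo (m ^ 2) (2 * ω) := ⟨hD'.1.trans hE₁.1, hE₂⟩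
  have h1 := hbig E ω (hD0.trans hE₁.1.le) hE₂.le hE₂ (by linarith [hE₁.2])
  have h2 : ℓ < gapPeriod E ω m := by
    have := shiftInt_nonneg (D := E) (ω := ω) hm
    have := le_quarterInt (hD0.trans hE₁.1.le) hE₂
    have : 0 ≤ Real.pi / (4 * √ω) := by positivity
    rw [gapPeriod]
    linarith
  have hiv := intermediate_value_Ioo hE₁.1.le
    (continuousOn_gapPeriod.mono fun x hx => ⟨hD'.1.trans_le hx.1, hx.2.trans_lt hE₂⟩)
  obtain ⟨D, hD, hDℓ⟩ := hiv ⟨hlt, h2⟩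
  exact ⟨D, ⟨hD'.1.trans hD.1, hD.2.trans hE₂⟩, hDℓ, D', ⟨hD'.1, hD.1⟩, hlt⟩

theorem IsUpperRoot.isSolvable (h : IsUpperRoot ℓ ω m D) : IsSolvable ℓ ω m := by
  obtain ⟨D', hD', hlt⟩ := h.exists_lt
  exact ⟨D', ⟨hD'.1, hD'.2.trans h.mem.2⟩, hlt⟩

theorem IsUpperRoot.not_lt {E : ℝ} (hm : 0 ≤ m) (hD : IsUpperRoot ℓ ω m D)
    (hE : IsUpperRoot ℓ ω m E) : ¬D < E := by
  intro hlt
  obtain ⟨D', hD', hlt'⟩ := hD.exists_lt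
  have := (convexOn_gapPeriod hm).lt_right_of_left_lt ⟨hD'.1, hD'.2.trans hD.mem.2⟩ hE.mem
    (by rw [openSegment_eq_Ioo (hD'.2.trans hlt)]; exact ⟨hD'.2, hlt⟩) (hlt'.trans_eq hD.eq.symm)
  simp only [hD.eq, hE.eq, lt_self_iff_false] at this

theorem IsUpperRoot.unique {E : ℝ} (hm : 0 ≤ m) (hD : IsUpperRoot ℓ ω m D)
    (hE : IsUpperRoot ℓ ω m E) : D = E :=
  le_antisymm (le_of_not_gt (hE.not_lt hm hD)) (le_of_not_gt (hD.not_lt hm hE))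

/-- If the level `ℓ` exceeds the endpoint value `3 I(m²)`, attained at `η = θ`, then every root is the
upper one. -/
theorem exists_lt_of_quarterInt_lt (hm : 0 ≤ m) (hω : m ^ 2 < 2 * ω)
    (h : 3 * quarterInt (m ^ 2) ω < ℓ) {E : ℝ} (hE : m ^ 2 < E) :
    ∃ D' ∈ Ioo (m ^ 2) E, gapPeriod D' ω m < ℓ := by
  have h1 : ContinuousAt (fun D => 3 * quarterInt D ω) (m ^ 2) :=
    continuousAt_const.mul (((contDiffAt_quarterInt (p := (m ^ 2, ω)) (sq_nonneg m)
      hω).continuousAt).comp (f := fun D : ℝ => (D, ω)) (by fun_prop))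
  have h2 : ∀ᶠ D in 𝓝[>] (m ^ 2), 3 * quarterInt D ω < ℓ :=
    (h1.eventually_lt_const h).filter_mono nhdsWithin_le_nhds
  obtain ⟨D', h3, h4⟩ := (h2.and (Ioo_mem_nhdsGT (lt_min hE hω))).exists
  exact ⟨D', ⟨h4.1, h4.2.trans_le (min_le_left _ _)⟩,
    (gapPeriod_le hm h4.1 (h4.2.trans_le (min_le_right _ _))).trans_lt h3⟩

theorem gapPeriod_zero_m (D ω : ℝ) : gapPeriod D ω 0 = 2 * quarterInt D ω := by
  simp [gapPeriod, shiftInt]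

theorem quarterInt_zero (ω : ℝ) : quarterInt 0 ω = Real.pi / (4 * √ω) := by
  rw [quarterInt, angleInt]
  simp only [zero_mul, sub_zero]
  rw [intervalIntegral.integral_const, smul_eq_mul, sub_zero, Real.sqrt_mul (by norm_num),
    show (4 : ℝ) = 2 ^ 2 by norm_num, Real.sqrt_sq zero_le_two]
  by_cases h : √ω = 0
  · simp [h]
  · field_simp

/-- Without defect every root is the upper one, since the period at `D = 0` is below the level. -/
theorem exists_lt_of_lt_omega (hℓ : 0 < ℓ) (h : Real.pi ^ 2 / (4 * ℓ ^ 2) < ω) {E : ℝ}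
    (hE : 0 < E) : ∃ D' ∈ Ioo (0 ^ 2) E, gapPeriod D' ω 0 < ℓ := by
  have hω : 0 < ω := lt_of_le_of_lt (by positivity) h
  have h0 : 2 * quarterInt 0 ω < ℓ := by
    rw [quarterInt_zero]
    rw [div_lt_iff₀ (by positivity)] at h
    have h1 : Real.pi < 2 * ℓ * √ω := by
      refine lt_of_pow_lt_pow_left₀ 2 (by positivity) ?_
      rw [mul_pow, mul_pow, Real.sq_sqrt hω.le]
      linarith
    rw [← mul_div_assoc, div_lt_iff₀ (by positivity)]
    linarith
  have h1 : ContinuousAt (fun D => 2 * quarterInt D ω) 0 :=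
    continuousAt_const.mul (((contDiffAt_quarterInt (p := (0, ω)) le_rfl
      (by simpa using hω)).continuousAt).comp (f := fun D : ℝ => (D, ω)) (by fun_prop))
  have h2 : ∀ᶠ D in 𝓝[>] (0 : ℝ), 2 * quarterInt D ω < ℓ :=
    (h1.eventually_lt_const h0).filter_mono nhdsWithin_le_nhds
  obtain ⟨D', h3, h4⟩ := (h2.and (Ioo_mem_nhdsGT hE)).exists
  refine ⟨D', by simpa using h4, ?_⟩
  rwa [gapPeriod_zero_m]

/-- At the endpoint `η = θ` the period decreases with infinite slope in `D`, so that its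
infimum is strictly below its endpoint value `3 I(m²)`. -/
theorem isSolvable_of_quarterInt_le (hm : 0 ≤ m) (hω : m ^ 2 < 2 * ω)
    (h : 3 * quarterInt (m ^ 2) ω ≤ ℓ) : IsSolvable ℓ ω m := by
  have hω0 : 0 < ω := by nlinarith [sq_nonneg m]
  have hd : DifferentiableAt ℝ (fun D => quarterInt D ω) (m ^ 2) :=
    ((contDiffAt_quarterInt (p := (m ^ 2, ω)) (sq_nonneg m) hω).comp (m ^ 2)
      (f := fun D : ℝ => (D, ω)) (by fun_prop)).differentiableAt (by simp)
  -- `I` grows at most linearly in `D - m²`, the deficit of `J` is of order `√(D - m²)`.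
  obtain ⟨C, hC0, hC⟩ := hd.isBigO_sub.exists_pos
  have hC' := hC.bound
  set c := 1 / (√(2 * ω) * (2 * √ω)) with hc
  have hc0 : 0 < c := by positivity
  have h1 : ContinuousAt (fun D => 3 * C * √(D - m ^ 2)) (m ^ 2) := by fun_prop
  have h2 : ∀ᶠ D in 𝓝[>] (m ^ 2), 3 * C * √(D - m ^ 2) < c :=
    (h1.eventually_lt_const (by simpa using hc0)).filter_mono nhdsWithin_le_nhds
  obtain ⟨D, ⟨h3, h4⟩, h5⟩ :=
    ((h2.and (hC'.filter_mono nhdsWithin_le_nhds)).and (Ioo_mem_nhdsGT hω)).exists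
  refine ⟨D, h5, ?_⟩
  have hD0 : 0 < D := (sq_nonneg m).trans_lt h5.1
  have hε : 0 < D - m ^ 2 := sub_pos.2 h5.1
  have h6 := shiftInt_add_le hm h5.1 h5.2
  rw [Real.norm_eq_abs, Real.norm_eq_abs, abs_of_pos hε] at h4
  have h7 := (le_abs_self _).trans h4
  have h8 : √(D - m ^ 2) * c ≤ √((D - m ^ 2) / D) / (2 * √ω) := by
    rw [hc, Real.sqrt_div hε.le, div_div, mul_one_div]
    have := h5.2
    gcongr
  have h9 : 3 * C * (D - m ^ 2) < √(D - m ^ 2) * c := by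
    have := mul_lt_mul_of_pos_left h3 (Real.sqrt_pos.2 hε)
    have e := Real.mul_self_sqrt hε.le
    calc 3 * C * (D - m ^ 2) = √(D - m ^ 2) * (3 * C * √(D - m ^ 2)) := by
          linear_combination (-3 * C) * e
      _ < _ := this
  rw [gapPeriod]
  linarith

theorem quarterInt_le (h0 : 0 ≤ D) (hD : D < 2 * ω) :
    quarterInt D ω ≤ Real.pi / 2 * (1 / √(4 * ω - 2 * D)) := by
  have h : quarterInt D ω ≤ ∫ _ in (0 : ℝ)..(Real.pi / 2), 1 / √(4 * ω - 2 * D) := by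
    refine intervalIntegral.integral_mono_on (by positivity)
      (intervalIntegrable_quarterInt h0 hD _ _) (by simp) fun t _ => ?_
    refine one_div_le_one_div_of_le (Real.sqrt_pos.2 (by linarith)) (Real.sqrt_le_sqrt ?_)
    nlinarith [Real.sin_sq_le_one t]
  rwa [intervalIntegral.integral_const, smul_eq_mul, sub_zero] at h

theorem exists_three_mul_quarterInt_eq (hm : 0 < m) (hℓ : 0 < ℓ) :
    ∃ ω, m ^ 2 < 2 * ω ∧ 3 * quarterInt (m ^ 2) ω = ℓ := by
  have hm2 : 0 < m ^ 2 := by positivity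
  obtain ⟨δ, hδ, hbig⟩ := exists_lt_quarterInt (m ^ 2) ℓ hm2
  set ω₁ := m ^ 2 / 2 + δ / 8 with hω₁
  have h1 : ℓ < quarterInt (m ^ 2) ω₁ :=
    hbig (m ^ 2) ω₁ hm2.le le_rfl (by linarith) (by linarith)
  have hlim : Tendsto (fun ω => 3 * (Real.pi / 2 * (1 / √(4 * ω - 2 * m ^ 2)))) atTop (𝓝 0) := by
    have h : Tendsto (fun ω => √(4 * ω - 2 * m ^ 2)) atTop atTop :=
      Real.tendsto_sqrt_atTop.comp (tendsto_atTop_add_const_right _ _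
        (tendsto_id.const_mul_atTop (by norm_num : (0 : ℝ) < 4)))
    have := ((h.inv_tendsto_atTop.const_mul (Real.pi / 2)).const_mul 3)
    simpa [one_div] using this
  obtain ⟨ω₂, h2, h3⟩ := ((hlim.eventually_lt_const hℓ).and (eventually_ge_atTop ω₁)).exists
  have h4 := quarterInt_le hm2.le (show m ^ 2 < 2 * ω₂ by linarith)
  have hcont : ContinuousOn (fun ω => 3 * quarterInt (m ^ 2) ω) (Icc ω₁ ω₂) := fun ω hω =>
    (continuousAt_const.mul (((contDiffAt_quarterInt (p := (m ^ 2, ω)) hm2.le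
      (by simp only; linarith [hω.1])).continuousAt).comp (f := fun ω : ℝ => (m ^ 2, ω))
      (by fun_prop))).continuousWithinAt
  obtain ⟨ω, hω, he⟩ := intermediate_value_Icc' h3 hcont
    (show ℓ ∈ Icc _ _ from ⟨by linarith, by linarith⟩)
  exact ⟨ω, by linarith [hω.1], he⟩

/-- Existence of a frequency between the threshold of solvability and the frequency at which the
period at `η = θ` equals the given one, and within `ε` of the former. -/
theorem exists_threshold (hm : 0 < m) (hℓ : 0 < ℓ) {ε : ℝ} (hε : 0 < ε) :
    ∃ c, IsSolvable ℓ c m ∧ ℓ ≤ 3 * quarterInt (m ^ 2) c ∧ ¬IsSolvable ℓ (c - ε) m := by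
  obtain ⟨ωA, h1, h2⟩ := exists_three_mul_quarterInt_eq hm hℓ
  have h3 : IsSolvable ℓ ωA m := isSolvable_of_quarterInt_le hm.le h1 h2.le
  set S := {ω | IsSolvable ℓ ω m} with hS
  have hbdd : BddBelow S := ⟨m ^ 2 / 2, fun ω hω => by linarith [IsSolvable.sq_lt hω]⟩
  obtain ⟨s, hs, hs'⟩ := exists_lt_of_csInf_lt (⟨ωA, h3⟩ : S.Nonempty)
    (show sInf S < sInf S + ε by linarith)
  -- `ωA` is solvable by the infinite slope at the endpoint, so `s` can be lowered to `ωA`.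
  have hc : IsSolvable ℓ (min s ωA) m := by
    rcases min_choice s ωA with h | h <;> rw [h]
    exacts [hs, h3]
  refine ⟨min s ωA, hc, ?_, fun h => ?_⟩
  · rw [← h2]
    linarith [quarterInt_anti (sq_nonneg m) hc.sq_lt (min_le_right s ωA)]
  · have := csInf_le hbdd h
    linarith [min_le_left s ωA]

theorem IsUpperRoot.deriv_pos {d : ℝ} (hm : 0 ≤ m) (h : IsUpperRoot ℓ ω m D)
    (hd : HasDerivAt (fun D => gapPeriod D ω m) d D) : 0 < d := by
  obtain ⟨D', hD', hlt⟩ := h.exists_lt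
  have h1 := (convexOn_gapPeriod hm).slope_le_of_hasDerivAt ⟨hD'.1, hD'.2.trans h.mem.2⟩ h.mem
    hD'.2 hd
  refine lt_of_lt_of_le ?_ h1
  rw [slope_def_field, h.eq]
  exact div_pos (sub_pos.2 hlt) (sub_pos.2 hD'.2)

/-- Near a parameter with `m ≥ 0` the upper root extends to an analytic function, also to
parameters with `m < 0`. -/
theorem IsUpperRoot.exists_analytic (hm : 0 ≤ m) (h : IsUpperRoot ℓ ω m D) :
    ∃ ρ : ℝ × ℝ → ℝ, ContDiffAt ℝ (⊤ : WithTop ℕ∞) ρ (ω, m) ∧ ρ (ω, m) = D ∧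
      ∀ᶠ p in 𝓝 (ω, m), IsUpperRoot ℓ p.1 p.2 (ρ p) := by
  set f : (ℝ × ℝ) × ℝ → ℝ := fun q => gapPeriod q.2 q.1.1 q.1.2 with hf
  have cdf : ContDiffAt ℝ (⊤ : WithTop ℕ∞) f ((ω, m), D) :=
    (contDiffAt_gapPeriod (p := (D, ω, m)) h.mem.1 h.mem.2).comp ((ω, m), D)
      (f := fun q : (ℝ × ℝ) × ℝ => (q.2, q.1.1, q.1.2)) (by fun_prop)
  have hder : HasDerivAt (fun D => gapPeriod D ω m) (fderiv ℝ f ((ω, m), D) (0, 1)) D := by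
    have h1 := (cdf.differentiableAt (by simp)).hasFDerivAt
    have h2 : HasDerivAt (fun D : ℝ => (((ω, m), D) : (ℝ × ℝ) × ℝ)) (0, 1) D :=
      (hasDerivAt_const D (ω, m)).prodMk (hasDerivAt_id D)
    exact h1.comp_hasDerivAt D h2
  have hpos := h.deriv_pos hm hder
  have hinv : (fderiv ℝ f ((ω, m), D) ∘L .inr ℝ (ℝ × ℝ) ℝ).IsInvertible := by
    refine ⟨ContinuousLinearEquiv.unitsEquivAut ℝ (Units.mk0 _ hpos.ne'), ?_⟩
    ext
    simp
  refine ⟨cdf.implicitFunction (by simp) hinv, cdf.contDiffAt_implicitFunction (by simp) hinv,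
    cdf.implicitFunction_apply_self (by simp) hinv, ?_⟩
  set ρ := cdf.implicitFunction (by simp) hinv with hρ
  have hρc : ContinuousAt ρ (ω, m) :=
    (cdf.contDiffAt_implicitFunction (by simp) hinv).continuousAt
  have hρ0 : ρ (ω, m) = D := cdf.implicitFunction_apply_self (by simp) hinv
  obtain ⟨D', hD', hlt⟩ := h.exists_lt
  have hmem := h.mem
  have e1 := eventually_gapPeriod_lt ⟨hD'.1, hD'.2.trans hmem.2⟩ hlt
  have e2 : ∀ᶠ p in 𝓝 (ω, m), D' < ρ p := hρc.eventually_const_lt (by rw [hρ0]; exact hD'.2)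
  have e3 : ∀ᶠ p : ℝ × ℝ in 𝓝 (ω, m), ρ p < 2 * p.1 :=
    hρc.eventually_lt (by fun_prop) (by rw [hρ0]; exact hmem.2)
  filter_upwards [e1, e2, e3, cdf.eventually_apply_implicitFunction (by simp) hinv]
    with p a1 a2 a3 a4
  refine ⟨⟨a1.1.1.trans a2, a3⟩, ?_, D', ⟨a1.1.1, a2⟩, a1.2⟩
  have : gapPeriod (ρ p) p.1 p.2 = gapPeriod D ω m := a4
  rw [this, h.eq]

end Roots

open Classical in
/-- The upper root of `gapPeriod D ω m = ℓ` when there is one, and `0` otherwise. -/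
noncomputable def upperRoot (ℓ ω m : ℝ) : ℝ :=
  if h : ∃ D, IsUpperRoot ℓ ω m D then h.choose else 0

theorem isUpperRoot_upperRoot {ℓ ω m : ℝ} (hm : 0 ≤ m) (h : IsSolvable ℓ ω m) :
    IsUpperRoot ℓ ω m (upperRoot ℓ ω m) := by
  rw [upperRoot, dif_pos (exists_isUpperRoot hm h)]
  exact (exists_isUpperRoot hm h).choose_spec

theorem IsUpperRoot.eq_upperRoot {ℓ ω m D : ℝ} (hm : 0 ≤ m) (h : IsUpperRoot ℓ ω m D) :
    D = upperRoot ℓ ω m :=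
  h.unique hm (isUpperRoot_upperRoot hm h.isSolvable)

/-! ### Analytic dependence of solutions of `φ'' = ω φ - φ³` on parameters -/

section Flow

variable {L : ℝ}

/-- The operator `f ↦ ∫₀ β ∫₀ f` on `C([0, L])`. -/
noncomputable def volterra (hL : 0 ≤ L) (β : C(Icc (0 : ℝ) L, ℝ)) :
    C(Icc (0 : ℝ) L, ℝ) →L[ℝ] C(Icc (0 : ℝ) L, ℝ) :=
  primitive hL ∘L ContinuousLinearMap.mul ℝ C(Icc (0 : ℝ) L, ℝ) β ∘L primitive hL

theorem abs_primitive_le (hL : 0 ≤ L) {f : C(Icc (0 : ℝ) L, ℝ)} {g : ℝ → ℝ} (hg : Continuous g)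
    (h : ∀ s, |f s| ≤ g s) (ξ : Icc (0 : ℝ) L) : |primitive hL f ξ| ≤ ∫ s in (0 : ℝ)..ξ, g s := by
  rw [primitive_apply]
  refine (intervalIntegral.abs_integral_le_integral_abs ξ.2.1).trans ?_
  refine intervalIntegral.integral_mono_on ξ.2.1
    (f.continuous.Icc_extend'.abs.intervalIntegrable _ _) (hg.intervalIntegrable _ _) fun s hs => ?_
  rw [IccExtend_of_mem hL _ ⟨hs.1, hs.2.trans ξ.2.2⟩]
  exact h ⟨s, _⟩

theorem abs_volterra_pow_le (hL : 0 ≤ L) (β f : C(Icc (0 : ℝ) L, ℝ)) (n : ℕ)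
    (ξ : Icc (0 : ℝ) L) :
    |(volterra hL β ^ n) f ξ| ≤ ‖f‖ * (‖β‖ * L) ^ n / n.factorial * (ξ : ℝ) ^ n := by
  induction n generalizing ξ with
  | zero => simpa using f.norm_coe_le_norm ξ
  | succ n ih =>
    set A := ‖f‖ * (‖β‖ * L) ^ n / n.factorial with hA
    have hA0 : 0 ≤ A := by positivity
    rw [pow_succ', mul_apply_eq_comp]
    set u := (volterra hL β ^ n) f
    have h1 : ∀ s : Icc (0 : ℝ) L, |primitive hL u s| ≤ A * L * (s : ℝ) ^ n := by
      intro s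
      have h2 : |primitive hL u s| ≤ A * (s : ℝ) ^ n * |(s : ℝ) - 0| := by
        rw [primitive_apply, ← Real.norm_eq_abs]
        refine intervalIntegral.norm_integral_le_of_norm_le_const fun r hr => ?_
        rw [uIoc_of_le s.2.1] at hr
        rw [IccExtend_of_mem hL _ ⟨hr.1.le, hr.2.trans s.2.2⟩]
        refine (ih ⟨r, _⟩).trans ?_
        exact mul_le_mul_of_nonneg_left (pow_le_pow_left₀ hr.1.le hr.2 n) hA0
      rw [sub_zero, abs_of_nonneg s.2.1] at h2
      refine h2.trans ?_
      have := mul_le_mul_of_nonneg_left s.2.2 (mul_nonneg hA0 (pow_nonneg s.2.1 n))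
      linarith
    have h3 : ∀ s : Icc (0 : ℝ) L, |(β * primitive hL u) s| ≤ ‖β‖ * (A * L) * (s : ℝ) ^ n := by
      intro s
      rw [ContinuousMap.mul_apply, abs_mul, mul_assoc]
      exact mul_le_mul (β.norm_coe_le_norm s) (h1 s) (abs_nonneg _) (norm_nonneg β)
    have h4 := abs_primitive_le hL (g := fun s => ‖β‖ * (A * L) * s ^ n) (by fun_prop) h3 ξ
    refine h4.trans (le_of_eq ?_)
    rw [intervalIntegral.integral_const_mul, integral_pow, hA, Nat.factorial_succ]
    push_cast
    have : (n.factorial : ℝ) ≠ 0 := by positivity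
    field_simp
    ring

/-- Volterra operators are quasinilpotent, so `1 - volterra hL β` is invertible. -/
theorem isUnit_one_sub_volterra (hL : 0 ≤ L) (β : C(Icc (0 : ℝ) L, ℝ)) :
    IsUnit (1 - volterra hL β) := by
  have hlim := FloorSemiring.tendsto_pow_div_factorial_atTop (‖β‖ * L * L)
  obtain ⟨n, hn⟩ := (hlim.eventually_lt_const one_pos).exists
  have h1 : ‖volterra hL β ^ n‖ ≤ (‖β‖ * L * L) ^ n / n.factorial := by
    refine ContinuousLinearMap.opNorm_le_bound _ (by positivity) fun f => ?_
    refine (ContinuousMap.norm_le _ (by positivity)).2 fun ξ => ?_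
    refine (abs_volterra_pow_le hL β f n ξ).trans ?_
    have h2 := pow_le_pow_left₀ ξ.2.1 ξ.2.2 n
    calc ‖f‖ * (‖β‖ * L) ^ n / n.factorial * (ξ : ℝ) ^ n
        ≤ ‖f‖ * (‖β‖ * L) ^ n / n.factorial * L ^ n := by gcongr
      _ = _ := by ring
  have h2 : IsUnit (1 - volterra hL β ^ n) := (Units.oneSub (volterra hL β ^ n) (h1.trans_lt hn)).isUnit
  have h3 : 1 - volterra hL β ^ n
      = (1 - volterra hL β) * ∑ i ∈ Finset.range n, volterra hL β ^ i :=
    (mul_neg_geom_sum _ _).symm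
  have h4 : Commute (1 - volterra hL β) (∑ i ∈ Finset.range n, volterra hL β ^ i) :=
    Commute.sum_right _ _ _ fun i _ => (Commute.one_left _).sub_left (Commute.self_pow _ _)
  rw [h3, h4.isUnit_mul_iff] at h2
  exact h2.1

/-- The function with value `c` at `0` and derivative `v`. -/
noncomputable def profileOf (hL : 0 ≤ L) (c : ℝ) (v : C(Icc (0 : ℝ) L, ℝ)) :
    C(Icc (0 : ℝ) L, ℝ) := c • 1 + primitive hL v

/-- The defect of the integrated equation `v = b + ∫₀ (ω φ - φ³)`, `φ = c + ∫₀ v`, for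
parameters `(ω, c, b)`. -/
noncomputable def slopeDefect (hL : 0 ≤ L) (q : (ℝ × ℝ × ℝ) × C(Icc (0 : ℝ) L, ℝ)) :
    C(Icc (0 : ℝ) L, ℝ) :=
  q.2 - q.1.2.2 • 1 - primitive hL (q.1.1 • profileOf hL q.1.2.1 q.2
    - profileOf hL q.1.2.1 q.2 * profileOf hL q.1.2.1 q.2 * profileOf hL q.1.2.1 q.2)

theorem contDiff_slopeDefect (hL : 0 ≤ L) :
    ContDiff ℝ (⊤ : WithTop ℕ∞) (slopeDefect hL) := by
  unfold slopeDefect profileOf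
  fun_prop

theorem hasFDerivAt_slopeDefect (hL : 0 ≤ L) (p : ℝ × ℝ × ℝ) (v : C(Icc (0 : ℝ) L, ℝ)) :
    HasFDerivAt (fun v => slopeDefect hL (p, v)) (1 - volterra hL
      (p.1 • 1 - 3 * (profileOf hL p.2.1 v * profileOf hL p.2.1 v))) v := by
  have h1 : HasFDerivAt (fun v => profileOf hL p.2.1 v) (primitive hL) v :=
    (primitive hL).hasFDerivAt.const_add _
  have h2 := (((hasFDerivAt_id v).sub_const (p.2.2 • 1)).sub
    ((primitive hL).hasFDerivAt.comp v ((h1.const_smul p.1).sub ((h1.mul h1).mul h1))))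
  refine h2.congr_fderiv ?_
  ext1 w
  simp only [volterra, sub_apply, ContinuousLinearMap.comp_apply,
    smul_apply, add_apply, ContinuousLinearMap.mul_apply',
    one_apply_eq_self, ContinuousLinearMap.id_apply, Pi.mul_apply, smul_eq_mul]
  congr 2
  simp only [sub_mul, smul_mul_assoc, one_mul]
  ring

/-- The difference of two solutions solves a homogeneous linear Volterra equation. -/
theorem slopeDefect_unique (hL : 0 ≤ L) {p : ℝ × ℝ × ℝ} {v w : C(Icc (0 : ℝ) L, ℝ)}
    (hv : slopeDefect hL (p, v) = 0) (hw : slopeDefect hL (p, w) = 0) : v = w := by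
  set φ := profileOf hL p.2.1 v with hφ
  set ψ := profileOf hL p.2.1 w with hψ
  have h1 : primitive hL (v - w) = φ - ψ := by
    rw [hφ, hψ, profileOf, profileOf, map_sub]
    abel
  have h2 : v - w - primitive hL ((p.1 • φ - φ * φ * φ) - (p.1 • ψ - ψ * ψ * ψ)) = 0 := by
    rw [map_sub, ← sub_self (0 : C(Icc (0 : ℝ) L, ℝ))]
    nth_rw 1 [← hv, ← hw]
    simp only [slopeDefect, ← hφ, ← hψ]
    abel
  have h3 : (1 - volterra hL (p.1 • 1 - (φ * φ + φ * ψ + ψ * ψ))) (v - w) = 0 := by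
    rw [← h2]
    simp only [volterra, sub_apply, ContinuousLinearMap.comp_apply,
      ContinuousLinearMap.mul_apply', one_apply_eq_self, h1]
    congr 2
    simp only [sub_mul, smul_mul_assoc, one_mul, smul_sub]
    ring
  obtain ⟨u, hu⟩ := isUnit_one_sub_volterra hL (p.1 • 1 - (φ * φ + φ * ψ + ψ * ψ))
  have h4 : (↑u⁻¹ : C(Icc (0 : ℝ) L, ℝ) →L[ℝ] C(Icc (0 : ℝ) L, ℝ)) ((u : C(Icc (0 : ℝ) L, ℝ) →L[ℝ]
      C(Icc (0 : ℝ) L, ℝ)) (v - w)) = 0 := by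
    rw [hu, h3, map_zero]
  rw [← mul_apply_eq_comp, Units.inv_mul, one_apply_eq_self] at h4
  exact sub_eq_zero.1 h4

open Classical in
/-- The derivative on `[0, L]` of the solution of `φ'' = ω φ - φ³`, `φ(0) = c`, `φ'(0) = b`, as
a function of `(ω, c, b)`; zero if the solution does not extend to `[0, L]`. -/
noncomputable def slopeFlow (hL : 0 ≤ L) (p : ℝ × ℝ × ℝ) : C(Icc (0 : ℝ) L, ℝ) :=
  if h : ∃ v, slopeDefect hL (p, v) = 0 then h.choose else 0

theorem slopeFlow_eq (hL : 0 ≤ L) {p : ℝ × ℝ × ℝ} {v : C(Icc (0 : ℝ) L, ℝ)}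
    (hv : slopeDefect hL (p, v) = 0) : slopeFlow hL p = v := by
  have h : ∃ v, slopeDefect hL (p, v) = 0 := ⟨v, hv⟩
  rw [slopeFlow, dif_pos h]
  exact slopeDefect_unique hL h.choose_spec hv

theorem contDiffAt_slopeFlow (hL : 0 ≤ L) {p : ℝ × ℝ × ℝ} {v : C(Icc (0 : ℝ) L, ℝ)}
    (hv : slopeDefect hL (p, v) = 0) : ContDiffAt ℝ (⊤ : WithTop ℕ∞) (slopeFlow hL) p := by
  have cdf : ContDiffAt ℝ (⊤ : WithTop ℕ∞) (slopeDefect hL) (p, v) :=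
    (contDiff_slopeDefect hL).contDiffAt
  obtain ⟨u, hu⟩ := isUnit_one_sub_volterra hL
    (p.1 • 1 - 3 * (profileOf hL p.2.1 v * profileOf hL p.2.1 v))
  have hinv : (fderiv ℝ (slopeDefect hL) (p, v) ∘L
      .inr ℝ (ℝ × ℝ × ℝ) C(Icc (0 : ℝ) L, ℝ)).IsInvertible := by
    refine ⟨ContinuousLinearEquiv.ofUnit u, ?_⟩
    have h1 := (cdf.differentiableAt (by simp)).hasFDerivAt.comp v (hasFDerivAt_prodMk_right p v)
    have h2 := h1.unique (hasFDerivAt_slopeDefect hL p v)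
    rw [h2, ← hu]
    rfl
  refine (cdf.contDiffAt_implicitFunction (by simp) hinv).congr_of_eventuallyEq ?_
  filter_upwards [cdf.eventually_apply_implicitFunction (by simp) hinv] with q hq
  exact slopeFlow_eq hL (hq.trans hv)

/-- A classical solution `h` of `h'' = ω h - h³` is recovered from `slopeFlow`. -/
theorem slopeFlow_of_hasDerivAt (hL : 0 ≤ L) {ω : ℝ} {h h' : ℝ → ℝ}
    (hd : ∀ r, HasDerivAt h (h' r) r) (hdd : ∀ r, HasDerivAt h' (ω * h r - h r ^ 3) r) :
    ContDiffAt ℝ (⊤ : WithTop ℕ∞) (slopeFlow hL) (ω, h 0, h' 0) ∧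
      ∀ ξ : Icc (0 : ℝ) L, profileOf hL (h 0) (slopeFlow hL (ω, h 0, h' 0)) ξ = h ξ := by
  have hc : Continuous h := continuous_iff_continuousAt.2 fun r => (hd r).continuousAt
  have hc' : Continuous h' := continuous_iff_continuousAt.2 fun r => (hdd r).continuousAt
  set v : C(Icc (0 : ℝ) L, ℝ) := ⟨fun ξ => h' ξ, by fun_prop⟩ with hv
  have h1 : ∀ ξ : Icc (0 : ℝ) L, profileOf hL (h 0) v ξ = h ξ := by
    intro ξ
    have e : primitive hL v ξ = h ξ - h 0 := by
      rw [primitive_apply, ← intervalIntegral.integral_eq_sub_of_hasDerivAt (fun x _ => hd x)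
        (hc'.intervalIntegrable _ _)]
      refine intervalIntegral.integral_congr fun s hs => ?_
      rw [uIcc_of_le ξ.2.1] at hs
      rw [IccExtend_of_mem hL _ ⟨hs.1, hs.2.trans ξ.2.2⟩]
      rfl
    simp [profileOf, e]
  have h2 : slopeDefect hL ((ω, h 0, h' 0), v) = 0 := by
    ext ξ
    have e : primitive hL (ω • profileOf hL (h 0) v
        - profileOf hL (h 0) v * profileOf hL (h 0) v * profileOf hL (h 0) v) ξ
        = h' ξ - h' 0 := by
      rw [primitive_apply, ← intervalIntegral.integral_eq_sub_of_hasDerivAt (fun x _ => hdd x)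
        (Continuous.intervalIntegrable (by fun_prop) _ _)]
      refine intervalIntegral.integral_congr fun s hs => ?_
      rw [uIcc_of_le ξ.2.1] at hs
      rw [IccExtend_of_mem hL _ ⟨hs.1, hs.2.trans ξ.2.2⟩]
      simp only [ContinuousMap.sub_apply, ContinuousMap.smul_apply, ContinuousMap.mul_apply, h1,
        smul_eq_mul]
      ring
    simp only [slopeDefect, ContinuousMap.sub_apply, e]
    simp [hv]
  refine ⟨contDiffAt_slopeFlow hL h2, ?_⟩
  rw [slopeFlow_eq hL h2]
  exact h1

end Flow

/-! ### Even extensions as elements of `H¹_per` -/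

section Sobolev

variable {L : ℝ}

/-- The function `x ↦ σ(x) f(|x|)`. -/
noncomputable def absExtend (hL : 0 ≤ L) (σ : ℝ → ℝ) (f : C(Icc (0 : ℝ) L, ℝ)) (x : ℝ) : ℂ :=
  ((σ x * IccExtend hL f |x| : ℝ) : ℂ)

theorem norm_absExtend_le (hL : 0 ≤ L) {σ : ℝ → ℝ} (hσ1 : ∀ x, |σ x| ≤ 1)
    (f : C(Icc (0 : ℝ) L, ℝ)) (x : ℝ) : ‖absExtend hL σ f x‖ ≤ ‖f‖ := by
  rw [absExtend, Complex.norm_real, Real.norm_eq_abs, abs_mul]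
  calc |σ x| * |IccExtend hL f (|x|)| ≤ 1 * ‖f‖ :=
        mul_le_mul (hσ1 x) (f.norm_coe_le_norm _) (abs_nonneg _) zero_le_one
    _ = ‖f‖ := one_mul _

theorem memLp_absExtend (hL : 0 ≤ L) {σ : ℝ → ℝ} (hσ : Measurable σ) (hσ1 : ∀ x, |σ x| ≤ 1)
    (f : C(Icc (0 : ℝ) L, ℝ)) : MemLp (absExtend hL σ f) 2 (periodMeasure L) := by
  have hm : Measurable (absExtend hL σ f) :=
    Complex.measurable_ofReal.comp
      (hσ.mul ((f.continuous.Icc_extend' (h := hL)).measurable.comp continuous_abs.measurable))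
  exact MemLp.of_bound hm.aestronglyMeasurable ‖f‖
    (Eventually.of_forall (norm_absExtend_le hL hσ1 f))

/-- The bounded operator `f ↦ σ(x) f(|x|)` from `C([0, L])` to `L²`. -/
noncomputable def absExtendL (hL : 0 ≤ L) {σ : ℝ → ℝ} (hσ : Measurable σ)
    (hσ1 : ∀ x, |σ x| ≤ 1) : C(Icc (0 : ℝ) L, ℝ) →L[ℝ] L2per L :=
  LinearMap.mkContinuous
    { toFun := fun f => (memLp_absExtend hL hσ hσ1 f).toLp _
      map_add' := fun f g => by
        rw [← MemLp.toLp_add]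
        refine MemLp.toLp_congr _ _ (Eventually.of_forall fun x => ?_)
        simp [absExtend, IccExtend, mul_add]
      map_smul' := fun c f => by
        rw [RingHom.id_apply, ← MemLp.toLp_const_smul]
        refine MemLp.toLp_congr _ _ (Eventually.of_forall fun x => ?_)
        simp [absExtend, IccExtend]
        ring }
    (measureUnivNNReal (periodMeasure L) ^ ((2 : ℝ≥0∞).toReal)⁻¹) fun f => by
      refine Lp.norm_le_of_ae_bound (norm_nonneg f) ?_
      filter_upwards [(memLp_absExtend hL hσ hσ1 f).coeFn_toLp] with x hx
      change ‖((memLp_absExtend hL hσ hσ1 f).toLp _ : ℝ → ℂ) x‖ ≤ _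
      rw [hx]
      exact norm_absExtend_le hL hσ1 f x

theorem absExtendL_ae (hL : 0 ≤ L) {σ : ℝ → ℝ} (hσ : Measurable σ) (hσ1 : ∀ x, |σ x| ≤ 1)
    (f : C(Icc (0 : ℝ) L, ℝ)) :
    absExtendL hL hσ hσ1 f =ᵐ[periodMeasure L] absExtend hL σ f :=
  (memLp_absExtend hL hσ hσ1 f).coeFn_toLp

/-- The sign function with value `1` at `0`. -/
noncomputable def signOne (x : ℝ) : ℝ := if x < 0 then -1 else 1

theorem measurable_signOne : Measurable signOne :=
  Measurable.ite measurableSet_Iio measurable_const measurable_const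

theorem abs_signOne_le (x : ℝ) : |signOne x| ≤ 1 := by
  unfold signOne
  split_ifs <;> simp

/-- Folding an integral over `[-L, L]` to `[0, L]`. -/
theorem integral_absExtend_mul (hL : 0 ≤ L) {σ : ℝ → ℝ} (hσ : Measurable σ)
    (hσ1 : ∀ x, |σ x| ≤ 1) {ε : ℝ} (hpos : ∀ x, 0 < x → σ x = 1)
    (hneg : ∀ x, x < 0 → σ x = ε) (f : C(Icc (0 : ℝ) L, ℝ)) {χ : ℝ → ℂ} (hχ : Continuous χ) :
    ∫ x, (absExtendL hL hσ hσ1 f) x * χ x ∂(periodMeasure L)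
      = ∫ x in (0 : ℝ)..L, ((IccExtend hL f x : ℝ) : ℂ) * (χ x + ε * χ (-x)) := by
  have hf : Continuous fun x => ((IccExtend hL f x : ℝ) : ℂ) :=
    Complex.continuous_ofReal.comp (f.continuous.Icc_extend' (h := hL))
  have e0 : ∫ x, (absExtendL hL hσ hσ1 f) x * χ x ∂(periodMeasure L)
      = ∫ x in (-L)..L, absExtend hL σ f x * χ x := by
    rw [intervalIntegral.integral_of_le (by linarith)]
    refine integral_congr_ae ?_
    filter_upwards [absExtendL_ae hL hσ hσ1 f] with x hx
    rw [hx]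
  have hint : Integrable (fun x => absExtend hL σ f x * χ x) (periodMeasure L) := by
    refine (integrable_mul_of_continuous (absExtendL hL hσ hσ1 f) hχ).congr ?_
    filter_upwards [absExtendL_ae hL hσ hσ1 f] with x hx
    rw [hx]
  have hii : IntervalIntegrable (fun x => absExtend hL σ f x * χ x) volume (-L) L :=
    (intervalIntegrable_iff_integrableOn_Ioc_of_le (by linarith)).2 hint
  have i1 : IntervalIntegrable (fun x => absExtend hL σ f x * χ x) volume (-L) 0 :=
    hii.mono_set (by
      rw [uIcc_of_le (by linarith), uIcc_of_le (by linarith)]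
      exact Icc_subset_Icc le_rfl hL)
  have i2 : IntervalIntegrable (fun x => absExtend hL σ f x * χ x) volume 0 L :=
    hii.mono_set (by
      rw [uIcc_of_le (by linarith), uIcc_of_le (by linarith)]
      exact Icc_subset_Icc (by linarith) le_rfl)
  have e1 : ∫ x in (0 : ℝ)..L, absExtend hL σ f x * χ x
      = ∫ x in (0 : ℝ)..L, ((IccExtend hL f x : ℝ) : ℂ) * χ x := by
    refine intervalIntegral.integral_congr_ae (Eventually.of_forall fun x hx => ?_)
    rw [uIoc_of_le hL] at hx
    simp only [absExtend]
    rw [hpos x hx.1, abs_of_pos hx.1, one_mul]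
  have e2 : ∫ x in (-L)..0, absExtend hL σ f x * χ x
      = ∫ x in (0 : ℝ)..L, ((IccExtend hL f x : ℝ) : ℂ) * (ε * χ (-x)) := by
    have h1 := intervalIntegral.integral_comp_neg (a := 0) (b := L)
      (fun x => absExtend hL σ f x * χ x)
    rw [neg_zero] at h1
    rw [← h1]
    refine intervalIntegral.integral_congr_ae (Eventually.of_forall fun x hx => ?_)
    rw [uIoc_of_le hL] at hx
    simp only [absExtend]
    rw [hneg (-x) (by linarith [hx.1]), abs_neg, abs_of_pos hx.1]
    push_cast
    ring
  rw [e0, ← intervalIntegral.integral_add_adjacent_intervals i1 i2, e1, e2, add_comm,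
    ← intervalIntegral.integral_add (Continuous.intervalIntegrable (by fun_prop) _ _)
      (Continuous.intervalIntegrable (by fun_prop) _ _)]
  refine intervalIntegral.integral_congr fun x _ => ?_
  ring

/-- The even `2L`-periodic extension of a `C¹` function on `[0, L]` has a weak derivative: the
boundary terms at `±L` cancel and there is no jump at `0`. -/
theorem isWeakDeriv_absExtendL (hL : 0 ≤ L) (c : ℝ) (v : C(Icc (0 : ℝ) L, ℝ)) :
    IsWeakDeriv L
      (absExtendL hL (measurable_const (a := (1 : ℝ))) (fun _ => (abs_one).le) (profileOf hL c v))
      (absExtendL hL measurable_signOne abs_signOne_le v) := by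
  intro ψ hs hp
  have hψ : Continuous ψ := hs.continuous
  have hψ' : Continuous (deriv ψ) := hs.continuous_deriv (by simp)
  have hw : Continuous (IccExtend hL v) := v.continuous.Icc_extend'
  rw [integral_absExtend_mul hL measurable_const _ (ε := 1) (fun _ _ => rfl) (fun _ _ => rfl) _ hψ',
    integral_absExtend_mul hL measurable_signOne _ (ε := -1)
      (fun x hx => if_neg (not_lt.2 hx.le)) (fun x hx => if_pos hx) _ hψ]
  set U : ℝ → ℝ := fun x => c + ∫ s in (0 : ℝ)..x, IccExtend hL v s with hU
  have hUd : ∀ x, HasDerivAt U (IccExtend hL v x) x := fun x =>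
    ((hw.integral_hasStrictDerivAt 0 x).hasDerivAt).const_add c
  have hUe : ∀ x ∈ Icc 0 L, IccExtend hL (profileOf hL c v) x = U x := by
    intro x hx
    rw [IccExtend_of_mem hL _ hx]
    simp [profileOf, primitive_apply, hU]
  have hχ : ∀ x, HasDerivAt (fun x => ψ x - ψ (-x)) (deriv ψ x + deriv ψ (-x)) x := by
    intro x
    have hd : Differentiable ℝ ψ := hs.differentiable (by simp)
    have h1 := (hd (-x)).hasDerivAt.scomp x (hasDerivAt_neg x)
    have h2 := (hd x).hasDerivAt.sub h1
    refine h2.congr_deriv ?_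
    simp
  have hparts := intervalIntegral.integral_mul_deriv_eq_deriv_mul (a := 0) (b := L)
    (u := fun x => (U x : ℂ)) (u' := fun x => ((IccExtend hL v x : ℝ) : ℂ))
    (fun x _ => (hUd x).ofReal_comp) (fun x _ => hχ x)
    (Continuous.intervalIntegrable (by fun_prop) _ _)
    (Continuous.intervalIntegrable (by fun_prop) _ _)
  have hend : ψ L - ψ (-L) = 0 := by
    have := hp (-L)
    rw [show -L + 2 * L = L by ring] at this
    rw [this, sub_self]
  rw [hend, neg_zero, sub_self, mul_zero, mul_zero, sub_self, zero_sub] at hparts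
  have e1 : ∫ x in (0 : ℝ)..L, ((IccExtend hL (profileOf hL c v) x : ℝ) : ℂ)
      * (deriv ψ x + (1 : ℝ) * deriv ψ (-x))
      = ∫ x in (0 : ℝ)..L, (U x : ℂ) * (deriv ψ x + deriv ψ (-x)) := by
    refine intervalIntegral.integral_congr fun x hx => ?_
    rw [uIcc_of_le hL] at hx
    simp only [hUe x hx, Complex.ofReal_one, one_mul]
  rw [e1, hparts]
  congr 1
  refine intervalIntegral.integral_congr fun x _ => ?_
  simp only [Complex.ofReal_neg, Complex.ofReal_one]
  ring

/-- The linear map `(c, v) ↦ c + ∫₀ v`. -/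
noncomputable def profileL (hL : 0 ≤ L) :
    (ℝ × C(Icc (0 : ℝ) L, ℝ)) →L[ℝ] C(Icc (0 : ℝ) L, ℝ) :=
  (ContinuousLinearMap.fst ℝ ℝ C(Icc (0 : ℝ) L, ℝ)).smulRight 1
    + primitive hL ∘L ContinuousLinearMap.snd ℝ ℝ C(Icc (0 : ℝ) L, ℝ)

theorem profileL_apply (hL : 0 ≤ L) (p : ℝ × C(Icc (0 : ℝ) L, ℝ)) :
    profileL hL p = profileOf hL p.1 p.2 := rfl

/-- The bounded operator taking `(c, v)` to the even extension of `c + ∫₀ v` and its derivative. -/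
noncomputable def evenPairL (hL : 0 ≤ L) :
    (ℝ × C(Icc (0 : ℝ) L, ℝ)) →L[ℝ] WithLp 2 (L2per L × L2per L) :=
  (WithLp.prodContinuousLinearEquiv 2 ℝ (L2per L) (L2per L)).symm.toContinuousLinearMap ∘L
    ((absExtendL hL (measurable_const (a := (1 : ℝ))) (fun _ => (abs_one).le) ∘L profileL hL).prod
      (absExtendL hL measurable_signOne abs_signOne_le
        ∘L ContinuousLinearMap.snd ℝ ℝ C(Icc (0 : ℝ) L, ℝ)))

theorem evenPairL_fst (hL : 0 ≤ L) (p : ℝ × C(Icc (0 : ℝ) L, ℝ)) :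
    (evenPairL hL p).fst = absExtendL hL (measurable_const (a := (1 : ℝ)))
      (fun _ => (abs_one).le) (profileOf hL p.1 p.2) := rfl

theorem evenPairL_snd (hL : 0 ≤ L) (p : ℝ × C(Icc (0 : ℝ) L, ℝ)) :
    (evenPairL hL p).snd = absExtendL hL measurable_signOne abs_signOne_le p.2 := rfl

theorem evenPairL_mem (hL : 0 ≤ L) (p : ℝ × C(Icc (0 : ℝ) L, ℝ)) :
    evenPairL hL p ∈ H1per L := by
  change IsWeakDeriv L (evenPairL hL p).fst (evenPairL hL p).snd
  rw [evenPairL_fst, evenPairL_snd]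
  exact isWeakDeriv_absExtendL hL p.1 p.2

/-- The bounded operator taking `(c, v)` to the even periodic extension of `c + ∫₀ v`. -/
noncomputable def evenExtendL (hL : 0 ≤ L) : (ℝ × C(Icc (0 : ℝ) L, ℝ)) →L[ℝ] H1per L :=
  (evenPairL hL).codRestrict (H1per L) (evenPairL_mem hL)

theorem coe_evenExtendL (hL : 0 ≤ L) (p : ℝ × C(Icc (0 : ℝ) L, ℝ)) :
    (evenExtendL hL p : WithLp 2 (L2per L × L2per L)) = evenPairL hL p := rfl

theorem represents_evenExtendL (hL : 0 ≤ L) {c : ℝ} {v : C(Icc (0 : ℝ) L, ℝ)} {u : ℝ → ℝ}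
    (hu : ∀ x (hx : |x| ≤ L), u x = profileOf hL c v ⟨|x|, abs_nonneg x, hx⟩) :
    Represents L (evenExtendL hL (c, v)) u := by
  have h1 := absExtendL_ae hL (measurable_const (a := (1 : ℝ))) (fun _ => (abs_one).le)
    (profileOf hL c v)
  have h2 : ∀ᵐ x ∂(periodMeasure L), x ∈ Ioc (-L) L := ae_restrict_mem measurableSet_Ioc
  filter_upwards [h1, h2] with x hx hmem
  have hx' : |x| ≤ L := abs_le.2 ⟨hmem.1.le, hmem.2⟩
  rw [coe_evenExtendL, evenPairL_fst, hx, absExtend, one_mul, hu x hx', IccExtend_of_mem hL _ ⟨abs_nonneg x, hx'⟩]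

end Sobolev

/-! ### The branch of solutions and its profiles -/

section Branch

variable {L ω Z η : ℝ}

theorem two_sqrt_two_mul_eq (x : ℝ) : 2 * √2 * x = 2 * L ↔ x = L / √2 := by
  have h2 : √2 * √2 = 2 := Real.mul_self_sqrt zero_le_two
  have h0 : √2 ≠ 0 := by positivity
  rw [eq_div_iff h0]
  constructor <;> intro h <;> linarith

theorem abs_div_sqrt_two_sq (Z : ℝ) : (|Z| / √2) ^ 2 = Z ^ 2 / 2 := by
  rw [div_pow, sq_abs, Real.sq_sqrt zero_le_two]

theorem pi_sq_div_level (L : ℝ) :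
    Real.pi ^ 2 / (4 * (L / √2) ^ 2) = Real.pi ^ 2 / (2 * L ^ 2) := by
  rw [div_pow, Real.sq_sqrt zero_le_two]
  congr 1
  ring

/-- The peak equation with period `2L` is solvable by a non-degenerate profile. -/
def HasBranch (L ω Z : ℝ) : Prop := IsSolvable (L / √2) ω (|Z| / √2)

/-- The smaller amplitude of the profile with period `2L`, on the branch along which the period
decreases with `η`. -/
noncomputable def branch (L : ℝ) (p : ℝ × ℝ) : ℝ :=
  etaOfGap (upperRoot (L / √2) p.1 (|p.2| / √2)) p.1

theorem HasBranch.isUpperRoot (h : HasBranch L ω Z) :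
    IsUpperRoot (L / √2) ω (|Z| / √2) (upperRoot (L / √2) ω (|Z| / √2)) :=
  isUpperRoot_upperRoot (by positivity) h

theorem HasBranch.sq_lt (h : HasBranch L ω Z) : Z ^ 2 / 4 < ω := by
  have := IsSolvable.sq_lt h
  rw [abs_div_sqrt_two_sq] at this
  linarith

theorem HasBranch.mono {ω' : ℝ} (h : HasBranch L ω Z) (hω : ω ≤ ω') : HasBranch L ω' Z :=
  IsSolvable.mono (by positivity) h hω

theorem HasBranch.branch_spec (h : HasBranch L ω Z) :
    branch L (ω, Z) ∈ Ioo 0 (theta ω Z) ∧ Tplus (branch L (ω, Z)) ω Z = 2 * L ∧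
      (etaOne (branch L (ω, Z)) ω - branch L (ω, Z)) ^ 2
        = upperRoot (L / √2) ω (|Z| / √2) := by
  have hU := h.isUpperRoot
  have hmem := hU.mem
  rw [abs_div_sqrt_two_sq] at hmem
  obtain ⟨h1, h2⟩ := etaOfGap_spec hmem.1 hmem.2
  refine ⟨h1, ?_, h2⟩
  rw [branch, Tplus_eq_gapPeriod h.sq_lt h1, h2, two_sqrt_two_mul_eq, hU.eq]

theorem HasBranch.isAmplitude (h : HasBranch L ω Z) : IsAmplitude (branch L (ω, Z)) ω Z :=
  (gap_of_mem_Ioo h.sq_lt h.branch_spec.1).1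

/-- A solution of the period equation lies on the branch as soon as some smaller gap has a smaller
period. -/
theorem eq_branch (hω : Z ^ 2 / 4 < ω) (hη : η ∈ Ioo 0 (theta ω Z)) (hT : Tplus η ω Z = 2 * L)
    (hlt : ∃ D' ∈ Ioo ((|Z| / √2) ^ 2) ((etaOne η ω - η) ^ 2),
      gapPeriod D' ω (|Z| / √2) < L / √2) : η = branch L (ω, Z) := by
  obtain ⟨-, h1, h2, h3⟩ := gap_of_mem_Ioo hω hη
  rw [Tplus_eq_gapPeriod hω hη, two_sqrt_two_mul_eq] at hT
  have hU : IsUpperRoot (L / √2) ω (|Z| / √2) ((etaOne η ω - η) ^ 2) :=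
    ⟨⟨by rwa [abs_div_sqrt_two_sq], h2⟩, hT, hlt⟩
  rw [branch, ← hU.eq_upperRoot (by positivity), h3]

/-- A bound independent of `(ω, Z)`, from `a ≤ K ≤ π η₁ / (2 η)`. -/
theorem IsAmplitude.le_of_Tplus_eq (hL : 0 < L) (h : IsAmplitude η ω Z)
    (hT : Tplus η ω Z = 2 * L) : η ≤ √2 * Real.pi / L := by
  have hb := h.etaOne_pos
  have hη := h.pos
  have hk : √(1 - modulus η ω ^ 2) = η / etaOne η ω := by
    rw [← Real.sqrt_sq (div_pos hη hb).le]
    congr 1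
    rw [div_pow, eq_div_iff (by positivity)]
    linarith [h.modulus_sq_mul]
  have h1 := ellK_le h.modulus_sq_lt_one
  have h2 := h.shift_spec.1.2
  rw [hk] at h1
  have h3 : Tplus η ω Z ≤ 2 * √2 / etaOne η ω * (2 * (Real.pi / 2 / (η / etaOne η ω))) := by
    rw [Tplus]
    exact mul_le_mul_of_nonneg_left (by linarith) (by positivity)
  have e : 2 * √2 / etaOne η ω * (2 * (Real.pi / 2 / (η / etaOne η ω)))
      = 2 * (√2 * Real.pi) / η := by
    field_simp
  rw [hT, e, le_div_iff₀ hη] at h3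
  rw [le_div_iff₀ hL]
  linarith

theorem contDiffAt_abs_div_sqrt_two (hZ : Z < 0) :
    ContDiffAt ℝ (⊤ : WithTop ℕ∞) (fun p : ℝ × ℝ => |p.2| / √2) (ω, Z) := by
  have : ContDiffAt ℝ (⊤ : WithTop ℕ∞) (fun p : ℝ × ℝ => -p.2 / √2) (ω, Z) := by fun_prop
  refine this.congr_of_eventuallyEq ?_
  filter_upwards [continuousAt_snd.eventually_lt_const (show (ω, Z).2 < 0 from hZ)] with p hp
  rw [abs_of_neg hp]

theorem continuousAt_absDiv :
    ContinuousAt (fun p : ℝ × ℝ => (p.1, |p.2| / √2)) (ω, Z) := by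
  have : Continuous fun p : ℝ × ℝ => (p.1, |p.2| / √2) := by fun_prop
  exact this.continuousAt

theorem HasBranch.exists_root (h : HasBranch L ω Z) : ∃ ρ : ℝ × ℝ → ℝ,
    ContDiffAt ℝ (⊤ : WithTop ℕ∞) ρ (ω, |Z| / √2) ∧
    (fun p : ℝ × ℝ => upperRoot (L / √2) p.1 (|p.2| / √2))
      =ᶠ[𝓝 (ω, Z)] fun p => ρ (p.1, |p.2| / √2) := by
  obtain ⟨ρ, h1, -, h2⟩ := h.isUpperRoot.exists_analytic (by positivity)
  refine ⟨ρ, h1, ?_⟩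
  filter_upwards [(continuousAt_absDiv (ω := ω) (Z := Z)).eventually h2] with p hp
  exact (hp.eq_upperRoot (by positivity)).symm

theorem HasBranch.eventually (h : HasBranch L ω Z) :
    ∀ᶠ p : ℝ × ℝ in 𝓝 (ω, Z), HasBranch L p.1 p.2 := by
  obtain ⟨D', hD', hlt⟩ := h
  filter_upwards [(continuousAt_absDiv (ω := ω) (Z := Z)).eventually
    (eventually_gapPeriod_lt hD' hlt)] with p hp
  exact ⟨D', hp.1, hp.2⟩

theorem HasBranch.continuousAt_branch (h : HasBranch L ω Z) :
    ContinuousAt (branch L) (ω, Z) := by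
  obtain ⟨ρ, h1, h2⟩ := h.exists_root
  have h3 : ContinuousAt (fun p : ℝ × ℝ => upperRoot (L / √2) p.1 (|p.2| / √2)) (ω, Z) :=
    (h1.continuousAt.comp (x := (ω, Z)) (f := fun p : ℝ × ℝ => (p.1, |p.2| / √2))
      continuousAt_absDiv).congr h2.symm
  unfold branch etaOfGap
  fun_prop

theorem HasBranch.contDiffAt_branch (h : HasBranch L ω Z) (hZ : Z < 0) :
    ContDiffAt ℝ (⊤ : WithTop ℕ∞) (branch L) (ω, Z) := by
  obtain ⟨ρ, h1, h2⟩ := h.exists_root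
  have h3 : ContDiffAt ℝ (⊤ : WithTop ℕ∞)
      (fun p : ℝ × ℝ => upperRoot (L / √2) p.1 (|p.2| / √2)) (ω, Z) :=
    (h1.comp (ω, Z) (f := fun p : ℝ × ℝ => (p.1, |p.2| / √2))
      (contDiffAt_fst.prodMk (contDiffAt_abs_div_sqrt_two hZ))).congr_of_eventuallyEq h2
  have hmem := h.isUpperRoot.mem
  have hpos : 0 < upperRoot (L / √2) ω (|Z| / √2) := (sq_nonneg _).trans_lt hmem.1
  have h4 := (contDiffAt_const (c := (4 : ℝ))).mul (contDiffAt_fst (𝕜 := ℝ) (E := ℝ) (F := ℝ)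
    (p := (ω, Z)) (n := (⊤ : WithTop ℕ∞)))
  exact (((h4.sub h3).sqrt (by simp only; linarith [hmem.2])).sub (h3.sqrt hpos.ne')).div_const 2

/-- The parameters `(ω, φ(0), φ'(0))` of the profile on the branch. -/
noncomputable def profileParams (L : ℝ) (p : ℝ × ℝ) : ℝ × ℝ × ℝ :=
  (p.1, Phi (branch L p) p.1 p.2, |p.2| / 2 * Phi (branch L p) p.1 p.2)

theorem HasBranch.continuousAt_profileParams (h : HasBranch L ω Z) :
    ContinuousAt (profileParams L) (ω, Z) := by
  have h1 := h.continuousAt_branch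
  unfold profileParams Phi
  fun_prop

theorem HasBranch.contDiffAt_profileParams (h : HasBranch L ω Z) (hZ : Z < 0) :
    ContDiffAt ℝ (⊤ : WithTop ℕ∞) (profileParams L) (ω, Z) := by
  have h1 := h.contDiffAt_branch hZ
  have hA := h.isAmplitude
  have hgap := (gap_of_mem_Ioo h.sq_lt h.branch_spec.1).2.1
  have hsq := hA.etaOne_sq
  have hprod := mul_pos hA.pos hA.etaOne_pos
  set η := branch L (ω, Z) with hη
  -- The radicands vanish only at the endpoint `η = θ`, where `D = Z² / 2`.
  have hdisc : 0 < (2 * ω - Z ^ 2 / 2) ^ 2 - 4 * η ^ 2 * (2 * ω - η ^ 2) := by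
    have e : (2 * ω - Z ^ 2 / 2) ^ 2 - 4 * η ^ 2 * (2 * ω - η ^ 2)
        = ((etaOne η ω - η) ^ 2 - Z ^ 2 / 2)
          * ((etaOne η ω - η) ^ 2 - Z ^ 2 / 2 + 4 * (η * etaOne η ω)) := by
      have e1 : 2 * ω = etaOne η ω ^ 2 + η ^ 2 := by linarith
      rw [e1]
      ring
    rw [e]
    exact mul_pos (by linarith) (by linarith)
  have hout : 0 < ((2 * ω - Z ^ 2 / 2)
      + √((2 * ω - Z ^ 2 / 2) ^ 2 - 4 * η ^ 2 * (2 * ω - η ^ 2))) / 2 := by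
    have := Real.sqrt_pos.2 hdisc
    nlinarith [h.sq_lt]
  have h2 : ContDiffAt ℝ (⊤ : WithTop ℕ∞) (fun p : ℝ × ℝ => 2 * p.1 - p.2 ^ 2 / 2) (ω, Z) := by
    fun_prop
  have h3 : ContDiffAt ℝ (⊤ : WithTop ℕ∞) (fun p : ℝ × ℝ => (2 * p.1 - p.2 ^ 2 / 2) ^ 2
      - 4 * branch L p ^ 2 * (2 * p.1 - branch L p ^ 2)) (ω, Z) := by
    fun_prop
  have h4 : ContDiffAt ℝ (⊤ : WithTop ℕ∞) (fun p : ℝ × ℝ => Phi (branch L p) p.1 p.2) (ω, Z) :=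
    ((h2.add (h3.sqrt hdisc.ne')).div_const 2).sqrt hout.ne'
  have h5 : ContDiffAt ℝ (⊤ : WithTop ℕ∞) (fun p : ℝ × ℝ => |p.2| / 2) (ω, Z) := by
    have := (contDiffAt_abs_div_sqrt_two (ω := ω) hZ).mul (contDiffAt_const (c := √2 / 2))
    refine this.congr_of_eventuallyEq (Eventually.of_forall fun p => ?_)
    have : √2 ≠ 0 := by positivity
    simp only
    field_simp
  exact contDiffAt_fst.prodMk (h4.prodMk (h5.mul h4))

theorem HasBranch.slopeFlow_spec (hL : 0 ≤ L) (h : HasBranch L ω Z) :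
    ContDiffAt ℝ (⊤ : WithTop ℕ∞) (slopeFlow hL) (profileParams L (ω, Z)) ∧
      ∀ ξ : Icc (0 : ℝ) L, profileOf hL (profileParams L (ω, Z)).2.1
        (slopeFlow hL (profileParams L (ω, Z))) ξ = arc (branch L (ω, Z)) ω Z ξ := by
  have hA := h.isAmplitude
  have h1 := slopeFlow_of_hasDerivAt hL hA.hasDerivAt_arc hA.hasDerivAt_arcDeriv
  rwa [hA.arc_zero, hA.arcDeriv_zero] at h1

/-- The value at the peak and the derivative on `[0, L]` of the profile on the branch. -/
noncomputable def profileData (hL : 0 ≤ L) (p : ℝ × ℝ) : ℝ × C(Icc (0 : ℝ) L, ℝ) :=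
  ((profileParams L p).2.1, slopeFlow hL (profileParams L p))

theorem HasBranch.continuousAt_profileData (hL : 0 ≤ L) (h : HasBranch L ω Z) :
    ContinuousAt (profileData hL) (ω, Z) := by
  have h1 := h.continuousAt_profileParams
  have h2 := (h.slopeFlow_spec hL).1.continuousAt.comp (x := (ω, Z)) h1
  exact (h1.snd.fst).prodMk h2

theorem HasBranch.contDiffAt_profileData (hL : 0 ≤ L) (h : HasBranch L ω Z) (hZ : Z < 0) :
    ContDiffAt ℝ (⊤ : WithTop ℕ∞) (profileData hL) (ω, Z) := by
  have h1 := h.contDiffAt_profileParams hZ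
  exact (h1.snd.fst).prodMk ((h.slopeFlow_spec hL).1.comp (ω, Z) h1)

theorem HasBranch.zetaPeak_eq_profileOf (hL : 0 < L) (h : HasBranch L ω Z) {x : ℝ}
    (hx : |x| ≤ L) : zetaPeak L (branch L (ω, Z)) ω Z x
      = profileL hL.le (profileData hL.le (ω, Z)) ⟨|x|, abs_nonneg x, hx⟩ := by
  rw [zetaPeak_eq, periodize_eq_of_abs_le hL hx, profileL_apply, profileData,
    (h.slopeFlow_spec hL.le).2]

theorem HasBranch.represents (hL : 0 < L) (h : HasBranch L ω Z) :
    Represents L (evenExtendL hL.le (profileData hL.le (ω, Z)))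
      (zetaPeak L (branch L (ω, Z)) ω Z) :=
  represents_evenExtendL hL.le fun _ hx => h.zetaPeak_eq_profileOf hL hx

theorem HasBranch.contDiffAt_evenExtendL (hL : 0 ≤ L) (h : HasBranch L ω Z) (hZ : Z < 0) :
    ContDiffAt ℝ (⊤ : WithTop ℕ∞) (fun p => evenExtendL hL (profileData hL p)) (ω, Z) :=
  (h.contDiffAt_profileData hL hZ).continuousLinearMap_comp (evenExtendL hL)

theorem HasBranch.analyticAt_evenExtendL (hL : 0 ≤ L) (h : HasBranch L ω Z) (hZ : Z < 0) :
    AnalyticAt ℝ (fun Z => evenExtendL hL (profileData hL (ω, Z))) Z :=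
  ((h.contDiffAt_evenExtendL hL hZ).comp Z (f := fun Z : ℝ => (ω, Z))
    (contDiffAt_const.prodMk contDiffAt_id)).analyticAt

theorem HasBranch.contDiffAt_evenExtendL_left (hL : 0 ≤ L) (h : HasBranch L ω Z) (hZ : Z < 0) :
    ContDiffAt ℝ (⊤ : ℕ∞) (fun ω => evenExtendL hL (profileData hL (ω, Z))) ω :=
  ((h.contDiffAt_evenExtendL hL hZ).comp ω (f := fun ω : ℝ => (ω, Z))
    (contDiffAt_id.prodMk contDiffAt_const)).of_le le_top

/-- A continuous solution of the period equation which meets the branch stays on it. -/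
theorem eqOn_branch {W : Set (ℝ × ℝ)} (hW : IsOpen W) (hWc : IsPreconnected W)
    (hWb : ∀ p ∈ W, HasBranch L p.1 p.2) (hWZ : ∀ p ∈ W, p.2 < 0) {g : ℝ × ℝ → ℝ}
    (hg : ContinuousOn g W) (hmem : ∀ p ∈ W, g p ∈ Ioo 0 (theta p.1 p.2))
    (hT : ∀ p ∈ W, Tplus (g p) p.1 p.2 = 2 * L) {p₀ : ℝ × ℝ} (hp₀ : p₀ ∈ W)
    (h₀ : g p₀ = branch L p₀) : EqOn g (branch L) W := by
  have hgc : ∀ p ∈ W, ContinuousAt g p := fun p hp => hg.continuousAt (hW.mem_nhds hp)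
  have hbc : ContinuousOn (branch L) W := fun p hp =>
    ((hWb p hp).contDiffAt_branch (hWZ p hp)).continuousAt.continuousWithinAt
  -- Close to the branch the witness `D'` of the upper root still lies below the gap of `g`.
  have hu : IsOpen {p ∈ W | g p = branch L p} := by
    refine isOpen_iff_mem_nhds.2 fun p ⟨hp, he⟩ => ?_
    obtain ⟨D', hD', hlt⟩ := (hWb p hp).isUpperRoot.exists_lt
    have e1 := (continuousAt_absDiv (ω := p.1) (Z := p.2)).eventually (eventually_gapPeriod_lt
      ⟨hD'.1, hD'.2.trans (hWb p hp).isUpperRoot.mem.2⟩ hlt)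
    have h1 := hgc p hp
    have h2 : ContinuousAt (fun q : ℝ × ℝ => (etaOne (g q) q.1 - g q) ^ 2) p := by
      unfold etaOne
      fun_prop
    have e2 := h2.eventually_const_lt (u := D') (by
      simp only [he]
      exact hD'.2.trans_eq (hWb p hp).branch_spec.2.2.symm)
    filter_upwards [e1, e2, hW.mem_nhds hp] with q a1 a2 a3
    exact ⟨a3, eq_branch (hWb q a3).sq_lt (hmem q a3) (hT q a3) ⟨D', ⟨a1.1.1, a2⟩, a1.2⟩⟩
  have hv : IsOpen {p ∈ W | g p ≠ branch L p} := by
    have := (hg.sub hbc).isOpen_inter_preimage hW (isOpen_compl_singleton (x := (0 : ℝ)))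
    convert this using 1
    ext p
    simp [sub_eq_zero]
  have hsub := hWc.subset_left_of_subset_union hu hv
    (disjoint_left.2 fun p hp hp' => hp'.2 hp.2)
    (fun p hp => (em (g p = branch L p)).imp (fun h => ⟨hp, h⟩) fun h => ⟨hp, h⟩)
    ⟨p₀, hp₀, hp₀, h₀⟩
  exact fun p hp => (hsub hp).2

theorem exists_nu (hL : 0 < L) (hZ : Z < 0) : ∃ c, HasBranch L c Z ∧
    L / √2 ≤ 3 * quarterInt (Z ^ 2 / 2) c ∧ ¬HasBranch L (c + Z) Z := by
  have hm : 0 < |Z| / √2 := div_pos (abs_pos.2 hZ.ne) (by positivity)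
  obtain ⟨c, h1, h2, h3⟩ := exists_threshold hm (show 0 < L / √2 by positivity) (neg_pos.2 hZ)
  rw [abs_div_sqrt_two_sq] at h2
  rw [sub_neg_eq_add] at h3
  exact ⟨c, h1, h2, h3⟩

open Classical in
/-- The frequency threshold `ν(Z)`, within `|Z|` of the infimum of the frequencies on the branch,
and at or below the frequencies at which the period at `η = θ` is `2L`. -/
noncomputable def nu (L Z : ℝ) : ℝ :=
  if h : ∃ c, HasBranch L c Z ∧ L / √2 ≤ 3 * quarterInt (Z ^ 2 / 2) c ∧ ¬HasBranch L (c + Z) Z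
  then h.choose else Real.pi ^ 2 / (2 * L ^ 2)

/-- At `Z = 0` the two conditions on a candidate contradict each other, so the default value is taken. -/
theorem nu_zero (L : ℝ) : nu L 0 = Real.pi ^ 2 / (2 * L ^ 2) := by
  rw [nu, dif_neg]
  rintro ⟨c, h1, -, h2⟩
  rw [add_zero] at h2
  exact h2 h1

theorem nu_spec (hL : 0 < L) (hZ : Z < 0) : HasBranch L (nu L Z) Z ∧
    L / √2 ≤ 3 * quarterInt (Z ^ 2 / 2) (nu L Z) ∧ ¬HasBranch L (nu L Z + Z) Z := by
  rw [nu, dif_pos (exists_nu hL hZ)]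
  exact (exists_nu hL hZ).choose_spec

theorem HasBranch.lt_omega (h : HasBranch L ω Z) : Real.pi ^ 2 / (2 * L ^ 2) < ω := by
  rw [← pi_sq_div_level]
  exact IsSolvable.lt_omega (by positivity) h

theorem quarterInt_lt_of_admissible (hZ : Z < 0) (h : Admissible L ω Z) :
    3 * quarterInt (Z ^ 2 / 2) ω < L / √2 := by
  have h1 := h.2.1
  rw [Tone_eq_quarterInt h.1 hZ.ne] at h1
  have h2 : √2 * √2 = 2 := Real.mul_self_sqrt zero_le_two
  rw [lt_div_iff₀ (by positivity)]
  linarith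

theorem nu_lt_of_admissible (hL : 0 < L) (hZ : Z < 0) (h : Admissible L ω Z) : nu L Z < ω := by
  by_contra! hle
  have h1 := quarterInt_lt_of_admissible hZ h
  have h2 := quarterInt_anti (D := Z ^ 2 / 2) (by positivity) (by linarith [h.1]) hle
  linarith [(nu_spec hL hZ).2.1]

theorem eq_branch_of_admissible (hZ : Z < 0) (h : Admissible L ω Z)
    (hη : η ∈ Ioo 0 (theta ω Z)) (hT : Tplus η ω Z = 2 * L) : η = branch L (ω, Z) := by
  refine eq_branch h.1 hη hT (exists_lt_of_quarterInt_lt (by positivity) ?_ ?_ ?_)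
  · rw [abs_div_sqrt_two_sq]
    linarith [h.1]
  · rw [abs_div_sqrt_two_sq]
    exact quarterInt_lt_of_admissible hZ h
  · rw [abs_div_sqrt_two_sq]
    exact (gap_of_mem_Ioo h.1 hη).2.1

/-- All frequencies above `ν(Z₀)` are on the branch, uniformly for `Z` near `Z₀`. -/
theorem exists_Ioo_hasBranch (hL : 0 < L) (hZ : Z < 0) : ∃ v₁ v₂ : ℝ, v₂ ≤ 0 ∧ Z ∈ Ioo v₁ v₂ ∧
    ∀ p ∈ Ioi (nu L Z) ×ˢ Ioo v₁ v₂, HasBranch L p.1 p.2 := by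
  have h1 := (nu_spec hL hZ).1.eventually
  have h2 : ∀ᶠ Z' in 𝓝 Z, HasBranch L (nu L Z) Z' :=
    (show ContinuousAt (fun Z' : ℝ => (nu L Z, Z')) Z by fun_prop).eventually h1
  obtain ⟨v₁, v₂, hmem, hsub⟩ := mem_nhds_iff_exists_Ioo_subset.1 h2
  refine ⟨v₁, min v₂ 0, min_le_right _ _, ⟨hmem.1, lt_min hmem.2 hZ⟩, fun p hp => ?_⟩
  exact HasBranch.mono (hsub ⟨hp.2.1, hp.2.2.trans_le (min_le_left _ _)⟩) (le_of_lt hp.1)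

/-! ### The limit of vanishing defect -/

theorem hasBranch_zero (hL : 0 < L) (hω : Real.pi ^ 2 / (2 * L ^ 2) < ω) : HasBranch L ω 0 := by
  have hω0 : 0 < ω := lt_of_le_of_lt (by positivity) hω
  rw [← pi_sq_div_level] at hω
  obtain ⟨D', h1, h2⟩ := exists_lt_of_lt_omega (show 0 < L / √2 by positivity) hω
    (show 0 < 2 * ω by linarith)
  exact ⟨D', by simpa using h1, by simpa using h2⟩

theorem theta_zero (ω : ℝ) : theta ω 0 = √ω := by simp [theta]

theorem IsAmplitude.Tplus_zero (h : IsAmplitude η ω 0) : Tplus η ω 0 = dnoidalPeriod η ω := by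
  rw [Tplus, h.shift_eq_zero, add_zero, dnoidalPeriod]

theorem eq_branch_zero (hL : 0 < L) (hω : Real.pi ^ 2 / (2 * L ^ 2) < ω)
    (hη : η ∈ Ioo 0 (√ω)) (hT : dnoidalPeriod η ω = 2 * L) : η = branch L (ω, 0) := by
  rw [← theta_zero] at hη
  have h0 := (hasBranch_zero hL hω).sq_lt
  have hA := (gap_of_mem_Ioo h0 hη).1
  rw [← hA.Tplus_zero] at hT
  rw [← pi_sq_div_level] at hω
  refine eq_branch h0 hη hT ?_
  have := exists_lt_of_lt_omega (show 0 < L / √2 by positivity) hω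
    (show 0 < (etaOne η ω - η) ^ 2 from pow_pos (sub_pos.2 hA.lt_etaOne) 2)
  simpa using this

/-- Solvability persists at a smaller frequency `ω'`, and `ν(Z)` exceeds the infimum by at most `|Z|`. -/
theorem eventually_nu_lt (hL : 0 < L) (hω : Real.pi ^ 2 / (2 * L ^ 2) < ω) :
    ∀ᶠ Z in 𝓝[<] (0 : ℝ), nu L Z < ω := by
  obtain ⟨ω', h1, h2⟩ := exists_between hω
  have h3 : ∀ᶠ Z in 𝓝 (0 : ℝ), HasBranch L ω' Z :=
    (show ContinuousAt (fun Z : ℝ => (ω', Z)) 0 by fun_prop).eventually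
      (hasBranch_zero hL h1).eventually
  filter_upwards [h3.filter_mono nhdsWithin_le_nhds,
    Ioo_mem_nhdsLT (show ω' - ω < 0 by linarith)] with Z hZ hZ'
  by_contra! hle
  exact (nu_spec hL hZ'.2).2.2 (hZ.mono (by linarith [hZ'.1]))

theorem tendsto_zetaPeak (hL : 0 < L) (hω : Real.pi ^ 2 / (2 * L ^ 2) < ω) {ξ : ℝ}
    (hξ : ξ ∈ Icc (-L) L) :
    Tendsto (fun Z => zetaPeak L (branch L (ω, Z)) ω Z ξ) (𝓝[<] 0)
      (𝓝 (dnoidalWave (branch L (ω, 0)) ω ξ)) := by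
  have h0 := hasBranch_zero hL hω
  have hA := h0.isAmplitude
  have hξ' : |ξ| ≤ L := abs_le.2 hξ
  set x : Icc (0 : ℝ) L := ⟨|ξ|, abs_nonneg ξ, hξ'⟩ with hx
  have hpath : ContinuousAt (fun Z : ℝ => (ω, Z)) 0 := by fun_prop
  have h1 : ContinuousAt (fun Z => profileL hL.le (profileData hL.le (ω, Z)) x) 0 :=
    (((ContinuousMap.evalCLM ℝ x).continuous.comp (profileL hL.le).continuous).continuousAt).comp
      ((h0.continuousAt_profileData hL.le).comp (x := (0 : ℝ)) (f := fun Z : ℝ => (ω, Z)) hpath)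
  have h2 : profileL hL.le (profileData hL.le (ω, 0)) x = dnoidalWave (branch L (ω, 0)) ω ξ := by
    rw [← h0.zetaPeak_eq_profileOf hL hξ', zetaPeak_eq, periodize_eq_of_abs_le hL hξ', arc,
      hA.shift_eq_zero, sub_zero, dnoidalWave]
    rcases abs_choice ξ with h | h <;> rw [h]
    rw [mul_neg, jacobiDn_neg hA.modulus_sq_lt_one]
  have h3 := h1.tendsto
  rw [h2] at h3
  refine (h3.mono_left nhdsWithin_le_nhds).congr' ?_
  filter_upwards [(hpath.eventually h0.eventually).filter_mono nhdsWithin_le_nhds] with Z hZ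
  exact (HasBranch.zetaPeak_eq_profileOf hL hZ hξ').symm

end Branch

end DnoidalPeak

theorem theorem5p5 (L : ℝ) (hL : 0 < L) :
    ∃ (ν : ℝ → ℝ) (Λ : ℝ × ℝ → ℝ),
      ν 0 = Real.pi ^ 2 / (2 * L ^ 2) ∧
      (∀ Z₀ < 0, Z₀ ^ 2 / 4 < ν Z₀ ∧ Real.pi ^ 2 / (2 * L ^ 2) < ν Z₀) ∧
      (∀ Z₀ < 0, ∀ ω₁, Admissible L ω₁ Z₀ →
        ν Z₀ < ω₁ ∧
        (∃! η, η ∈ Ioo 0 (theta ω₁ Z₀) ∧ Tplus η ω₁ Z₀ = 2 * L) ∧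
        ∀ η₀ ∈ Ioo 0 (theta ω₁ Z₀), Tplus η₀ ω₁ Z₀ = 2 * L →
          ∃ v₁ v₂ n₁ n₂ : ℝ, v₂ ≤ 0 ∧ Z₀ ∈ Ioo v₁ v₂ ∧ η₀ ∈ Ioo n₁ n₂ ∧
            IsBranch L (Ioi (ν Z₀) ×ˢ Ioo v₁ v₂) (Ioo n₁ n₂) ω₁ Z₀ η₀ Λ ∧
            (∀ g, IsBranch L (Ioi (ν Z₀) ×ˢ Ioo v₁ v₂) (Ioo n₁ n₂) ω₁ Z₀ η₀ g →
              EqOn g Λ (Ioi (ν Z₀) ×ˢ Ioo v₁ v₂)) ∧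
            (∀ ω ∈ Ioi (ν Z₀), ∀ Z ∈ Ioo v₁ v₂,
              IsPeriodicPeak L ω Z (zetaPeak L (Λ (ω, Z)) ω Z) ∧
              (∀ ξ, 0 < zetaPeak L (Λ (ω, Z)) ω Z ξ) ∧
              (∀ ξ, zetaPeak L (Λ (ω, Z)) ω Z (-ξ) = zetaPeak L (Λ (ω, Z)) ω Z ξ)) ∧
            ∃ G : ℝ → ℝ → H1per L,
              (∀ ω ∈ Ioi (ν Z₀), ∀ Z ∈ Ioo v₁ v₂,
                Represents L (G ω Z) (zetaPeak L (Λ (ω, Z)) ω Z)) ∧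
              (∀ ω ∈ Ioi (ν Z₀), AnalyticOnNhd ℝ (fun Z => G ω Z) (Ioo v₁ v₂)) ∧
              (∀ Z ∈ Ioo v₁ v₂, ContDiffOn ℝ (⊤ : ℕ∞) (fun ω => G ω Z) (Ioi (ν Z₀)))) ∧
      (∀ ω, Real.pi ^ 2 / (2 * L ^ 2) < ω →
        (Λ (ω, 0) ∈ Ioo 0 (√ω) ∧ dnoidalPeriod (Λ (ω, 0)) ω = 2 * L) ∧
        (∀ η ∈ Ioo 0 (√ω), dnoidalPeriod η ω = 2 * L → η = Λ (ω, 0)) ∧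
        shift (Λ (ω, 0)) ω 0 = 0 ∧
        (∀ᶠ Z in 𝓝[<] (0 : ℝ), ν Z < ω) ∧
        Tendsto (fun Z => Λ (ω, Z)) (𝓝[<] 0) (𝓝 (Λ (ω, 0))) ∧
        ∀ ξ ∈ Icc (-L) L,
          Tendsto (fun Z => zetaPeak L (Λ (ω, Z)) ω Z ξ) (𝓝[<] 0)
            (𝓝 (dnoidalWave (Λ (ω, 0)) ω ξ))) := by
  refine ⟨nu L, branch L, nu_zero L,
    fun Z₀ hZ₀ => ⟨(nu_spec hL hZ₀).1.sq_lt, (nu_spec hL hZ₀).1.lt_omega⟩, ?_, ?_⟩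
  · intro Z₀ hZ₀ ω₁ hadm
    have hν := nu_lt_of_admissible hL hZ₀ hadm
    have hB₁ : HasBranch L ω₁ Z₀ := (nu_spec hL hZ₀).1.mono hν.le
    refine ⟨hν, ⟨branch L (ω₁, Z₀), ⟨hB₁.branch_spec.1, hB₁.branch_spec.2.1⟩,
      fun η hη => eq_branch_of_admissible hZ₀ hadm hη.1 hη.2⟩, fun η₀ hη₀ hT₀ => ?_⟩
    have e₀ : η₀ = branch L (ω₁, Z₀) := eq_branch_of_admissible hZ₀ hadm hη₀ hT₀
    obtain ⟨v₁, v₂, hv₂, hmem, hW⟩ := exists_Ioo_hasBranch hL hZ₀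
    have hWZ : ∀ p ∈ Ioi (nu L Z₀) ×ˢ Ioo v₁ v₂, p.2 < 0 := fun p hp => hp.2.2.trans_le hv₂
    have hW' : ∀ ω ∈ Ioi (nu L Z₀), ∀ Z ∈ Ioo v₁ v₂, HasBranch L ω Z := fun ω hω Z hZ =>
      hW (ω, Z) ⟨hω, hZ⟩
    have hp₁ : (ω₁, Z₀) ∈ Ioi (nu L Z₀) ×ˢ Ioo v₁ v₂ := ⟨hν, hmem⟩
    have hbound : ∀ p ∈ Ioi (nu L Z₀) ×ˢ Ioo v₁ v₂,
        branch L p ∈ Ioo 0 (√2 * Real.pi / L + 1) := fun p hp =>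
      ⟨(hW p hp).isAmplitude.pos, lt_of_le_of_lt
        ((hW p hp).isAmplitude.le_of_Tplus_eq hL (hW p hp).branch_spec.2.1) (lt_add_one _)⟩
    refine ⟨v₁, v₂, 0, √2 * Real.pi / L + 1, hv₂, hmem, by rw [e₀]; exact hbound _ hp₁,
      ?_, ?_, ?_, ?_⟩
    · exact
        { smooth := fun p hp =>
            (((hW p hp).contDiffAt_branch (hWZ p hp)).of_le le_top).contDiffWithinAt
          mapsTo := hbound
          mem_domain := fun p hp => (hW p hp).branch_spec.1
          base := e₀.symm
          period := fun p hp => (hW p hp).branch_spec.2.1 }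
    · intro g hg
      exact eqOn_branch (isOpen_Ioi.prod isOpen_Ioo) (isPreconnected_Ioi.prod isPreconnected_Ioo)
        hW hWZ hg.smooth.continuousOn hg.mem_domain hg.period hp₁ (hg.base.trans e₀)
    · intro ω hω Z hZ
      have hB := hW' ω hω Z hZ
      refine ⟨hB.isAmplitude.isPeriodicPeak hL (hZ.2.trans_le hv₂).le hB.branch_spec.2.1,
        hB.isAmplitude.zetaPeak_pos L, fun ξ => ?_⟩
      rw [zetaPeak_eq]
      exact periodize_neg ξ
    · refine ⟨fun ω Z => evenExtendL hL.le (profileData hL.le (ω, Z)),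
        fun ω hω Z hZ => (hW' ω hω Z hZ).represents hL,
        fun ω hω Z hZ => (hW' ω hω Z hZ).analyticAt_evenExtendL hL.le (hZ.2.trans_le hv₂),
        fun Z hZ ω hω => ((hW' ω hω Z hZ).contDiffAt_evenExtendL_left hL.le
          (hZ.2.trans_le hv₂)).contDiffWithinAt⟩
  · intro ω hω
    have h0 := hasBranch_zero hL hω
    refine ⟨⟨?_, ?_⟩, fun η hη hT => eq_branch_zero hL hω hη hT, h0.isAmplitude.shift_eq_zero,
      eventually_nu_lt hL hω, ?_, fun ξ hξ => tendsto_zetaPeak hL hω hξ⟩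
    · rw [← theta_zero]
      exact h0.branch_spec.1
    · rw [← h0.isAmplitude.Tplus_zero]
      exact h0.branch_spec.2.1
    · have hpath : ContinuousAt (fun Z : ℝ => (ω, Z)) 0 := by fun_prop
      exact (h0.continuousAt_branch.comp (x := (0 : ℝ)) (f := fun Z : ℝ => (ω, Z))
        hpath).tendsto.mono_left nhdsWithin_le_nhds
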